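/- Let $p\ge 5$ be odd and $q\ge 3$, and let $\Gamma=\langle s_i\ (i\in\mathbb Z/p)\mid s_i^q=1,\ [s_i,s_{i+1}]=1\rangle$. The chambers of the Bourdon building $I_{p,q}$ are identified with the elements of $\Gamma$: the edges of a chamber $g$ are labelled by $i\in\mathbb Z/p$, and the $q$ chambers containing its edge $i$ are the $gs_i^k$. Put in every chamber $g$ a perfect tensor $T_g$ of bond dimension $d$ (a tensor that, for every set of at most half of its legs, is proportional to an isometry from these legs to the others; normalize it as a unit vector) with $q-1$ contracted legs across each edge, one towards each other chamber containing this edge, and $q-1$ dangling (bulk) legs. Fix a central tile $O$ and a unit vector $|\mathrm{ref}\rangle\in\mathbb C^d$. Layers are measured by the distance to $O$ in the graph of the network. For $\Lambda\ge 0$, $\mathcal H^\Lambda_{code}$ has one qudit $\mathbb C^d$ for each bulk leg of a tile at distance at most $\Lambda$, $\mathcal H^\Lambda_{phys}$ has one qudit for each boundary leg (a link from layer $\Lambda$ to layer $\Lambda+1$), and $u^\Lambda:\mathcal H^\Lambda_{code}\to\mathcal H^\Lambda_{phys}$ is the contraction of the truncated network, normalized by a factor $\sqrt d$ for each internal link and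 each bulk leg. For a state $\chi$ of the bulk legs of layer $\Lambda+1$, let $V^\Lambda_\chi:\mathcal H^\Lambda_{phys}\to\mathcal H^{\Lambda+1}_{phys}$ be the contraction of layer $\Lambda+1$, normalized in the same way, with its bulk legs in the state $\chi$. The map $\mathcal H^\Lambda_{code}\to\mathcal H^{\Lambda+1}_{code}$ tensors with $|\mathrm{ref}\rangle$ on each new bulk leg, and the map $\mathcal H^\Lambda_{phys}\to\mathcal H^{\Lambda+1}_{phys}$ is $V^\Lambda_\chi$ for $\chi$ the product of the states $|\mathrm{ref}\rangle$. The tree-wall through an edge is the set of edges obtained from it by repeatedly adding, at each end of an edge, the edges at distance $2$ from it in the link of that end. Let $T$ be a tile, and let $J=\{i\}$ (an edge of $T$) or $J=\{i,i+1\}$ (two edges meeting at a vertex of $T$). The entanglement wedge $W$ of $(T,J)$ is the connected component of $T$ after the building is cut along the tree-walls through the edges of $T$ with label in $J$. Assume that $O$ and $T$ are separated by each of these tree-walls. For a set $R$ of tiles, $\mathcal A^\Lambda_{code}(R)$ is the algebra of all operators on the bulk qudits of the tiles of $R$ at distance at most $\Lambda$, and $\mathcal A^\Lambda_{phys}(R)$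 is the algebra of all operators on the boundary legs at $\Lambda$ that lead to a tile of $R$ in layer $\Lambda+1$. They act on $\mathcal H^\Lambda_{code}$ and $\mathcal H^\Lambda_{phys}$ as $A\otimes 1$. **Theorem.** The Hilbert spaces above have inductive limits $\mathcal H_{code}$ and $\mathcal H_{phys}$ (complete, with compatible isometric embeddings whose ranges have dense union), and the maps $u^\Lambda$ induce an isometry $u:\mathcal H_{code}\to\mathcal H_{phys}$. For every wedge $W$ as above, and both for $R=W$ and for its complement $R=W^c$, there are unital $*$-homomorphisms $\iota^\Lambda:\mathcal A^\Lambda_{code}(R)\to\mathcal A^\Lambda_{phys}(R)$ and $\kappa^\Lambda:\mathcal A^\Lambda_{phys}(R)\to\mathcal A^{\Lambda+1}_{phys}(R)$ such that, for all $\Lambda\ge 0$, $A\in\mathcal A^\Lambda_{code}(R)$, $B\in\mathcal A^\Lambda_{phys}(R)$ and all $\chi$, $$\iota^\Lambda(A)u^\Lambda=u^\Lambda A,\qquad \kappa^\Lambda(B)V^\Lambda_\chi=V^\Lambda_\chi B,\qquad \kappa^\Lambda(\iota^\Lambda(A))=\iota^{\Lambda+1}(A\otimes 1),$$ and the following holds.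 The systems $(\mathcal A^\Lambda_{code}(R),\,A\mapsto A\otimes 1)$ and $(\mathcal A^\Lambda_{phys}(R),\kappa^\Lambda)$ have inductive limit $C^*$-algebras $\mathcal A_{code}$ and $\mathcal A_{phys}$ (with compatible isometric unital $*$-homomorphisms into the limit whose ranges have dense union). These act faithfully (isometrically) on $\mathcal H_{code}$ and $\mathcal H_{phys}$, by representations extending the actions at each $\Lambda$. The maps $\iota^\Lambda$ induce a unital isometric $*$-homomorphism $\iota:\mathcal A_{code}\to\mathcal A_{phys}$, and $\iota(A)u=uA$ for all $A\in\mathcal A_{code}$. -/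

import Mathlib

open scoped ComplexConjugate Kronecker

noncomputable section

namespace Bourdon

/-! ### The Bourdon building as a chamber system -/

/-- Relators of `⟨s_i (i ∈ ℤ/p) | s_i ^ q = 1, [s_i, s_{i+1}] = 1⟩`. -/
def relators (p q : ℕ) : Set (FreeGroup (ZMod p)) :=
  {r | ∃ i : ZMod p, r = FreeGroup.of i ^ q ∨
    r = FreeGroup.of i * FreeGroup.of (i + 1) * (FreeGroup.of i)⁻¹ * (FreeGroup.of (i + 1))⁻¹}

/-- The chambers of the Bourdon building `I_{p,q}`: the group `Γ_{p,q}` acts simply transitively on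
them, so they are the elements of `Γ_{p,q}`. The `p` edges of the chamber `g` are labelled
cyclically by `i : ZMod p`; the `q` chambers sharing the edge `i` of `g` are the `g * s_i ^ k`, and
the `q ^ 2` chambers sharing the vertex between the edges `i` and `i + 1` of `g` are the
`g * s_i ^ k * s_{i+1} ^ l`. -/
abbrev Chamber (p q : ℕ) : Type := PresentedGroup (relators p q)

/-- The generator `s_i` of `Γ_{p,q}`. -/
def gen (p q : ℕ) (i : ZMod p) : Chamber p q := PresentedGroup.of i

instance (p q : ℕ) : DecidableEq (Chamber p q) := Classical.decEq _

/-- The contracted legs of the tensor of a chamber: the leg `(i, k)` crosses the edge `i`, towards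
the `k`-th other chamber sharing this edge. There are `p * (q - 1)` of them. -/
abbrev ContractedLeg (p q : ℕ) : Type := ZMod p × {k : ZMod q // k ≠ 0}

/-- All the legs of the tensor of a chamber: the contracted legs and `q - 1` dangling (bulk) legs. -/
abbrev Leg (p q : ℕ) : Type := ContractedLeg p q ⊕ Fin (q - 1)

/-- The chamber at the other end of a contracted leg of `g`. -/
def neighbor {p q : ℕ} (g : Chamber p q) (l : ContractedLeg p q) : Chamber p q :=
  g * gen p q l.1 ^ (l.2 : ZMod q).val

/-- The link of the network along the contracted leg `l` of `g` (two chambers share at most one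
edge, so that a link is determined by its two ends). -/
def link {p q : ℕ} (g : Chamber p q) (l : ContractedLeg p q) : Sym2 (Chamber p q) :=
  s(g, neighbor g l)

/-- The graph of the tensor network: two chambers are adjacent when they share an edge. -/
def networkGraph (p q : ℕ) : SimpleGraph (Chamber p q) :=
  SimpleGraph.fromRel fun g h => ∃ l : ContractedLeg p q, h = neighbor g l

/-! ### Tree-walls and entanglement wedges -/

/-- The chambers with an edge on the tree-wall through the edge `i` of `T` (for such a chamber, it
is its edge `i`). The tree-wall is built from the edge `i` of `T` by repeatedly adding, at both ends
of an edge, the edges at distance two from it in the link of that end: at the common vertex of the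
edges `i` and `j = i ± 1` of `h`, these are the edges `i` of the chambers `h * s_j ^ k`. The case
`j = i` lists the other chambers containing the same edge. -/
inductive OnTreeWall {p q : ℕ} (T : Chamber p q) (i : ZMod p) : Chamber p q → Prop
  | base : OnTreeWall T i T
  | step (h : Chamber p q) (j : ZMod p) (k : ℕ) (hh : OnTreeWall T i h)
      (hj : j = i ∨ j = i + 1 ∨ j = i - 1) : OnTreeWall T i (h * gen p q j ^ k)

/-- Cut the building along the tree-walls through the edges of `T` with label in `J`; the component
of `T` is the set of chambers that are joined to `T` by a gallery crossing none of them.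
For `J = {i}` this is the entanglement wedge of the chamber `T` and its edge `i`, delimited by one
tree-wall; for `J = {i, i + 1}` it is that of `T` and the vertex between its edges `i` and `i + 1`,
delimited by two half-tree-walls. -/
def wedge {p q : ℕ} (T : Chamber p q) (J : Set (ZMod p)) : Set (Chamber p q) :=
  {D | Relation.ReflTransGen
    (fun g h => ∃ l : ContractedLeg p q, h = neighbor g l ∧ ¬ (l.1 ∈ J ∧ OnTreeWall T l.1 g)) T D}

/-! ### Perfect tensors and the network -/

/-- A tensor with legs `ι` and bond dimension `d` is perfect if, for every set `A` of at most half of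
the legs, it is proportional to an isometry from the legs in `A` to the other legs. -/
def IsPerfectTensor {ι : Type} [Fintype ι] [DecidableEq ι] {d : ℕ} (t : (ι → Fin d) → ℂ) : Prop :=
  ∀ (A : ι → Prop) [DecidablePred A], 2 * Fintype.card {l // A l} ≤ Fintype.card ι →
    ∃ c : ℝ, 0 < c ∧ ∀ a a' : {l // A l} → Fin d,
      ∑ b : {l // ¬ A l} → Fin d,
        conj (t ((Equiv.piEquivPiSubtypeProd A fun _ => Fin d).symm (a, b))) *
          t ((Equiv.piEquivPiSubtypeProd A fun _ => Fin d).symm (a', b)) = if a = a' then (c : ℂ) else 0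

/-- The data of an `I_{p,q}` tensor network with bond dimension `d`: a central tile, a perfect tensor
(normalized as a unit vector) in every chamber, and a reference state for the bulk qudits. -/
structure Network (p q d : ℕ) [NeZero p] [NeZero q] where
  center : Chamber p q
  tensor : Chamber p q → (Leg p q → Fin d) → ℂ
  perfect : ∀ g, IsPerfectTensor (tensor g)
  normalized : ∀ g, ∑ x, ‖tensor g x‖ ^ 2 = 1
  ref : EuclideanSpace ℂ (Fin d)
  norm_ref : ‖ref‖ = 1

/-! ### Systems of qudits -/

/-- The Hilbert space `(ℂ^d)^{⊗ X}` of one qudit at each site of `X`. -/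
abbrev Qudits (d : ℕ) {α : Type} (X : Finset α) : Type := EuclideanSpace ℂ (X → Fin d)

/-- The C⋆-algebra `M_d(ℂ)^{⊗ X}` of all operators on the qudits at the sites of `X`. -/
abbrev Op (d : ℕ) {α : Type} (X : Finset α) : Type := Qudits d X →L[ℂ] Qudits d X

section Qudits

variable {d : ℕ} {α : Type} [DecidableEq α] {X Y : Finset α}

/-- Basis labels on `Y` are pairs of labels on `X ⊆ Y` and on `Y \ X`. -/
def splitLabels (h : X ⊆ Y) : (Y → Fin d) ≃ (X → Fin d) × ((Y \ X : Finset α) → Fin d) where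
  toFun y := (fun s => y ⟨s, h s.2⟩, fun s => y ⟨s, (Finset.mem_sdiff.1 s.2).1⟩)
  invFun z s := if hs : (s : α) ∈ X then z.1 ⟨s, hs⟩ else z.2 ⟨s, Finset.mem_sdiff.2 ⟨s.2, hs⟩⟩
  left_inv y := by
    funext s
    by_cases hs : (s : α) ∈ X <;> simp [hs]
  right_inv z := by
    ext s
    · simp
    · have := (Finset.mem_sdiff.1 s.2).2
      simp [this]

/-- `ψ ↦ ψ ⊗ χ`, where `χ` is a state of the additional qudits. -/
def tensorState (h : X ⊆ Y) (χ : Qudits d (Y \ X)) : Qudits d X →ₗ[ℂ] Qudits d Y where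
  toFun ψ := WithLp.toLp 2 fun y => ψ (splitLabels h y).1 * χ (splitLabels h y).2
  map_add' ψ ψ' := by ext y; simp [add_mul]
  map_smul' c ψ := by ext y; simp [mul_assoc]

/-- `A ↦ A ⊗ 1` on matrices, as a unital star homomorphism. -/
def amplifyMatrix (d : ℕ) (h : X ⊆ Y) :
    Matrix (X → Fin d) (X → Fin d) ℂ →⋆ₐ[ℂ] Matrix (Y → Fin d) (Y → Fin d) ℂ where
  toFun M := (M ⊗ₖ (1 : Matrix ((Y \ X : Finset α) → Fin d) ((Y \ X : Finset α) → Fin d) ℂ)).submatrix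
    (splitLabels h) (splitLabels h)
  map_one' := by simp
  map_mul' M M' := by
    rw [Matrix.submatrix_mul_equiv, ← Matrix.mul_kronecker_mul, one_mul]
  map_zero' := by simp
  map_add' M M' := by ext; simp [Matrix.add_kronecker]
  commutes' c := by
    rw [Algebra.algebraMap_eq_smul_one, Algebra.algebraMap_eq_smul_one, Matrix.smul_kronecker,
      Matrix.one_kronecker_one]
    ext y y'
    simp [Matrix.one_apply]
  map_star' M := by
    simp [Matrix.star_eq_conjTranspose, Matrix.conjTranspose_submatrix,
      Matrix.conjTranspose_kronecker]

/-- `A ↦ A ⊗ 1`, from the operators on the qudits in `X` to those on the qudits in `Y ⊇ X`. -/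
def amplify (d : ℕ) (h : X ⊆ Y) : Op d X →⋆ₐ[ℂ] Op d Y :=
  ((Matrix.toEuclideanCLM (n := Y → Fin d) (𝕜 := ℂ) : _ →⋆ₐ[ℂ] Op d Y).comp
    (amplifyMatrix d h)).comp
    ((Matrix.toEuclideanCLM (n := X → Fin d) (𝕜 := ℂ)).symm : Op d X →⋆ₐ[ℂ] _)

/-- The product state with the same vector `v` at each site. -/
def productState (v : EuclideanSpace ℂ (Fin d)) (X : Finset α) : Qudits d X :=
  WithLp.toLp 2 fun x => ∏ s, v (x s)

/-- Two labellings agree at their common sites. -/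
def Agree (x : X → Fin d) (y : Y → Fin d) : Prop :=
  ∀ s (hx : s ∈ X) (hy : s ∈ Y), x ⟨s, hx⟩ = y ⟨s, hy⟩

end Qudits

namespace Network

variable {p q d : ℕ} [NeZero p] [NeZero q]

/-! ### Truncation -/

theorem exists_neighbor (i : ZMod p) (g : Chamber p q) :
    g * gen p q i = g ∨ ∃ l : ContractedLeg p q, g * gen p q i = neighbor g l := by
  have hq : gen p q i ^ q = 1 := by
    have : (PresentedGroup.mk (relators p q)) (FreeGroup.of i ^ q) = 1 :=
      PresentedGroup.one_of_mem ⟨i, Or.inl rfl⟩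
    simpa [gen, PresentedGroup.of] using this
  by_cases h1 : (1 : ZMod q) = 0
  · left
    have : q = 1 := by
      have := (ZMod.natCast_eq_zero_iff 1 q).1 (by simpa using h1)
      exact Nat.dvd_one.1 this
    subst this
    simpa using hq
  · right
    refine ⟨(i, ⟨1, h1⟩), ?_⟩
    have hq1 : 1 < q := by
      rcases Nat.lt_or_ge 1 q with h | h
      · exact h
      · exfalso
        have : q = 1 := le_antisymm h (Nat.one_le_iff_ne_zero.2 (NeZero.ne q))
        subst this
        exact h1 (Subsingleton.elim _ _)
    have : Fact (1 < q) := ⟨hq1⟩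
    simp [neighbor, ZMod.val_one]

theorem reachable_mul_gen (i : ZMod p) (g : Chamber p q) :
    (networkGraph p q).Reachable g (g * gen p q i) := by
  rcases exists_neighbor i g with h | ⟨l, h⟩
  · rw [h]
  · by_cases hg : g = g * gen p q i
    · rw [← hg]
    · exact SimpleGraph.Adj.reachable
        ((SimpleGraph.fromRel_adj _ _ _).2 ⟨hg, Or.inl ⟨l, h⟩⟩)

theorem networkGraph_reachable (g h : Chamber p q) : (networkGraph p q).Reachable g h := by
  suffices H : ∀ w g : Chamber p q, (networkGraph p q).Reachable g (g * w) by
    simpa using H (g⁻¹ * h) g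
  let K : Subgroup (Chamber p q) :=
    { carrier := {w | ∀ g, (networkGraph p q).Reachable g (g * w)}
      one_mem' := fun g => by simp
      mul_mem' := fun {a b} ha hb g => by
        rw [← mul_assoc]
        exact (ha g).trans (hb _)
      inv_mem' := fun {a} ha g => by
        have := (ha (g * a⁻¹)).symm
        simpa using this }
  intro w
  exact PresentedGroup.generated_by _ K (fun i g => reachable_mul_gen i g) w

theorem finite_ball (o : Chamber p q) (Λ : ℕ) :
    {g | (networkGraph p q).dist o g ≤ Λ}.Finite := by
  induction Λ with
  | zero =>
    refine (Set.finite_singleton o).subset fun g hg => ?_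
    have h0 : (networkGraph p q).dist o g = 0 := Nat.le_zero.1 hg
    exact ((networkGraph_reachable o g).dist_eq_zero_iff.1 h0).symm
  | succ n ih =>
    refine (ih.union (Set.Finite.biUnion ih fun g _ =>
      (Set.finite_range fun l : ContractedLeg p q => neighbor g l).union
        (Set.finite_range fun l : ContractedLeg p q =>
          g * (gen p q l.1 ^ (l.2 : ZMod q).val)⁻¹))).subset ?_
    intro g hg
    obtain ⟨w, hw⟩ := (networkGraph_reachable g o).exists_walk_length_eq_dist
    cases w with
    | nil => exact Or.inl (by simp)
    | @cons _ h _ hadj w' =>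
      have hd : (networkGraph p q).dist o h ≤ n := by
        have h1 : (networkGraph p q).dist o g ≤ n + 1 := hg
        rw [SimpleGraph.dist_comm] at h1
        rw [SimpleGraph.dist_comm]
        have := SimpleGraph.dist_le w'
        simp only [SimpleGraph.Walk.length_cons] at hw
        omega
      refine Or.inr (Set.mem_biUnion hd ?_)
      obtain ⟨-, ⟨l, hl⟩ | ⟨l, hl⟩⟩ := (SimpleGraph.fromRel_adj _ _ _).1 hadj
      · exact Or.inr ⟨l, by simp [hl, neighbor]⟩
      · exact Or.inl ⟨l, hl.symm⟩

variable (N : Network p q d)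

/-- The tiles at distance at most `Λ` from the central tile in the tensor network. -/
def ball (Λ : ℕ) : Finset (Chamber p q) := (finite_ball N.center Λ).toFinset

/-- The tiles of layer `Λ + 1`. -/
def shell (Λ : ℕ) : Finset (Chamber p q) := N.ball (Λ + 1) \ N.ball Λ

theorem ball_mono (Λ : ℕ) : N.ball Λ ⊆ N.ball (Λ + 1) := by
  intro g hg
  simp only [ball, Set.Finite.mem_toFinset, Set.mem_ofPred_eq] at *
  omega

/-- All links with at least one end in a finite set of tiles. -/
def linksAt (S : Finset (Chamber p q)) : Finset (Sym2 (Chamber p q)) :=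
  (S ×ˢ Finset.univ).image fun x : Chamber p q × ContractedLeg p q => link x.1 x.2

open Classical in
/-- The bulk sites (dangling legs) of the tiles of the network truncated at `Λ` that lie in `R`. -/
def bulkSites (Λ : ℕ) (R : Set (Chamber p q)) : Finset (Chamber p q × Fin (q - 1)) :=
  {g ∈ N.ball Λ | g ∈ R} ×ˢ Finset.univ

open Classical in
/-- The boundary legs of the network truncated at `Λ` that lead into `R`: the links from a tile of
layer `Λ` to a tile of layer `Λ + 1` belonging to `R`. -/
def boundaryLegs (Λ : ℕ) (R : Set (Chamber p q)) : Finset (Sym2 (Chamber p q)) :=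
  {x ∈ N.ball Λ ×ˢ (Finset.univ : Finset (ContractedLeg p q)) |
    neighbor x.1 x.2 ∉ N.ball Λ ∧ neighbor x.1 x.2 ∈ R}.image fun x => link x.1 x.2

theorem bulkSites_subset (Λ : ℕ) (R : Set (Chamber p q)) :
    N.bulkSites Λ R ⊆ N.bulkSites Λ Set.univ := by
  intro x hx
  simp only [bulkSites, Finset.mem_product, Finset.mem_filter] at *
  exact ⟨⟨hx.1.1, Set.mem_univ _⟩, hx.2⟩

theorem bulkSites_mono (Λ : ℕ) (R : Set (Chamber p q)) :
    N.bulkSites Λ R ⊆ N.bulkSites (Λ + 1) R := by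
  intro x hx
  simp only [bulkSites, Finset.mem_product, Finset.mem_filter] at *
  exact ⟨⟨N.ball_mono Λ hx.1.1, hx.1.2⟩, hx.2⟩

theorem boundaryLegs_subset (Λ : ℕ) (R : Set (Chamber p q)) :
    N.boundaryLegs Λ R ⊆ N.boundaryLegs Λ Set.univ := by
  refine Finset.image_subset_image fun x hx => ?_
  simp only [Finset.mem_filter] at *
  exact ⟨hx.1, hx.2.1, Set.mem_univ _⟩

/-- The code Hilbert space of the network truncated at `Λ`: one qudit per bulk dangling leg. -/
abbrev HCode (Λ : ℕ) : Type := Qudits d (N.bulkSites Λ Set.univ)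

/-- The physical Hilbert space of the network truncated at `Λ`: one qudit per boundary leg. -/
abbrev HPhys (Λ : ℕ) : Type := Qudits d (N.boundaryLegs Λ Set.univ)

/-! ### Contraction of the network -/

/-- The product of the tensors at the tiles of `S`, for given labels `x` of the links at `S` and `β`
of the bulk legs of `S`. As a link carries one label, summing over the labels of the links inside `S`
performs the index contractions. -/
def amplitude (S : Finset (Chamber p q)) (x : linksAt S → Fin d)
    (β : (S ×ˢ (Finset.univ : Finset (Fin (q - 1))) : Finset _) → Fin d) : ℂ :=
  ∏ g : S, N.tensor g (Sum.elim
    (fun l => x ⟨link g l, Finset.mem_image.2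
      ⟨(g, l), Finset.mem_product.2 ⟨g.2, Finset.mem_univ _⟩, rfl⟩⟩)
    (fun m => β ⟨(g, m), Finset.mem_product.2 ⟨g.2, Finset.mem_univ _⟩⟩))

/-- The normalization of a contraction over the tiles of `S` with outgoing legs `B`: a factor
`√d` for every link at `S` not in `B` and for every bulk leg. -/
def weight (S : Finset (Chamber p q)) (B : Finset (Sym2 (Chamber p q))) : ℝ :=
  Real.sqrt d ^ ((linksAt S \ B).card + S.card * (q - 1))

open Classical in
/-- The (normalized) map `u^Λ` from the code space to the physical space given by contracting the
network truncated at `Λ`. -/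
def bulkToBoundary (Λ : ℕ) : N.HCode Λ →ₗ[ℂ] N.HPhys Λ :=
  Matrix.toEuclideanLin (Matrix.of fun b β =>
    (weight (d := d) (N.ball Λ) (N.boundaryLegs Λ Set.univ) : ℂ) *
      ∑ x : linksAt (N.ball Λ) → Fin d, if Agree x b then
        N.amplitude (N.ball Λ) x (fun s => β ⟨s, by
          simp [bulkSites]⟩)
      else 0)

open Classical in
/-- The (normalized) contraction of layer `Λ + 1` of the network, as a map from the boundary legs at
`Λ` to those at `Λ + 1`, with the bulk legs of layer `Λ + 1` fixed in the state `χ`. -/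
def layerMap (Λ : ℕ) (χ : Qudits d (N.shell Λ ×ˢ (Finset.univ : Finset (Fin (q - 1))))) :
    N.HPhys Λ →ₗ[ℂ] N.HPhys (Λ + 1) :=
  Matrix.toEuclideanLin (Matrix.of fun b' b =>
    (weight (d := d) (N.shell Λ) (N.boundaryLegs (Λ + 1) Set.univ) : ℂ) *
      ∑ x : linksAt (N.shell Λ) → Fin d, if Agree x b ∧ Agree x b' then
        ∑ β, χ β * N.amplitude (N.shell Λ) x β
      else 0)

/-- The map `H_code^Λ → H_code^{Λ+1}`: tensor with the reference state at the new bulk sites. -/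
def codeStep (Λ : ℕ) : N.HCode Λ →ₗ[ℂ] N.HCode (Λ + 1) :=
  tensorState (N.bulkSites_mono Λ Set.univ) (productState N.ref _)

/-- The map `H_phys^Λ → H_phys^{Λ+1}`: go through layer `Λ + 1` of the network, with the bulk legs
of that layer in the reference state. -/
def physStep (Λ : ℕ) : N.HPhys Λ →ₗ[ℂ] N.HPhys (Λ + 1) := N.layerMap Λ (productState N.ref _)

/-! ### Operator algebras of a region -/

/-- The algebra of the bulk qudits in the region `R` at cutoff `Λ`. -/
abbrev ACode (R : Set (Chamber p q)) (Λ : ℕ) : Type := Op d (N.bulkSites Λ R)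

/-- The algebra of the boundary legs leading into the region `R` at cutoff `Λ`. -/
abbrev APhys (R : Set (Chamber p q)) (Λ : ℕ) : Type := Op d (N.boundaryLegs Λ R)

/-- The bulk-to-bulk map `A ↦ A ⊗ 1`. -/
def codeAlgStep (R : Set (Chamber p q)) (Λ : ℕ) : N.ACode R Λ →⋆ₐ[ℂ] N.ACode R (Λ + 1) :=
  amplify d (N.bulkSites_mono Λ R)

/-- The action of the bulk algebra of `R` on the code space. -/
def codeAct (R : Set (Chamber p q)) (Λ : ℕ) : N.ACode R Λ →⋆ₐ[ℂ] (N.HCode Λ →L[ℂ] N.HCode Λ) :=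
  amplify d (N.bulkSites_subset Λ R)

/-- The action of the boundary algebra of `R` on the physical space. -/
def physAct (R : Set (Chamber p q)) (Λ : ℕ) : N.APhys R Λ →⋆ₐ[ℂ] (N.HPhys Λ →L[ℂ] N.HPhys Λ) :=
  amplify d (N.boundaryLegs_subset Λ R)

end Network

/-! ### Inductive limits -/

/-- `H` with the maps `j n` is the inductive limit Hilbert space of a sequence of isometries `t n`. -/
structure IsHilbertLimit {E : ℕ → Type} [∀ n, NormedAddCommGroup (E n)]
    [∀ n, InnerProductSpace ℂ (E n)] (t : ∀ n, E n →ₗ[ℂ] E (n + 1))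
    {H : Type} [NormedAddCommGroup H] [InnerProductSpace ℂ H] (j : ∀ n, E n →ₗᵢ[ℂ] H) : Prop where
  complete : CompleteSpace H
  compat : ∀ n ψ, j (n + 1) (t n ψ) = j n ψ
  dense : Dense (⋃ n, Set.range (j n))

/-- `B` with the maps `φ n` is the inductive limit C⋆-algebra of a sequence of injective (hence
isometric) unital star homomorphisms `t n`. -/
structure IsCStarLimit {A : ℕ → Type} [∀ n, CStarAlgebra (A n)] (t : ∀ n, A n →⋆ₐ[ℂ] A (n + 1))
    {B : Type} [CStarAlgebra B] (φ : ∀ n, A n →⋆ₐ[ℂ] B) : Prop where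
  isometry : ∀ n, Isometry (φ n)
  compat : ∀ n a, φ (n + 1) (t n a) = φ n a
  dense : Dense (⋃ n, Set.range (φ n))

/-- The inductive limits of the bulk and boundary algebras of the region `R` exist, act on the limit
Hilbert spaces, and are related by a unital isometric star homomorphism compatible with `u`. -/
def HasLimitAlgebras {p q d : ℕ} [NeZero p] [NeZero q] (N : Network p q d) (R : Set (Chamber p q))
    {Hc Hp : Type} [NormedAddCommGroup Hc] [InnerProductSpace ℂ Hc] [CompleteSpace Hc]
    [NormedAddCommGroup Hp] [InnerProductSpace ℂ Hp] [CompleteSpace Hp]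
    (jc : ∀ Λ, N.HCode Λ →ₗᵢ[ℂ] Hc) (jp : ∀ Λ, N.HPhys Λ →ₗᵢ[ℂ] Hp) (u : Hc →ₗᵢ[ℂ] Hp) : Prop :=
  ∃ -- the bulk-to-boundary maps and the boundary-to-boundary maps at finite cutoff
    (ι : ∀ Λ, N.ACode R Λ →⋆ₐ[ℂ] N.APhys R Λ)
    (κ : ∀ Λ, N.APhys R Λ →⋆ₐ[ℂ] N.APhys R (Λ + 1))
    -- the limit algebras
    (Ac : Type) (_ : CStarAlgebra Ac) (Ap : Type) (_ : CStarAlgebra Ap)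
    (φc : ∀ Λ, N.ACode R Λ →⋆ₐ[ℂ] Ac) (φp : ∀ Λ, N.APhys R Λ →⋆ₐ[ℂ] Ap)
    -- the limit homomorphism and the actions on the limit Hilbert spaces
    (ιlim : Ac →⋆ₐ[ℂ] Ap) (πc : Ac →⋆ₐ[ℂ] (Hc →L[ℂ] Hc)) (πp : Ap →⋆ₐ[ℂ] (Hp →L[ℂ] Hp)),
    -- `ι Λ` reconstructs bulk operators of `R` on the boundary of `R`
    (∀ Λ A ψ, N.physAct R Λ (ι Λ A) (N.bulkToBoundary Λ ψ) =
      N.bulkToBoundary Λ (N.codeAct R Λ A ψ)) ∧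
    -- `κ Λ` pushes operators through layer `Λ + 1`, with the identity on the new bulk legs
    (∀ Λ χ B ψ, N.physAct R (Λ + 1) (κ Λ B) (N.layerMap Λ χ ψ) =
      N.layerMap Λ χ (N.physAct R Λ B ψ)) ∧
    -- the diagram of algebras commutes
    (∀ Λ A, κ Λ (ι Λ A) = ι (Λ + 1) (N.codeAlgStep R Λ A)) ∧
    -- the limits, with the induced homomorphism
    IsCStarLimit (N.codeAlgStep R) φc ∧
    IsCStarLimit κ φp ∧
    Isometry ιlim ∧
    (∀ Λ A, ιlim (φc Λ A) = φp Λ (ι Λ A)) ∧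
    -- the (faithful) actions on the limit Hilbert spaces, extending those at finite cutoff
    Isometry πc ∧
    Isometry πp ∧
    (∀ Λ A ψ, πc (φc Λ A) (jc Λ ψ) = jc Λ (N.codeAct R Λ A ψ)) ∧
    (∀ Λ B ψ, πp (φp Λ B) (jp Λ ψ) = jp Λ (N.physAct R Λ B ψ)) ∧
    -- `ι(A) u = u A`
    (∀ A ψ, πp (ιlim A) (u ψ) = u (πc A ψ))

end Bourdon

end

/-!
Operators of a region are pushed through the network one layer at a time. Three facts make this
possible.

*Linear algebra.* If a matrix `C` from `X ⊗ Z` to `X' ⊗ Z'` has blocks `C z` from `X` to `X'` with all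
products `(C z)ᴴ * C w` proportional to the identity, then the columns of the blocks span a copy of
`X ⊗ ℂ^r` in `X'`. It extends to an isomorphism `X' ≃ X ⊗ ℂ^m` (dimensions are powers of `d`, so that
the dimension of `X` divides that of `X'`), and `B ↦ B ⊗ 1` is a unital star homomorphism `P` from
operators on `X` to operators on `X'`, with `(P B ⊗ 1) C = C (B ⊗ 1)`: see `exists_starAlgHom_mul_eq`
and `exists_ampl_mul_eq`.

*Perfect tensors.* The products above are contractions of two copies of a layer along the legs that
lead out into the region `R`. At a tile with at least half of its legs already identified between the
two copies, the two tensors cancel, as the reduced state of a perfect tensor on at most half of its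
legs is maximally mixed, and the remaining legs become identified (`doubleSum_erase`). If the tiles of
the layer in `R` can be removed one after the other in this way, the products are proportional to the
identity on the legs into `R` and on the bulk legs of `R` (`doubleSum_eq_ite`). With `R` everything,
the same argument shows that a layer is an isometry (`IsLayer.contraction_isometry`).

*Geometry.* The group acts on pairs of a chamber and a function on the walls, and this defines on
which `side` of each wall a chamber lies; distances in the network count separating walls
(`dist_eq_ncard_sep`), since a gallery that crosses a wall twice is shortened by retracting it into
the neighborhood of the wall. The edges of a tile that lead back to the center are pairwise adjacent
(`near_of_isDescent`), hence at most two. So a tile has at most `2 (q - 1)` legs towards the center or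
within its layer, and `q - 1` bulk legs; as `p ≥ 5`, these are at most half of its `(p + 1) (q - 1)`
legs. For a wedge that the center is separated from, all other legs stay in the wedge. For the
complement of a wedge, at most one leg of a tile leads out of the region away from the center; such a
tile with two edges towards the center has a neighbor in the layer without such a leg, which is
removed before it (`isRegion_compl_wedge`, `IsLayer.peelable`).

The homomorphisms `κ` push through one layer with the identity on the new bulk legs, and the `ι` are
built by recursion on the layers, so that the diagram of algebras commutes (`Network.exists_homs`).

The limit of the physical spaces exists as for any sequence of isometries (`exists_isHilbertLimit`),
and the limit of the code spaces is the closure in it of the images of the truncated code spaces. The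
boundary algebras act compatibly on the physical limit space, by isometric representations since
injective star homomorphisms of matrix algebras are isometric. The limit algebras are closures of unions
of images in the operators on this space, and the bulk algebra acts on the code limit space by
restriction (`exists_limitAlgebras`).
-/

set_option linter.unusedSectionVars false

noncomputable section

namespace Bourdon

/-! ### Pushing operators through a matrix -/

section Push

variable {X Z X' : Type} [Fintype X] [DecidableEq X] [Fintype Z] [Fintype X'] [DecidableEq X']

/-- If an orthonormal family indexed by `X × Fin r` spans a subspace on which the operators of `X`
are to act, it extends to an orthonormal basis indexed by `X × Fin m`; in matrix form, it is part of
a unitary matrix `U`. The divisibility holds for spaces of qudits, whose dimensions are powers of `d`. -/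
theorem exists_unitary_extending (hdvd : Fintype.card X ≤ Fintype.card X' →
    Fintype.card X ∣ Fintype.card X') [Nonempty X] {r : ℕ} (hr : 0 < r)
    (e : X × Fin r → EuclideanSpace ℂ X') (he : Orthonormal ℂ e) :
    ∃ (m : ℕ) (hm : r ≤ m) (U : Matrix X' (X × Fin m) ℂ), U.conjTranspose * U = 1 ∧
      U * U.conjTranspose = 1 ∧ ∀ x (a : Fin r) x', U x' (x, Fin.castLE hm a) = e (x, a) x' := by
  classical
  have hcard : Fintype.card X * r ≤ Fintype.card X' := by
    have := he.linearIndependent.fintype_card_le_finrank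
    simpa using this
  have hpos : 0 < Fintype.card X := Fintype.card_pos
  obtain ⟨m, hm⟩ := hdvd (le_trans (Nat.le_mul_of_pos_right _ hr) hcard)
  have hrm : r ≤ m := by
    rw [hm] at hcard
    exact Nat.le_of_mul_le_mul_left hcard hpos
  let v : X × Fin m → EuclideanSpace ℂ X' := fun p =>
    if h : p.2.val < r then e (p.1, ⟨p.2.val, h⟩) else 0
  let s : Set (X × Fin m) := {p | p.2.val < r}
  have hv : Orthonormal ℂ (s.domRestrict v) := by
    have : s.domRestrict v = e ∘ fun p : s => (p.1.1, ⟨p.1.2.val, p.2⟩) := by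
      funext p
      have hp : p.1.2.val < r := p.2
      simp [v, Set.domRestrict, hp]
    rw [this]
    refine he.comp _ ?_
    rintro ⟨⟨x, a⟩, ha⟩ ⟨⟨y, b⟩, hb⟩ h
    simp only [Prod.mk.injEq, Fin.mk.injEq] at h
    simp [h.1, Fin.ext h.2]
  obtain ⟨b, hb⟩ := Orthonormal.exists_orthonormalBasis_extension_of_card_eq
    (ι := X × Fin m) (by simp [hm]) hv
  let U : Matrix X' (X × Fin m) ℂ := Matrix.of fun x' p => b p x'
  have hU : U.conjTranspose * U = 1 := by
    ext p p'
    have := orthonormal_iff_ite.1 b.orthonormal p p'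
    simpa [U, Matrix.mul_apply, Matrix.one_apply, PiLp.inner_apply, mul_comm] using this
  refine ⟨m, hrm, U, hU, ?_, fun x a x' => ?_⟩
  · exact (Matrix.mul_eq_one_comm_of_card_eq (X × Fin m) X' ℂ (by simp [hm])).1 hU
  · have hs : (x, Fin.castLE hrm a) ∈ s := by simp [s]
    simp [U, hb _ hs, v]

/-- Conjugation of `B ⊗ 1` by a unitary matrix is a unital star homomorphism. -/
def conjKronecker {m : ℕ} (U : Matrix X' (X × Fin m) ℂ) (h₁ : U.conjTranspose * U = 1)
    (h₂ : U * U.conjTranspose = 1) : Matrix X X ℂ →⋆ₐ[ℂ] Matrix X' X' ℂ where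
  toFun B := U * (B ⊗ₖ (1 : Matrix (Fin m) (Fin m) ℂ)) * U.conjTranspose
  map_one' := by simp [h₂]
  map_mul' A B := by
    have : (A * B) ⊗ₖ (1 : Matrix (Fin m) (Fin m) ℂ) = (A ⊗ₖ 1) * (U.conjTranspose * U) * (B ⊗ₖ 1) := by
      rw [h₁, mul_one, ← Matrix.mul_kronecker_mul, one_mul]
    rw [this]
    simp only [mul_assoc, Matrix.mul_assoc]
  map_zero' := by simp
  map_add' A B := by simp [Matrix.add_kronecker, Matrix.mul_add, Matrix.add_mul]
  commutes' c := by
    rw [Algebra.algebraMap_eq_smul_one, Algebra.algebraMap_eq_smul_one, Matrix.smul_kronecker,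
      Matrix.one_kronecker_one]
    simp [h₂]
  map_star' B := by
    simp [Matrix.star_eq_conjTranspose, Matrix.conjTranspose_mul, Matrix.conjTranspose_kronecker,
      Matrix.mul_assoc]

/-- If the matrices `F z` satisfy `(F z₁)ᴴ * F z₂ = G z₁ z₂ • 1`, operators on the domain can be pushed
through all of them at once by a unital star homomorphism. The columns of the `F z` span a copy of
`ℂ^X ⊗ ℂ^r`, which extends to an identification of the whole codomain with `ℂ^X ⊗ ℂ^m`. -/
theorem exists_starAlgHom_mul_eq (hdvd : Fintype.card X ≤ Fintype.card X' →
    Fintype.card X ∣ Fintype.card X') [Nonempty X] (F : Z → Matrix X' X ℂ) (G : Z → Z → ℂ)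
    (hF : ∀ z₁ z₂, (F z₁).conjTranspose * F z₂ = G z₁ z₂ • (1 : Matrix X X ℂ))
    (hF0 : ∃ z, F z ≠ 0) :
    ∃ P : Matrix X X ℂ →⋆ₐ[ℂ] Matrix X' X' ℂ, ∀ B z, P B * F z = F z * B := by
  classical
  let f : X → Z → EuclideanSpace ℂ X' := fun x z => WithLp.toLp 2 fun x' => F z x' x
  have hf : ∀ x y z w, inner ℂ (f x z) (f y w) = if x = y then G z w else 0 := by
    intro x y z w
    have := congrFun (congrFun (hF z w) x) y
    simp only [Matrix.mul_apply, Matrix.conjTranspose_apply, Matrix.smul_apply,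
      Matrix.one_apply, smul_eq_mul, mul_ite, mul_one, mul_zero] at this
    rw [← this]
    simp [f, PiLp.inner_apply, mul_comm]
  -- inner products of combinations of the columns at `x` do not depend on `x`
  have hcomb : ∀ (k l : Z → ℂ) x y, inner ℂ (∑ z, k z • f x z) (∑ z, l z • f y z) =
      if x = y then ∑ z, ∑ w, conj (k z) * l w * G z w else 0 := by
    intro k l x y
    simp only [sum_inner, inner_sum, inner_smul_left, inner_smul_right, hf]
    split_ifs with h
    · simp only [Finset.mul_sum]
      rw [Finset.sum_comm]
      exact Finset.sum_congr rfl fun z _ => Finset.sum_congr rfl fun w _ => by ring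
    · simp
  obtain ⟨x₀⟩ := (inferInstance : Nonempty X)
  have hzero : ∀ (k : Z → ℂ) x, ∑ z, k z • f x₀ z = 0 → ∑ z, k z • f x z = 0 := by
    intro k x h
    have h1 := hcomb k k x₀ x₀
    have h2 := hcomb k k x x
    rw [if_pos rfl] at h1 h2
    rw [← h1, h, inner_zero_left] at h2
    exact inner_self_eq_zero.1 h2
  -- coefficients that orthonormalize the columns at `x₀` do so for every `x`
  let S : Submodule ℂ (EuclideanSpace ℂ X') := Submodule.span ℂ (Set.range (f x₀))
  let w := stdOrthonormalBasis ℂ S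
  have hw : ∀ a, ∃ c : Z → ℂ, ∑ z, c z • f x₀ z = w a := fun a =>
    (Submodule.mem_span_range_iff_exists_fun ℂ).1 (w a).2
  choose c hc using hw
  let r := Module.finrank ℂ S
  let e : X × Fin r → EuclideanSpace ℂ X' := fun p => ∑ z, c p.2 z • f p.1 z
  have he : Orthonormal ℂ e := by
    rw [orthonormal_iff_ite]
    rintro ⟨x, a⟩ ⟨y, b⟩
    have h0 := hcomb (c a) (c b) x₀ x₀
    rw [if_pos rfl, hc, hc] at h0
    have h1 := orthonormal_iff_ite.1 w.orthonormal a b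
    rw [Submodule.coe_inner] at h1
    simp only [e]
    rw [hcomb, ← h0, h1]
    by_cases hx : x = y <;> by_cases ha : a = b <;> simp [hx, ha]
  let t : Z → Fin r → ℂ := fun z a => w.repr ⟨f x₀ z, Submodule.subset_span ⟨z, rfl⟩⟩ a
  have ht : ∀ x z, f x z = ∑ a, t z a • e (x, a) := by
    intro x z
    have key : ∀ x, ∑ z', ((if z' = z then 1 else 0) - ∑ a, t z a * c a z') • f x z' =
        f x z - ∑ a, t z a • e (x, a) := by
      intro x
      simp only [sub_smul, Finset.sum_sub_distrib, Finset.sum_smul, e, Finset.smul_sum, smul_smul,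
        ite_smul, one_smul, zero_smul, Finset.sum_ite_eq', Finset.mem_univ, if_true]
      rw [Finset.sum_comm]
    have h0 := hzero _ x (by
      rw [key, sub_eq_zero]
      have := congrArg Subtype.val (w.sum_repr ⟨f x₀ z, Submodule.subset_span ⟨z, rfl⟩⟩)
      simp only [Submodule.coe_sum, Submodule.coe_smul] at this
      rw [← this]
      exact Finset.sum_congr rfl fun a _ => by simp only [e, hc, t])
    rw [key, sub_eq_zero] at h0
    exact h0
  have hr : 0 < r := by
    obtain ⟨z, hz⟩ := hF0
    rw [Nat.pos_iff_ne_zero]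
    intro hr
    have : IsEmpty (Fin r) := by rw [hr]; infer_instance
    refine hz (Matrix.ext fun x' x => ?_)
    have := congrArg (fun v : EuclideanSpace ℂ X' => v x') (ht x z)
    simpa [f] using this
  obtain ⟨m, hm, U, hU₁, hU₂, hU⟩ := exists_unitary_extending hdvd hr e he
  -- in the new basis, `F z` is `1 ⊗ t z`, which commutes with the operators on `X`
  let T : Z → Matrix (X × Fin m) X ℂ := fun z => Matrix.of fun p x =>
    if p.1 = x then (if h : p.2.val < r then t z ⟨p.2.val, h⟩ else 0) else 0
  have hT : ∀ z, F z = U * T z := by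
    intro z
    ext x' x
    have h1 := congrArg (fun v : EuclideanSpace ℂ X' => v x') (ht x z)
    simp only [f, WithLp.ofLp_sum, WithLp.ofLp_smul, Finset.sum_apply, Pi.smul_apply,
      smul_eq_mul] at h1
    rw [h1]
    simp only [T, Matrix.mul_apply, Matrix.of_apply, Fintype.sum_prod_type, mul_ite, mul_zero]
    rw [Finset.sum_eq_single x (fun y _ hy => by simp [hy]) (by simp)]
    simp only [if_true, ← hU]
    rw [← Finset.sum_subset (Finset.subset_univ (Finset.univ.map (Fin.castLEEmb hm)))]
    · rw [Finset.sum_map]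
      exact Finset.sum_congr rfl fun a _ => by simp [mul_comm]
    · intro a _ ha
      have : ¬ a.val < r := fun h => ha (Finset.mem_map.2 ⟨⟨a, h⟩, Finset.mem_univ _, by ext; simp⟩)
      simp [this]
  refine ⟨conjKronecker U hU₁ hU₂, fun B z => ?_⟩
  have hcomm : (B ⊗ₖ (1 : Matrix (Fin m) (Fin m) ℂ)) * T z = T z * B := by
    ext ⟨y, a⟩ x
    simp only [T, Matrix.mul_apply, Fintype.sum_prod_type, Matrix.one_apply,
      Matrix.kroneckerMap_apply, Matrix.of_apply]
    rw [Finset.sum_eq_single x (fun z _ hz => by simp [hz]) (by simp),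
      Finset.sum_eq_single a (fun b _ hb => by simp [Ne.symm hb]) (by simp),
      Finset.sum_eq_single y (fun z _ hz => by simp [Ne.symm hz]) (by simp)]
    simp [mul_comm]
  rw [hT z]
  change U * (B ⊗ₖ (1 : Matrix (Fin m) (Fin m) ℂ)) * U.conjTranspose * (U * T z) = U * T z * B
  calc _ = U * ((B ⊗ₖ (1 : Matrix (Fin m) (Fin m) ℂ)) * ((U.conjTranspose * U) * T z)) := by
        simp only [Matrix.mul_assoc]
    _ = _ := by rw [hU₁, Matrix.one_mul, hcomm, Matrix.mul_assoc]

end Push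

/-! ### Perfect tensors -/

section Labels

variable {E L : Type} [Fintype E] [DecidableEq E] [Fintype L] [DecidableEq L] {d : ℕ}

/-- The indicator that two labellings coincide on a set of sites. -/
def eqOn (C : Finset E) (z z' : E → Fin d) : ℂ := if ∀ s ∈ C, z s = z' s then 1 else 0

theorem eqOn_union (C C' : Finset E) (z z' : E → Fin d) :
    eqOn (C ∪ C') z z' = eqOn C z z' * eqOn C' z z' := by
  unfold eqOn
  simp only [Finset.mem_union, or_imp, forall_and]
  split_ifs <;> simp_all

theorem eqOn_congr {C : Finset E} {z z' w w' : E → Fin d} (h : ∀ s ∈ C, z s = w s)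
    (h' : ∀ s ∈ C, z' s = w' s) : eqOn C z z' = eqOn C w w' := by
  unfold eqOn
  have : (∀ s ∈ C, z s = z' s) ↔ ∀ s ∈ C, w s = w' s :=
    forall₂_congr fun s hs => by rw [h s hs, h' s hs]
  simp only [this]

theorem sum_eqOn (C : Finset E) (x : E → Fin d) :
    ∑ z : E → Fin d, eqOn C z x = (d : ℂ) ^ (Fintype.card E - C.card) := by
  unfold eqOn
  rw [Finset.sum_boole]
  have : (Finset.univ.filter fun z : E → Fin d => ∀ s ∈ C, z s = x s) =
      Fintype.piFinset fun s => if s ∈ C then {x s} else Finset.univ := by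
    ext z
    simp only [Finset.mem_filter, Finset.mem_univ, true_and, Fintype.mem_piFinset]
    refine forall_congr' fun s => ?_
    by_cases hs : s ∈ C <;> simp [hs]
  rw [this, Fintype.card_piFinset]
  have h2 : ∀ s, (if s ∈ C then ({x s} : Finset (Fin d)) else Finset.univ).card =
      if s ∈ C then 1 else d := by
    intro s; by_cases hs : s ∈ C <;> simp [hs]
  simp only [h2]
  rw [Finset.prod_ite]
  simp only [Finset.prod_const_one, Finset.prod_const, one_mul]
  rw [← Finset.card_compl, Nat.cast_pow]
  congr 2
  ext; simp

/-- Exchanging the labels on `O` with an auxiliary labelling: a sum over pairs that coincide on `O`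
may be averaged over the common value on `O`. -/
theorem sum_eqOn_mul_piecewise (O : Finset E) (Ψ : (E → Fin d) → (E → Fin d) → ℂ) :
    ∑ z : E → Fin d, ∑ z' : E → Fin d, eqOn O z z' *
      ∑ w : E → Fin d, Ψ (O.piecewise w z) (O.piecewise w z') =
    (d : ℂ) ^ Fintype.card E * ∑ z : E → Fin d, ∑ z' : E → Fin d, eqOn O z z' * Ψ z z' := by
  have h1 : ∑ z : E → Fin d, ∑ z' : E → Fin d, eqOn O z z' *
      ∑ w : E → Fin d, Ψ (O.piecewise w z) (O.piecewise w z') =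
      ∑ t ∈ Finset.univ.filter fun t : (E → Fin d) × (E → Fin d) × (E → Fin d) =>
        ∀ s ∈ O, t.1 s = t.2.1 s, Ψ (O.piecewise t.2.2 t.1) (O.piecewise t.2.2 t.2.1) := by
    rw [Finset.sum_filter, Fintype.sum_prod_type]
    refine Finset.sum_congr rfl fun z _ => ?_
    rw [Fintype.sum_prod_type]
    refine Finset.sum_congr rfl fun z' _ => ?_
    rw [Finset.mul_sum]
    refine Finset.sum_congr rfl fun w _ => ?_
    simp [eqOn]
  have h2 : (d : ℂ) ^ Fintype.card E * ∑ z : E → Fin d, ∑ z' : E → Fin d, eqOn O z z' * Ψ z z' =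
      ∑ t ∈ Finset.univ.filter fun t : (E → Fin d) × (E → Fin d) × (E → Fin d) =>
        ∀ s ∈ O, t.1 s = t.2.1 s, Ψ t.1 t.2.1 := by
    rw [Finset.sum_filter, Fintype.sum_prod_type, Finset.mul_sum]
    refine Finset.sum_congr rfl fun z _ => ?_
    rw [Fintype.sum_prod_type, Finset.mul_sum]
    refine Finset.sum_congr rfl fun z' _ => ?_
    simp [eqOn]
  rw [h1, h2]
  let φ : (E → Fin d) × (E → Fin d) × (E → Fin d) → (E → Fin d) × (E → Fin d) × (E → Fin d) :=
    fun t => (O.piecewise t.2.2 t.1, O.piecewise t.2.2 t.2.1, O.piecewise t.1 t.2.2)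
  refine Finset.sum_nbij' φ φ ?_ ?_ ?_ ?_ ?_
  · rintro ⟨z, z', w⟩ h
    simp only [Finset.mem_filter, Finset.mem_univ, true_and, φ] at h ⊢
    intro s hs; simp [hs]
  · rintro ⟨z, z', w⟩ h
    simp only [Finset.mem_filter, Finset.mem_univ, true_and, φ] at h ⊢
    intro s hs; simp [hs]
  · rintro ⟨z, z', w⟩ h
    simp only [Finset.mem_filter, Finset.mem_univ, true_and, φ] at h ⊢
    ext s <;> by_cases hs : s ∈ O <;> simp [hs, h s]
  · rintro ⟨z, z', w⟩ h
    simp only [Finset.mem_filter, Finset.mem_univ, true_and, φ] at h ⊢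
    ext s <;> by_cases hs : s ∈ O <;> simp [hs, h s]
  · rintro ⟨z, z', w⟩ h
    rfl

/-- Summing a function of the labels along an injection. -/
theorem sum_comp_injective {e : L → E} (he : Function.Injective e) (g : (L → Fin d) → ℂ) :
    ∑ w : E → Fin d, g (w ∘ e) =
      (d : ℂ) ^ (Fintype.card E - Fintype.card L) * ∑ y : L → Fin d, g y := by
  classical
  rw [Finset.mul_sum, ← Finset.sum_fiberwise Finset.univ fun w : E → Fin d => w ∘ e]
  refine Finset.sum_congr rfl fun y _ => ?_
  rw [Finset.sum_congr rfl (g := fun _ => g y) (fun w hw => by rw [(Finset.mem_filter.1 hw).2]),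
    Finset.sum_const, nsmul_eq_mul]
  congr 1
  rcases isEmpty_or_nonempty (E → Fin d) with hE | ⟨⟨w₀⟩⟩
  · have hd : d = 0 := by
      by_contra hd
      exact hE.elim fun _ => ⟨0, Nat.pos_of_ne_zero hd⟩
    subst hd
    have hL : IsEmpty L := ⟨fun l => (y l).elim0⟩
    have hE' : Nonempty E := by
      by_contra h
      exact hE.elim fun s => (h ⟨s⟩).elim
    simp [zero_pow Fintype.card_ne_zero]
  · let x : E → Fin d := fun s => if h : ∃ l, e l = s then y h.choose else w₀ s
    have hx : ∀ l, x (e l) = y l := by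
      intro l
      have h : ∃ l', e l' = e l := ⟨l, rfl⟩
      simp only [x, dif_pos h]
      rw [he h.choose_spec]
    have := sum_eqOn (Finset.univ.image e) x
    rw [Finset.card_image_of_injective _ he, Finset.card_univ] at this
    rw [← this]
    unfold eqOn
    rw [Finset.sum_boole]
    congr 2
    ext w
    simp only [Finset.mem_filter, Finset.mem_univ, true_and, Finset.mem_image, forall_exists_index,
      forall_apply_eq_imp_iff, hx, funext_iff, Function.comp]

/-- The reduced state of a normalized perfect tensor on at most half of its legs is maximally mixed.
The labels of the remaining legs are read off a labelling `w` of all the legs. -/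
theorem IsPerfectTensor.sum_piecewise {t : (L → Fin d) → ℂ} (ht : IsPerfectTensor t)
    (hn : ∑ x, ‖t x‖ ^ 2 = 1) (A : Finset L) (hA : 2 * A.card ≤ Fintype.card L)
    (y y' : L → Fin d) :
    ∑ w : L → Fin d, conj (t (A.piecewise y w)) * t (A.piecewise y' w) = eqOn A y y' := by
  obtain ⟨c, -, hc⟩ := ht (fun l => l ∈ A) (by simpa using hA)
  -- the sum is the indicator, up to a constant
  have h1 : ∀ y y' : L → Fin d,
      ∑ w : L → Fin d, conj (t (A.piecewise y w)) * t (A.piecewise y' w) =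
      (d : ℂ) ^ (Fintype.card L - Fintype.card {l // l ∉ A}) * (c * eqOn A y y') := by
    intro y y'
    have h2 := hc (fun l => y l) (fun l => y' l)
    have h3 := sum_comp_injective (d := d) (e := fun l : {l // l ∉ A} => (l : L))
      Subtype.val_injective (fun b => conj (t ((Equiv.piEquivPiSubtypeProd (fun l => l ∈ A)
        fun _ => Fin d).symm (fun l => y l, b))) * t ((Equiv.piEquivPiSubtypeProd (fun l => l ∈ A)
        fun _ => Fin d).symm (fun l => y' l, b)))
    rw [h2.trans (b := _) (c := (c * eqOn A y y' : ℂ)) (by unfold eqOn; simp [funext_iff])] at h3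
    rw [← h3]
    refine Finset.sum_congr rfl fun w _ => ?_
    have h5 : ∀ y : L → Fin d, A.piecewise y w = (Equiv.piEquivPiSubtypeProd (fun l => l ∈ A)
        fun _ => Fin d).symm (fun l => y l, w ∘ fun l : {l // l ∉ A} => (l : L)) := by
      intro y
      ext l
      by_cases hl : l ∈ A <;> simp [hl, Equiv.piEquivPiSubtypeProd]
    rw [h5, h5]
  rw [h1]
  -- the constant is one, by the normalization of `t`
  suffices hK : (d : ℂ) ^ (Fintype.card L - Fintype.card {l // l ∉ A}) * c = 1 by
    rw [← mul_assoc, hK, one_mul]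
  have hn' : ∑ x, (conj (t x) * t x : ℂ) = 1 := by
    rw [← Complex.ofReal_one, ← hn, Complex.ofReal_sum]
    exact Finset.sum_congr rfl fun x _ => by rw [Complex.conj_mul']; push_cast; rfl
  have h7 : ∑ w : L → Fin d, ∑ y : L → Fin d, conj (t (A.piecewise y w)) * t (A.piecewise y w) =
      (d : ℂ) ^ Fintype.card L := by
    have h8 := sum_eqOn_mul_piecewise (d := d) A
      (fun z z' : L → Fin d => if z = z' then (conj (t z) * t z : ℂ) else 0)
    have h9 : ∀ z : L → Fin d, ∑ z' : L → Fin d, eqOn A z z' *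
        (if z = z' then (conj (t z) * t z : ℂ) else 0) = conj (t z) * t z := by
      intro z; simp [eqOn]
    simp only [h9, hn', mul_one] at h8
    rw [← h8]
    refine Finset.sum_congr rfl fun w _ => ?_
    symm
    refine (Finset.sum_eq_single w ?_ (by simp)).trans (by simp [eqOn])
    · intro w' _ hw
      by_cases h : ∀ s ∈ A, w s = w' s
      · rw [Finset.sum_eq_zero, mul_zero]
        intro y _
        rw [if_neg]
        intro h'
        refine hw (funext fun s => ?_)
        by_cases hs : s ∈ A
        · exact (h s hs).symm
        · simpa [hs] using (congrFun h' s).symm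
      · simp [eqOn, h]
  rw [Finset.sum_comm] at h7
  simp only [h1] at h7
  have h10 : ∀ y : L → Fin d, eqOn A y y = 1 := fun y => by simp [eqOn]
  simp only [h10, mul_one, Finset.sum_const, Finset.card_univ, Fintype.card_fun, Fintype.card_fin,
    nsmul_eq_mul, Nat.cast_pow] at h7
  have hd : (d : ℂ) ^ Fintype.card L ≠ 0 := by
    intro h0
    have : Fintype.card (L → Fin d) = 0 := by
      rw [Fintype.card_fun, Fintype.card_fin]; exact_mod_cast h0
    have : IsEmpty (L → Fin d) := Fintype.card_eq_zero_iff.1 this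
    simp at hn
  exact mul_left_cancel₀ hd (by rw [h7, mul_one])

end Labels

/-! ### Contracting two copies of a network of perfect tensors -/

section Contraction

variable {V E L : Type} [Fintype V] [DecidableEq V] [Fintype E] [DecidableEq E] [Fintype L]
  [DecidableEq L] {d : ℕ}

/-- A finite network: the tile `v` has the legs `L`, its leg `l` is attached to the site `e v l`. The
sites of `F` and `B` are open, that is, they belong to one tile only, and the others belong to at
most two tiles. -/
structure Wiring (e : V → L → E) (F B : Finset E) : Prop where
  injective : ∀ v, Function.Injective (e v)
  disjoint : Disjoint F B
  isOpen : ∀ u v l l', e u l ∈ F ∪ B → e u l = e v l' → u = v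
  two : ∀ u v w l l' l'', e u l = e v l' → e u l = e w l'' → u = v ∨ u = w ∨ v = w

/-- The contraction of the network of the tiles `V'` with its complex conjugate. The labels of the
two copies coincide on the sites of `C`, and `h` prescribes the labels of other open sites. -/
def doubleSum (t : V → (L → Fin d) → ℂ) (e : V → L → E) (V' : Finset V) (C : Finset E)
    (h : (E → Fin d) → (E → Fin d) → ℂ) : ℂ :=
  ∑ z : E → Fin d, ∑ z' : E → Fin d, eqOn C z z' *
    (h z z' * ∏ v ∈ V', conj (t v (z ∘ e v)) * t v (z' ∘ e v))

/-- A weight that depends only on the labels at the sites of `F`. -/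
def DependsOn (h : (E → Fin d) → (E → Fin d) → ℂ) (F : Finset E) : Prop :=
  ∀ z z' w w', (∀ s ∈ F, z s = w s) → (∀ s ∈ F, z' s = w' s) → h z z' = h w w'

variable {t : V → (L → Fin d) → ℂ} {e : V → L → E} {F B : Finset E}

/-- Removing one tile: if at most half of its legs are not yet identified between the two copies, the
sum over the identified ones is the reduced state of a perfect tensor, which identifies the
remaining legs. -/
theorem doubleSum_erase (hd : d ≠ 0) (ht : ∀ v, IsPerfectTensor (t v))
    (hn : ∀ v, ∑ x, ‖t v x‖ ^ 2 = 1) {V' : Finset V} {C : Finset E} {v : V} (hv : v ∈ V')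
    (he : Function.Injective (e v))
    (hhalf : 2 * (Finset.univ.filter fun l => e v l ∉ C).card ≤ Fintype.card L)
    (hF : ∀ l, e v l ∈ C → e v l ∉ F)
    (hother : ∀ l, e v l ∈ C → ∀ u ∈ V', u ≠ v → ∀ l', e u l' ≠ e v l)
    {h : (E → Fin d) → (E → Fin d) → ℂ} (hh : DependsOn h F) :
    (d : ℂ) ^ Fintype.card L * doubleSum t e V' C h =
      doubleSum t e (V'.erase v) (C ∪ Finset.univ.image (e v)) h := by
  set A : Finset L := Finset.univ.filter fun l => e v l ∉ C with hA
  set O : Finset E := Finset.univ.filter fun s => s ∈ C ∧ ∃ l, e v l = s with hO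
  have hOC : O ∪ C \ O = C := Finset.union_sdiff_of_subset fun s hs => (Finset.mem_filter.1 hs).2.1
  have hC' : C ∪ Finset.univ.image (e v) = O ∪ (C \ O ∪ A.image (e v)) := by
    rw [← Finset.union_assoc, hOC]
    ext s
    simp only [Finset.mem_union, Finset.mem_image, Finset.mem_univ, true_and, hA,
      Finset.mem_filter]
    constructor
    · rintro (h | ⟨l, rfl⟩)
      · exact Or.inl h
      · by_cases hl : e v l ∈ C
        · exact Or.inl hl
        · exact Or.inr ⟨l, hl, rfl⟩
    · rintro (h | ⟨l, -, rfl⟩)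
      · exact Or.inl h
      · exact Or.inr ⟨l, rfl⟩
  have hnotO : ∀ u ∈ V'.erase v, ∀ l, e u l ∉ O := by
    intro u hu l hl
    obtain ⟨-, hl1, l', hl'⟩ := Finset.mem_filter.1 hl
    exact hother l' (hl' ▸ hl1) u (Finset.mem_of_mem_erase hu) (Finset.ne_of_mem_erase hu) l hl'.symm
  let R : (E → Fin d) → (E → Fin d) → ℂ := fun z z' => eqOn (C \ O) z z' * (h z z' *
    ∏ u ∈ V'.erase v, conj (t u (z ∘ e u)) * t u (z' ∘ e u))
  have hR : ∀ w z z', R (O.piecewise w z) (O.piecewise w z') = R z z' := by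
    intro w z z'
    have h1 : ∀ (z : E → Fin d), ∀ u ∈ V'.erase v, O.piecewise w z ∘ e u = z ∘ e u := by
      intro z u hu
      funext l
      simp [hnotO u hu l]
    have h2 : ∀ (z : E → Fin d), ∀ s ∈ F, O.piecewise w z s = z s := by
      intro z s hs
      refine Finset.piecewise_eq_of_notMem _ _ _ fun hsO => ?_
      obtain ⟨-, hl1, l', rfl⟩ := Finset.mem_filter.1 hsO
      exact hF l' hl1 hs
    simp only [R]
    rw [hh _ _ z z' (h2 z) (h2 z'), eqOn_congr (w := z) (w' := z')
      (fun s hs => by simp [(Finset.mem_sdiff.1 hs).2])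
      (fun s hs => by simp [(Finset.mem_sdiff.1 hs).2]),
      Finset.prod_congr rfl fun u hu => by rw [h1 z u hu, h1 z' u hu]]
  have hcomp : ∀ w z : E → Fin d, O.piecewise w z ∘ e v = A.piecewise (z ∘ e v) (w ∘ e v) := by
    intro w z
    funext l
    by_cases hl : e v l ∈ C <;> simp [hA, hO, hl, Finset.piecewise]
  have key := sum_eqOn_mul_piecewise O fun z z' : E → Fin d =>
    R z z' * (conj (t v (z ∘ e v)) * t v (z' ∘ e v))
  simp only [hR, hcomp, ← Finset.mul_sum] at key
  have hsum : ∀ z z' : E → Fin d, ∑ w : E → Fin d, conj (t v (A.piecewise (z ∘ e v) (w ∘ e v))) *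
      t v (A.piecewise (z' ∘ e v) (w ∘ e v)) =
      (d : ℂ) ^ (Fintype.card E - Fintype.card L) * eqOn (A.image (e v)) z z' := by
    intro z z'
    rw [sum_comp_injective he (fun w => conj (t v (A.piecewise (z ∘ e v) w)) *
      t v (A.piecewise (z' ∘ e v) w)), (ht v).sum_piecewise (hn v) A hhalf]
    simp [eqOn]
  simp only [hsum] at key
  have hL : Fintype.card L ≤ Fintype.card E := Fintype.card_le_of_injective _ he
  have hd' : (d : ℂ) ≠ 0 := Nat.cast_ne_zero.2 hd
  have hpow : (d : ℂ) ^ Fintype.card E =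
      (d : ℂ) ^ (Fintype.card E - Fintype.card L) * (d : ℂ) ^ Fintype.card L := by
    rw [← pow_add, Nat.sub_add_cancel hL]
  have e1 : doubleSum t e V' C h = ∑ z : E → Fin d, ∑ z' : E → Fin d, eqOn O z z' *
      (R z z' * (conj (t v (z ∘ e v)) * t v (z' ∘ e v))) := by
    unfold doubleSum
    refine Finset.sum_congr rfl fun z _ => Finset.sum_congr rfl fun z' _ => ?_
    rw [← Finset.mul_prod_erase V' _ hv]
    nth_rewrite 1 [← hOC]
    rw [eqOn_union]
    simp only [R]
    ring
  have e2 : (d : ℂ) ^ (Fintype.card E - Fintype.card L) *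
      doubleSum t e (V'.erase v) (C ∪ Finset.univ.image (e v)) h =
      ∑ z : E → Fin d, ∑ z' : E → Fin d, eqOn O z z' * (R z z' *
        ((d : ℂ) ^ (Fintype.card E - Fintype.card L) * eqOn (A.image (e v)) z z')) := by
    unfold doubleSum
    rw [Finset.mul_sum]
    refine Finset.sum_congr rfl fun z _ => ?_
    rw [Finset.mul_sum]
    refine Finset.sum_congr rfl fun z' _ => ?_
    rw [hC', eqOn_union, eqOn_union]
    simp only [R]
    ring
  refine mul_left_cancel₀ (pow_ne_zero (Fintype.card E - Fintype.card L) hd') ?_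
  rw [e2, key, e1, hpow]
  ring

/-- The sites of the tiles of `K`. -/
def sitesOf (e : V → L → E) (K : Finset V) : Finset E := K.biUnion fun v => Finset.univ.image (e v)

/-- The tiles of `K` can be removed one after the other: as long as some are left, one of them has at
most half of its legs outside `B` and away from the tiles already removed. -/
def Peelable (e : V → L → E) (B : Finset E) (K : Finset V) : Prop :=
  ∀ Q ⊂ K, ∃ v ∈ K \ Q,
    2 * (Finset.univ.filter fun l => e v l ∉ B ∪ sitesOf e Q).card ≤ Fintype.card L

theorem mem_sitesOf {K : Finset V} {s : E} : s ∈ sitesOf e K ↔ ∃ v ∈ K, ∃ l, e v l = s := by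
  simp [sitesOf]

theorem doubleSum_peel (hd : d ≠ 0) (ht : ∀ v, IsPerfectTensor (t v))
    (hn : ∀ v, ∑ x, ‖t v x‖ ^ 2 = 1) (hw : Wiring e F B) {K : Finset V} (hK : Peelable e B K)
    {h : (E → Fin d) → (E → Fin d) → ℂ} (hh : DependsOn h F) :
    (d : ℂ) ^ (K.card * Fintype.card L) * doubleSum t e Finset.univ B h =
      doubleSum t e (Finset.univ \ K) (B ∪ sitesOf e K) h := by
  suffices H : ∀ n ≤ K.card, ∃ Q ⊆ K, Q.card = n ∧
      (d : ℂ) ^ (Q.card * Fintype.card L) * doubleSum t e Finset.univ B h =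
        doubleSum t e (Finset.univ \ Q) (B ∪ sitesOf e Q) h by
    obtain ⟨Q, hQ, hc, hs⟩ := H _ le_rfl
    rwa [Finset.eq_of_subset_of_card_le hQ hc.ge] at hs
  intro n
  induction n with
  | zero => exact fun _ => ⟨∅, by simp, rfl, by simp [sitesOf]⟩
  | succ n ih =>
    intro hnK
    obtain ⟨Q, hQ, hc, hs⟩ := ih (by omega)
    obtain ⟨v, hv, hhalf⟩ := hK Q ⟨hQ, fun h => by have := Finset.card_le_card h; omega⟩
    obtain ⟨hvK, hvQ⟩ := Finset.mem_sdiff.1 hv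
    refine ⟨insert v Q, Finset.insert_subset hvK hQ, by rw [Finset.card_insert_of_notMem hvQ, hc],
      ?_⟩
    have := doubleSum_erase (F := F) hd ht hn (V' := Finset.univ \ Q) (C := B ∪ sitesOf e Q) (v := v)
      (by simp [hvQ]) (hw.injective v) hhalf ?_ ?_ hh
    · rw [Finset.card_insert_of_notMem hvQ, add_mul, one_mul, pow_add, mul_comm ((d : ℂ) ^ _),
        mul_assoc, hs, this]
      congr 1
      · ext u; simp [not_or]
      · simp only [sitesOf, Finset.biUnion_insert]
        rw [Finset.union_assoc, Finset.union_comm (Finset.biUnion _ _)]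
    · intro l hl hlF
      rcases Finset.mem_union.1 hl with hl | hl
      · exact Finset.disjoint_left.1 hw.disjoint hlF hl
      · obtain ⟨u, hu, l', hl'⟩ := mem_sitesOf.1 hl
        have := hw.isOpen v u l l' (Finset.mem_union_left _ hlF) hl'.symm
        exact hvQ (this ▸ hu)
    · intro l hl u hu huv l' hl'
      rcases Finset.mem_union.1 hl with hl | hl
      · exact huv (hw.isOpen v u l l' (Finset.mem_union_right _ hl) hl'.symm).symm
      · obtain ⟨u', hu', l'', hl''⟩ := mem_sitesOf.1 hl
        have huQ : u ∉ Q := (Finset.mem_sdiff.1 hu).2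
        rcases hw.two v u u' l l' l'' hl'.symm hl''.symm with h | h | h
        · exact huv h.symm
        · exact hvQ (h ▸ hu')
        · exact huQ (h ▸ hu')

/-- If all the tiles can be removed, the double contraction is diagonal in the labels at `F`. -/
theorem doubleSum_univ (hd : d ≠ 0) (ht : ∀ v, IsPerfectTensor (t v))
    (hn : ∀ v, ∑ x, ‖t v x‖ ^ 2 = 1) (hw : Wiring e F B) (hK : Peelable e B Finset.univ)
    (hcover : ∀ s, ∃ v l, e v l = s) (x x' : E → Fin d) :
    (d : ℂ) ^ (Fintype.card V * Fintype.card L) *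
      doubleSum t e Finset.univ B (fun z z' => eqOn F z x * eqOn F z' x') =
      (d : ℂ) ^ (Fintype.card E - F.card) * eqOn F x x' := by
  have := doubleSum_peel (h := fun z z' => eqOn F z x * eqOn F z' x') hd ht hn hw hK
    (fun z z' w w' h h' => by
      simp only []
      rw [eqOn_congr (w := w) (w' := x) h fun _ _ => rfl,
        eqOn_congr (w := w') (w' := x') h' fun _ _ => rfl])
  rw [Finset.card_univ] at this
  rw [this]
  have hall : B ∪ sitesOf e Finset.univ = (Finset.univ : Finset E) := by
    ext s
    obtain ⟨v, l, h⟩ := hcover s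
    simp only [Finset.mem_union, Finset.mem_univ, iff_true]
    exact Or.inr (mem_sitesOf.2 ⟨v, Finset.mem_univ _, l, h⟩)
  rw [hall]
  unfold doubleSum
  rw [← sum_eqOn F x, Finset.sum_mul]
  refine Finset.sum_congr rfl fun z _ => ?_
  rw [Finset.sum_eq_single z]
  · by_cases hz : ∀ s ∈ F, z s = x s
    · have h1 : eqOn F z x' = eqOn F x x' := eqOn_congr hz fun _ _ => rfl
      simp only [h1]
      simp [eqOn]
    · simp [eqOn, hz]
  · intro z' _ hz'
    have : eqOn Finset.univ z z' = 0 :=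
      if_neg fun h => hz' (funext fun s => (h s (Finset.mem_univ s)).symm)
    rw [this, zero_mul]
  · simp

/-- The double contraction is proportional to the identity in the labels of the open sites `X` of
the removed tiles, whatever is prescribed at the other sites of `F`. -/
theorem doubleSum_eq_ite (hd : d ≠ 0) (ht : ∀ v, IsPerfectTensor (t v))
    (hn : ∀ v, ∑ x, ‖t v x‖ ^ 2 = 1) (hw : Wiring e F B) {K : Finset V} (hK : Peelable e B K)
    {X : Finset E} (hXF : X ⊆ F) (hXK : X ⊆ sitesOf e K)
    {k : (E → Fin d) → (E → Fin d) → ℂ} (hk : DependsOn k (F \ X)) :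
    ∃ g : ℂ, ∀ x x' : E → Fin d,
      doubleSum t e Finset.univ B (fun z z' => (eqOn X z x * eqOn X z' x') * k z z') =
        eqOn X x x' * g := by
  have hd' : (d : ℂ) ≠ 0 := Nat.cast_ne_zero.2 hd
  let R : (E → Fin d) → (E → Fin d) → ℂ := fun z z' => eqOn ((B ∪ sitesOf e K) \ X) z z' *
    (k z z' * ∏ u ∈ Finset.univ \ K, conj (t u (z ∘ e u)) * t u (z' ∘ e u))
  refine ⟨((d : ℂ) ^ (K.card * Fintype.card L))⁻¹ * ((d : ℂ) ^ Fintype.card E)⁻¹ *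
    ((d : ℂ) ^ (Fintype.card E - X.card) *
      ∑ z : E → Fin d, ∑ z' : E → Fin d, eqOn X z z' * R z z'), fun x x' => ?_⟩
  have hpeel := doubleSum_peel (h := fun z z' => (eqOn X z x * eqOn X z' x') * k z z') hd ht hn hw hK
    (fun z z' w w' h h' => by
      simp only []
      rw [eqOn_congr (w := w) (w' := x) (fun s hs => h s (hXF hs)) fun _ _ => rfl,
        eqOn_congr (w := w') (w' := x') (fun s hs => h' s (hXF hs)) fun _ _ => rfl,
        hk z z' w w' (fun s hs => h s (Finset.mem_sdiff.1 hs).1)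
          fun s hs => h' s (Finset.mem_sdiff.1 hs).1])
  have hR : ∀ w z z', R (X.piecewise w z) (X.piecewise w z') = R z z' := by
    intro w z z'
    have h1 : ∀ (z : E → Fin d), ∀ u ∈ Finset.univ \ K, X.piecewise w z ∘ e u = z ∘ e u := by
      intro z u hu
      funext l
      refine Finset.piecewise_eq_of_notMem _ _ _ fun hl => ?_
      obtain ⟨v, hv, l', hl'⟩ := mem_sitesOf.1 (hXK hl)
      have := hw.isOpen u v l l' (Finset.mem_union_left _ (hXF hl)) hl'.symm
      exact (Finset.mem_sdiff.1 hu).2 (this ▸ hv)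
    simp only [R]
    rw [hk _ _ z z' (fun s hs => by simp [(Finset.mem_sdiff.1 hs).2])
      (fun s hs => by simp [(Finset.mem_sdiff.1 hs).2]), eqOn_congr (w := z) (w' := z')
      (fun s hs => by simp [(Finset.mem_sdiff.1 hs).2])
      (fun s hs => by simp [(Finset.mem_sdiff.1 hs).2]),
      Finset.prod_congr rfl fun u hu => by rw [h1 z u hu, h1 z' u hu]]
  have key := sum_eqOn_mul_piecewise X fun z z' : E → Fin d =>
    (eqOn X z x * eqOn X z' x') * R z z'
  have hc : ∀ (w z x : E → Fin d), eqOn X (X.piecewise w z) x = eqOn X w x := fun w z x =>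
    eqOn_congr (fun s hs => by simp [hs]) fun _ _ => rfl
  simp only [hR, hc, ← Finset.sum_mul] at key
  have hsum : ∑ w : E → Fin d, eqOn X w x * eqOn X w x' =
      (d : ℂ) ^ (Fintype.card E - X.card) * eqOn X x x' := by
    rw [← sum_eqOn X x, Finset.sum_mul]
    refine Finset.sum_congr rfl fun w _ => ?_
    by_cases hz : ∀ s ∈ X, w s = x s
    · rw [eqOn_congr (z := w) (w := x) (w' := x') hz fun _ _ => rfl]
    · simp [eqOn, hz]
  have e1 : doubleSum t e (Finset.univ \ K) (B ∪ sitesOf e K)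
      (fun z z' => (eqOn X z x * eqOn X z' x') * k z z') =
      ∑ z : E → Fin d, ∑ z' : E → Fin d, eqOn X z z' * ((eqOn X z x * eqOn X z' x') * R z z') := by
    unfold doubleSum
    refine Finset.sum_congr rfl fun z _ => Finset.sum_congr rfl fun z' _ => ?_
    nth_rewrite 1 [← Finset.union_sdiff_of_subset (hXK.trans (Finset.subset_union_right (s₁ := B)))]
    rw [eqOn_union]
    simp only [R]
    ring
  rw [e1] at hpeel
  rw [hsum] at key
  have e2 : ∑ z : E → Fin d, ∑ z' : E → Fin d, eqOn X z z' *
      (((d : ℂ) ^ (Fintype.card E - X.card) * eqOn X x x') * R z z') =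
      eqOn X x x' * ((d : ℂ) ^ (Fintype.card E - X.card) *
      ∑ z : E → Fin d, ∑ z' : E → Fin d, eqOn X z z' * R z z') := by
    simp only [Finset.mul_sum]
    refine Finset.sum_congr rfl fun z _ => Finset.sum_congr rfl fun z' _ => ?_
    ring
  rw [e2, ← hpeel] at key
  have h1 := pow_ne_zero (K.card * Fintype.card L) hd'
  have h2 := pow_ne_zero (Fintype.card E) hd'
  rw [mul_left_comm, key]
  field_simp

end Contraction

/-! ### Walls and sides -/

section Geometry

variable {p q : ℕ}

theorem gen_pow_q (i : ZMod p) : gen p q i ^ q = 1 := by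
  have : (PresentedGroup.mk (relators p q)) (FreeGroup.of i ^ q) = 1 :=
    PresentedGroup.one_of_mem ⟨i, Or.inl rfl⟩
  simpa [gen, PresentedGroup.of] using this

theorem gen_commute (i : ZMod p) : Commute (gen p q i) (gen p q (i + 1)) := by
  have : (PresentedGroup.mk (relators p q))
      (FreeGroup.of i * FreeGroup.of (i + 1) * (FreeGroup.of i)⁻¹ * (FreeGroup.of (i + 1))⁻¹) = 1 :=
    PresentedGroup.one_of_mem ⟨i, Or.inr rfl⟩
  simp only [map_mul, map_inv] at this
  exact mul_inv_eq_iff_eq_mul.1 (mul_inv_eq_one.1 this)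

/-- Two labels are equal or cyclically adjacent. -/
def Near (i j : ZMod p) : Prop := j = i ∨ j = i + 1 ∨ j = i - 1

theorem Near.gen_commute {i j : ZMod p} (h : Near i j) : Commute (gen p q i) (gen p q j) := by
  rcases h with rfl | rfl | rfl
  · exact Commute.refl _
  · exact Bourdon.gen_commute i
  · have := Bourdon.gen_commute (q := q) (i - 1)
    rw [sub_add_cancel] at this
    exact this.symm

theorem Near.symm {i j : ZMod p} (h : Near i j) : Near j i := by
  rcases h with rfl | rfl | rfl
  · exact Or.inl rfl
  · exact Or.inr (Or.inr (by ring))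
  · exact Or.inr (Or.inl (by ring))

/-- The stabilizer of the wall through the edge `i` of the chamber `1`. -/
def wallStab (p q : ℕ) (i : ZMod p) : Subgroup (Chamber p q) :=
  Subgroup.closure {x | ∃ j, Near i j ∧ x = gen p q j}

theorem gen_mem_wallStab {i j : ZMod p} (h : Near i j) : gen p q j ∈ wallStab p q i :=
  Subgroup.subset_closure ⟨j, h, rfl⟩

/-- The walls: pairs of a label `i` and a coset of `wallStab p q i`. -/
abbrev Wall (p q : ℕ) : Type := Σ i : ZMod p, Chamber p q ⧸ wallStab p q i

/-- The wall through the edge `i` of `g`. -/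
def wallAt (i : ZMod p) (g : Chamber p q) : Wall p q := ⟨i, (g : Chamber p q ⧸ wallStab p q i)⟩

theorem wallAt_eq_iff {i j : ZMod p} {g h : Chamber p q} :
    wallAt i g = wallAt j h ↔ i = j ∧ g⁻¹ * h ∈ wallStab p q i := by
  unfold wallAt
  constructor
  · intro hw
    obtain rfl : i = j := congrArg Sigma.fst hw
    exact ⟨rfl, QuotientGroup.eq.1 (eq_of_heq (Sigma.mk.inj hw).2)⟩
  · rintro ⟨rfl, h⟩
    rw [QuotientGroup.eq.2 h]

theorem wallAt_mul {i j : ZMod p} (h : Near i j) (g : Chamber p q) (k : ℕ) :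
    wallAt i (g * gen p q j ^ k) = wallAt i g :=
  (wallAt_eq_iff.2 ⟨rfl, by simpa using pow_mem (gen_mem_wallStab h) k⟩).symm

open Classical in
/-- The function on the walls with value `k` at `C` and zero elsewhere. -/
def jump (C : Wall p q) (k : ZMod q) : Wall p q → ZMod q := fun D => if D = C then k else 0

theorem jump_add (C : Wall p q) (k l : ZMod q) : jump C (k + l) = jump C k + jump C l := by
  funext D
  by_cases h : D = C <;> simp [jump, h]

theorem jump_self (C : Wall p q) (k : ZMod q) : jump C k C = k := by simp [jump]

theorem jump_of_ne {C D : Wall p q} (h : D ≠ C) (k : ZMod q) : jump C k D = 0 := by simp [jump, h]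

/-- The step across the edge `i`, which records the crossed wall. -/
def crossStep (p q : ℕ) (i : ZMod p) : Equiv.Perm (Chamber p q × (Wall p q → ZMod q)) where
  toFun x := (x.1 * gen p q i, x.2 + jump (wallAt i x.1) 1)
  invFun x := (x.1 * (gen p q i)⁻¹, x.2 - jump (wallAt i x.1) 1)
  left_inv x := by
    have := wallAt_mul (q := q) (Or.inl rfl : Near i i) x.1 1
    rw [pow_one] at this
    simp [this]
  right_inv x := by
    have := wallAt_mul (q := q) (Or.inl rfl : Near i i) (x.1 * (gen p q i)⁻¹) 1
    rw [pow_one, inv_mul_cancel_right] at this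
    simp [this]

theorem crossStep_pow (i : ZMod p) (k : ℕ) (x : Chamber p q × (Wall p q → ZMod q)) :
    (crossStep p q i ^ k) x = (x.1 * gen p q i ^ k, x.2 + jump (wallAt i x.1) k) := by
  induction k with
  | zero =>
    have : jump (wallAt i x.1) (0 : ZMod q) = 0 := by funext D; simp [jump]
    simp [this]
  | succ k ih =>
    rw [pow_succ', Equiv.Perm.mul_apply, ih]
    change (x.1 * gen p q i ^ k * gen p q i, x.2 + jump (wallAt i x.1) k +
      jump (wallAt i (x.1 * gen p q i ^ k)) 1) = _
    rw [wallAt_mul (Or.inl rfl), pow_succ, mul_assoc, add_assoc, ← jump_add]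
    push_cast
    rfl

theorem crossStep_pow_q (i : ZMod p) : crossStep p q i ^ q = 1 := by
  ext1 x
  rw [crossStep_pow, gen_pow_q]
  have : jump (wallAt i x.1) ((q : ℕ) : ZMod q) = 0 := by funext D; simp [jump]
  rw [this, mul_one, add_zero]
  rfl

theorem crossStep_commute (i : ZMod p) : Commute (crossStep p q i) (crossStep p q (i + 1)) := by
  ext1 x
  have h1 := wallAt_mul (q := q) (Or.inr (Or.inl rfl) : Near i (i + 1)) x.1 1
  have h2 := wallAt_mul (q := q) (Near.symm (Or.inr (Or.inl rfl) : Near i (i + 1))) x.1 1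
  rw [pow_one] at h1 h2
  change (x.1 * gen p q (i + 1) * gen p q i, x.2 + jump (wallAt (i + 1) x.1) 1 +
    jump (wallAt i (x.1 * gen p q (i + 1))) 1) = (x.1 * gen p q i * gen p q (i + 1),
    x.2 + jump (wallAt i x.1) 1 + jump (wallAt (i + 1) (x.1 * gen p q i)) 1)
  rw [h1, h2, mul_assoc, mul_assoc, (gen_commute i).eq, add_assoc, add_assoc,
    add_comm (jump (wallAt (i + 1) x.1) 1)]

/-- The action of `Γ` by crossing edges; inverses turn right multiplication into a left action. -/
def crossHom (p q : ℕ) : Chamber p q →* Equiv.Perm (Chamber p q × (Wall p q → ZMod q)) :=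
  PresentedGroup.toGroup (f := fun i => (crossStep p q i)⁻¹) (by
    rintro r ⟨i, rfl | rfl⟩
    · simp [crossStep_pow_q]
    · simp only [map_mul, map_inv, FreeGroup.lift_apply_of]
      rw [mul_inv_eq_one, inv_inv, (crossStep_commute i).inv_inv.eq, inv_mul_cancel_right])

theorem crossHom_gen (i : ZMod p) : crossHom p q (gen p q i) = (crossStep p q i)⁻¹ :=
  PresentedGroup.toGroup.of _

/-- The first component of the action is right multiplication. -/
theorem crossHom_inv_fst (g h : Chamber p q) (f : Wall p q → ZMod q) :
    ((crossHom p q g)⁻¹ (h, f)).1 = h * g := by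
  let K : Subgroup (Chamber p q) :=
    { carrier := {g | ∀ x, ((crossHom p q g)⁻¹ x).1 = x.1 * g}
      one_mem' := fun x => by simp
      mul_mem' := fun {a b} ha hb x => by
        rw [map_mul, mul_inv_rev, Equiv.Perm.mul_apply, hb, ha, mul_assoc]
      inv_mem' := fun {a} ha x => by
        have := ha (crossHom p q a x)
        rw [← Equiv.Perm.mul_apply, inv_mul_cancel, Equiv.Perm.one_apply] at this
        rw [map_inv, inv_inv, this, mul_inv_cancel_right] }
  have hK : g ∈ K := PresentedGroup.generated_by _ K (fun i x => by
    change ((crossHom p q (gen p q i))⁻¹ x).1 = x.1 * gen p q i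
    rw [crossHom_gen, inv_inv]
    rfl) g
  exact hK (h, f)

/-- The side of the chamber `g` at each wall, relative to the chamber `1`: the `q` components of the
complement of a wall are numbered by `ZMod q`. -/
def side (g : Chamber p q) : Wall p q → ZMod q := ((crossHom p q g)⁻¹ (1, 0)).2

/-- Crossing an edge changes the side of the wall through this edge, and no other side. -/
theorem side_mul_pow (g : Chamber p q) (i : ZMod p) (k : ℕ) :
    side (g * gen p q i ^ k) = side g + jump (wallAt i g) k := by
  unfold side
  have h1 : (crossHom p q g)⁻¹ (1, 0) = (g, ((crossHom p q g)⁻¹ (1, 0)).2) :=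
    Prod.ext (by rw [crossHom_inv_fst, one_mul]) rfl
  rw [map_mul, mul_inv_rev, Equiv.Perm.mul_apply, map_pow, crossHom_gen, inv_pow, inv_inv, h1,
    crossStep_pow]

/-- The sides at which two chambers differ. -/
def sep (g h : Chamber p q) : Set (Wall p q) := {C | side h C ≠ side g C}

theorem neighbor_side [NeZero q] (g : Chamber p q) (l : ContractedLeg p q) :
    side (neighbor g l) = side g + jump (wallAt l.1 g) l.2 := by
  rw [neighbor, side_mul_pow, ZMod.natCast_zmod_val]

theorem side_neighbor_self [NeZero q] (g : Chamber p q) (l : ContractedLeg p q) :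
    side (neighbor g l) (wallAt l.1 g) = side g (wallAt l.1 g) + l.2 := by
  rw [neighbor_side, Pi.add_apply, jump_self]

theorem side_neighbor_of_ne [NeZero q] {g : Chamber p q} {l : ContractedLeg p q} {C : Wall p q}
    (h : C ≠ wallAt l.1 g) : side (neighbor g l) C = side g C := by
  rw [neighbor_side, Pi.add_apply, jump_of_ne h, add_zero]

theorem neighbor_ne [NeZero q] (g : Chamber p q) (l : ContractedLeg p q) : neighbor g l ≠ g := by
  intro h
  have := side_neighbor_self g l
  rw [h, left_eq_add] at this
  exact l.2.2 this

theorem neighbor_injective [NeZero q] (g : Chamber p q) : Function.Injective (neighbor g) := by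
  intro l l' h
  have h1 := side_neighbor_self g l
  have hw : wallAt l.1 g = wallAt l'.1 g := by
    by_contra hne
    rw [h, side_neighbor_of_ne hne, left_eq_add] at h1
    exact l.2.2 h1
  rw [h, hw, side_neighbor_self, add_right_inj] at h1
  exact Prod.ext (wallAt_eq_iff.1 hw).1 (Subtype.ext h1.symm)

/-- Every other chamber at the same edge is a neighbor. -/
theorem exists_neighbor_eq_mul_pow [NeZero q] (g : Chamber p q) (i : ZMod p) (k : ℕ) :
    g * gen p q i ^ k = g ∨ ∃ l : ContractedLeg p q, l.1 = i ∧ neighbor g l = g * gen p q i ^ k := by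
  have hk : gen p q i ^ k = gen p q i ^ ((k : ZMod q)).val := by
    rw [ZMod.val_natCast, pow_eq_pow_mod k (gen_pow_q i)]
  by_cases h : (k : ZMod q) = 0
  · left; rw [hk, h]; simp
  · right; exact ⟨(i, ⟨k, h⟩), rfl, by rw [hk]; rfl⟩

theorem exists_neighbor_symm [NeZero q] (g : Chamber p q) (l : ContractedLeg p q) :
    ∃ l' : ContractedLeg p q, l'.1 = l.1 ∧ neighbor (neighbor g l) l' = g := by
  have h0 : (l.2 : ZMod q).val ≤ q := (ZMod.val_lt _).le
  have h1 : neighbor g l * gen p q l.1 ^ (q - (l.2 : ZMod q).val) = g := by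
    rw [neighbor, mul_assoc, ← pow_add, Nat.add_sub_cancel' h0, gen_pow_q, mul_one]
  rcases exists_neighbor_eq_mul_pow (neighbor g l) l.1 (q - (l.2 : ZMod q).val) with h | ⟨l', h, h'⟩
  · rw [h1] at h
    exact absurd h.symm (neighbor_ne g l)
  · exact ⟨l', h, by rw [h', h1]⟩

theorem networkGraph_adj [NeZero q] {g h : Chamber p q} :
    (networkGraph p q).Adj g h ↔ ∃ l : ContractedLeg p q, h = neighbor g l := by
  unfold networkGraph
  rw [SimpleGraph.fromRel_adj]
  constructor
  · rintro ⟨-, h | ⟨l, rfl⟩⟩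
    · exact h
    · obtain ⟨l', -, h⟩ := exists_neighbor_symm h l
      exact ⟨l', h.symm⟩
  · rintro ⟨l, rfl⟩
    exact ⟨(neighbor_ne g l).symm, Or.inl ⟨l, rfl⟩⟩

/-! ### Geodesics of the network -/

/-- The end of the gallery that starts at `g` and crosses edges as prescribed. -/
def pathEnd (g : Chamber p q) (w : List (ContractedLeg p q)) : Chamber p q := w.foldl neighbor g

theorem pathEnd_append (g : Chamber p q) (w w' : List (ContractedLeg p q)) :
    pathEnd g (w ++ w') = pathEnd (pathEnd g w) w' := List.foldl_append

theorem mul_pathEnd (a g : Chamber p q) (w : List (ContractedLeg p q)) :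
    pathEnd (a * g) w = a * pathEnd g w := by
  induction w generalizing g with
  | nil => rfl
  | cons l w ih =>
    change pathEnd (neighbor (a * g) l) w = a * pathEnd (neighbor g l) w
    rw [← ih, neighbor, neighbor, mul_assoc]

section

variable [NeZero p] [NeZero q]

theorem dist_triangle (a b c : Chamber p q) : (networkGraph p q).dist a c ≤
    (networkGraph p q).dist a b + (networkGraph p q).dist b c := by
  have hconn : (networkGraph p q).Connected :=
    (SimpleGraph.connected_iff _).2 ⟨Network.networkGraph_reachable, ⟨1⟩⟩
  exact hconn.dist_triangle

theorem dist_neighbor_le (g : Chamber p q) (l : ContractedLeg p q) :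
    (networkGraph p q).dist g (neighbor g l) ≤ 1 :=
  (SimpleGraph.dist_eq_one_iff_adj.2 (networkGraph_adj.2 ⟨l, rfl⟩)).le

theorem dist_mul_pow_le (g : Chamber p q) (i : ZMod p) (k : ℕ) :
    (networkGraph p q).dist g (g * gen p q i ^ k) ≤ 1 := by
  rcases exists_neighbor_eq_mul_pow g i k with h | ⟨l, -, h⟩
  · rw [h, SimpleGraph.dist_self]; exact Nat.zero_le _
  · rw [← h]; exact dist_neighbor_le g l

theorem dist_pathEnd_le (g : Chamber p q) (w : List (ContractedLeg p q)) :
    (networkGraph p q).dist g (pathEnd g w) ≤ w.length := by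
  induction w generalizing g with
  | nil => simp [pathEnd]
  | cons l w ih =>
    have h1 := dist_triangle g (neighbor g l) (pathEnd g (l :: w))
    have h2 := dist_neighbor_le g l
    have h3 := ih (neighbor g l)
    simp only [List.length_cons]
    refine h1.trans ?_
    change _ + (networkGraph p q).dist (neighbor g l) (pathEnd (neighbor g l) w) ≤ _
    omega

theorem exists_geodesic (g h : Chamber p q) :
    ∃ w : List (ContractedLeg p q), pathEnd g w = h ∧ w.length = (networkGraph p q).dist g h := by
  obtain ⟨W, hW⟩ := (Network.networkGraph_reachable g h).exists_walk_length_eq_dist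
  rw [← hW]
  clear hW
  induction W with
  | nil => exact ⟨[], rfl, rfl⟩
  | cons hadj W ih =>
    obtain ⟨w, hw, hl⟩ := ih
    obtain ⟨l, rfl⟩ := networkGraph_adj.1 hadj
    exact ⟨l :: w, hw, by simp [hl]⟩

end

end Geometry

/-! ### Walls crossed by geodesics -/

section Geometry

variable {p q : ℕ}

open Classical in
theorem retract_relators (q : ℕ) (A : ZMod p → Prop) : ∀ r ∈ relators p q,
    FreeGroup.lift (fun i => if A i then gen p q i else 1) r = 1 := by
  rintro r ⟨i, rfl | rfl⟩
  · by_cases h : A i <;> simp [h, gen_pow_q]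
  · simp only [map_mul, map_inv, FreeGroup.lift_apply_of]
    by_cases h : A i <;> by_cases h' : A (i + 1) <;> simp [h, h', (gen_commute i).eq]

/-- The retraction of `Γ` that kills the generators with labels outside `A`. -/
def retract (q : ℕ) (A : ZMod p → Prop) : Chamber p q →* Chamber p q :=
  PresentedGroup.toGroup (retract_relators q A)

theorem retract_gen_of_mem {A : ZMod p → Prop} {i : ZMod p} (h : A i) :
    retract q A (gen p q i) = gen p q i := by
  have := PresentedGroup.toGroup.of (x := i) (rels := relators p q) (h := retract_relators q A)
  rw [if_pos h] at this
  exact this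

theorem retract_gen_of_notMem {A : ZMod p → Prop} {i : ZMod p} (h : ¬ A i) :
    retract q A (gen p q i) = 1 := by
  have := PresentedGroup.toGroup.of (x := i) (rels := relators p q) (h := retract_relators q A)
  rw [if_neg h] at this
  exact this

theorem retract_of_mem_wallStab {i : ZMod p} {x : Chamber p q} (hx : x ∈ wallStab p q i) :
    retract q (Near i) x = x := by
  have : wallStab p q i ≤ (retract q (Near i)).eqLocus (MonoidHom.id _) := by
    refine (Subgroup.closure_le _).2 ?_
    rintro _ ⟨j, hj, rfl⟩
    exact retract_gen_of_mem hj
  exact this hx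

theorem gen_notMem_wallStab [NeZero q] {i : ZMod p} {l : ContractedLeg p q} (h : ¬ Near i l.1) :
    gen p q l.1 ^ (l.2 : ZMod q).val ∉ wallStab p q i := by
  intro hx
  have := retract_of_mem_wallStab hx
  rw [map_pow, retract_gen_of_notMem h, one_pow] at this
  refine neighbor_ne (1 : Chamber p q) l ?_
  rw [neighbor, ← this, one_mul]

/-- The stabilizer of a wall with label `i` is the product of the subgroup generated by `s_{i-1}` and
`s_{i+1}` and that generated by `s_i`. -/
theorem exists_eq_retract_mul_pow [NeZero q] {i : ZMod p} {x : Chamber p q}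
    (hx : x ∈ wallStab p q i) :
    ∃ m : ℕ, x = retract q (fun j => Near i j ∧ j ≠ i) x * gen p q i ^ m := by
  set ρ := retract q (fun j => Near i j ∧ j ≠ i) with hρ
  let K : Subgroup (Chamber p q) :=
    { carrier := {x | Commute (ρ x) (gen p q i) ∧ ∃ m : ℕ, x = ρ x * gen p q i ^ m}
      one_mem' := ⟨by simp, 0, by simp⟩
      mul_mem' := by
        rintro a b ⟨ha, m, hm⟩ ⟨hb, n, hn⟩
        refine ⟨by rw [map_mul]; exact ha.mul_left hb, m + n, ?_⟩
        rw [map_mul, pow_add, mul_assoc, ← mul_assoc (ρ b), (hb.pow_right m).eq, mul_assoc,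
          ← mul_assoc, ← hm, ← hn]
      inv_mem' := by
        rintro a ⟨ha, m, hm⟩
        refine ⟨by rw [map_inv]; exact ha.inv_left, m * (q - 1), ?_⟩
        have h1 : gen p q i ^ (m * (q - 1)) = (gen p q i ^ m)⁻¹ := by
          rw [eq_inv_iff_mul_eq_one, ← pow_add, ← Nat.mul_succ, Nat.succ_eq_add_one,
            Nat.sub_add_cancel (NeZero.one_le), mul_comm, pow_mul, gen_pow_q, one_pow]
        nth_rewrite 1 [hm]
        rw [h1, map_inv, mul_inv_rev]
        exact ((ha.pow_right m).inv_inv.eq).symm }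
  have : wallStab p q i ≤ K := by
    refine (Subgroup.closure_le _).2 ?_
    rintro _ ⟨j, hj, rfl⟩
    by_cases hij : j = i
    · subst hij
      have h1 : ρ (gen p q j) = 1 := retract_gen_of_notMem (by simp)
      exact ⟨by rw [h1]; exact Commute.one_left _, 1, by rw [h1]; simp⟩
    · have h1 : ρ (gen p q j) = gen p q j := retract_gen_of_mem ⟨hj, hij⟩
      exact ⟨by rw [h1]; exact hj.gen_commute.symm, 0, by rw [h1]; simp⟩
  exact (this hx).2

variable [NeZero p] [NeZero q]

/-- Retractions do not lengthen galleries. -/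
theorem dist_retract_le (A : ZMod p → Prop) (g : Chamber p q) (w : List (ContractedLeg p q)) :
    (networkGraph p q).dist g (g * retract q A (pathEnd 1 w)) ≤ w.length := by
  induction w generalizing g with
  | nil => simp [pathEnd]
  | cons l w ih =>
    have h1 : pathEnd 1 (l :: w) = gen p q l.1 ^ (l.2 : ZMod q).val * pathEnd 1 w := by
      rw [← mul_pathEnd, mul_one]
      change pathEnd (neighbor 1 l) w = _
      rw [neighbor, one_mul]
    rw [h1, map_mul, map_pow, ← mul_assoc, List.length_cons]
    have h2 := ih (g * retract q A (gen p q l.1) ^ (l.2 : ZMod q).val)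
    refine (dist_triangle _ (g * retract q A (gen p q l.1) ^ (l.2 : ZMod q).val) _).trans ?_
    rw [add_comm]
    refine add_le_add h2 ?_
    by_cases h : A l.1
    · rw [retract_gen_of_mem h]; exact dist_mul_pow_le _ _ _
    · rw [retract_gen_of_notMem h]; simp

/-- The walls crossed by a gallery. -/
def pathWalls (g : Chamber p q) : List (ContractedLeg p q) → List (Wall p q)
  | [] => []
  | l :: w => wallAt l.1 g :: pathWalls (neighbor g l) w

theorem length_pathWalls (g : Chamber p q) (w : List (ContractedLeg p q)) :
    (pathWalls g w).length = w.length := by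
  induction w generalizing g with
  | nil => rfl
  | cons l w ih => simp [pathWalls, ih]

theorem exists_of_mem_pathWalls {g : Chamber p q} {w : List (ContractedLeg p q)} {C : Wall p q}
    (h : C ∈ pathWalls g w) : ∃ w₁ l w₂, w = w₁ ++ l :: w₂ ∧ C = wallAt l.1 (pathEnd g w₁) := by
  induction w generalizing g with
  | nil => simp [pathWalls] at h
  | cons l w ih =>
    rcases List.mem_cons.1 h with h | h
    · exact ⟨[], l, w, rfl, h⟩
    · obtain ⟨w₁, l', w₂, rfl, h'⟩ := ih h
      exact ⟨l :: w₁, l', w₂, rfl, h'⟩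

theorem side_pathEnd_of_notMem {g : Chamber p q} {w : List (ContractedLeg p q)} {C : Wall p q}
    (h : C ∉ pathWalls g w) : side (pathEnd g w) C = side g C := by
  induction w generalizing g with
  | nil => rfl
  | cons l w ih =>
    simp only [pathWalls, List.mem_cons, not_or] at h
    exact (ih h.2).trans (side_neighbor_of_ne h.1)

theorem mem_pathWalls_iff {g : Chamber p q} {w : List (ContractedLeg p q)}
    (hw : (pathWalls g w).Nodup) {C : Wall p q} :
    C ∈ pathWalls g w ↔ C ∈ sep g (pathEnd g w) := by
  refine ⟨fun h => ?_, fun h => by_contra fun hC => h (side_pathEnd_of_notMem hC)⟩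
  induction w generalizing g with
  | nil => simp [pathWalls] at h
  | cons l w ih =>
    simp only [pathWalls, List.nodup_cons] at hw
    rcases List.mem_cons.1 h with rfl | h
    · change side (pathEnd (neighbor g l) w) _ ≠ _
      rw [side_pathEnd_of_notMem hw.1, side_neighbor_self]
      simpa using l.2.2
    · have hne : C ≠ wallAt l.1 g := fun hC => hw.1 (hC ▸ h)
      have := ih hw.2 h
      change side (pathEnd (neighbor g l) w) C ≠ side g C
      rwa [← side_neighbor_of_ne hne]

/-- A geodesic crosses no wall twice. Between two crossings of a wall, the gallery can be retracted
into the neighborhood of the wall, where it commutes with the crossings. -/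
theorem nodup_pathWalls {g : Chamber p q} {w : List (ContractedLeg p q)}
    (hw : w.length = (networkGraph p q).dist g (pathEnd g w)) : (pathWalls g w).Nodup := by
  induction w generalizing g with
  | nil => simp [pathWalls]
  | cons l w ih =>
    have hend : pathEnd g (l :: w) = pathEnd (neighbor g l) w := rfl
    refine List.nodup_cons.2 ⟨fun hmem => ?_, ih ?_⟩
    · obtain ⟨w₁, l', w₂, rfl, hC⟩ := exists_of_mem_pathWalls hmem
      obtain ⟨hl, hC⟩ := wallAt_eq_iff.1 hC
      have hu : ∀ a : Chamber p q, pathEnd a w₁ = a * pathEnd 1 w₁ := fun a => by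
        rw [← mul_pathEnd, mul_one]
      rw [hu, neighbor, mul_assoc, inv_mul_cancel_left] at hC
      -- the retracted gallery commutes with the two crossings, which merge into one
      obtain ⟨m, hm⟩ := exists_eq_retract_mul_pow hC
      rw [map_mul, map_pow, retract_gen_of_notMem (by simp), one_pow, one_mul] at hm
      have hmid : neighbor (pathEnd (neighbor g l) w₁) l' =
          g * retract q (fun j => Near l.1 j ∧ j ≠ l.1) (pathEnd 1 w₁) *
            gen p q l.1 ^ (m + (l'.2 : ZMod q).val) := by
        rw [hu, neighbor, neighbor, ← hl, mul_assoc g, hm, pow_add]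
        simp only [mul_assoc]
      have hfin : pathEnd g (l :: (w₁ ++ l' :: w₂)) =
          pathEnd (neighbor (pathEnd (neighbor g l) w₁) l') w₂ := by
        rw [hend, pathEnd_append]; rfl
      have h1 := dist_retract_le (fun j => Near l.1 j ∧ j ≠ l.1) g w₁
      have h2 := dist_mul_pow_le (g * retract q (fun j => Near l.1 j ∧ j ≠ l.1) (pathEnd 1 w₁)) l.1
        (m + (l'.2 : ZMod q).val)
      rw [← hmid] at h2
      have h3 := dist_pathEnd_le (neighbor (pathEnd (neighbor g l) w₁) l') w₂
      rw [← hfin] at h3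
      have h4 := dist_triangle g (g * retract q (fun j => Near l.1 j ∧ j ≠ l.1) (pathEnd 1 w₁))
        (pathEnd g (l :: (w₁ ++ l' :: w₂)))
      have h5 := dist_triangle (g * retract q (fun j => Near l.1 j ∧ j ≠ l.1) (pathEnd 1 w₁))
        (neighbor (pathEnd (neighbor g l) w₁) l') (pathEnd g (l :: (w₁ ++ l' :: w₂)))
      simp only [List.length_cons, List.length_append] at hw
      omega
    · refine le_antisymm ?_ (dist_pathEnd_le _ _)
      have h1 := dist_triangle g (neighbor g l) (pathEnd g (l :: w))
      have h2 := dist_neighbor_le g l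
      rw [hend] at hw h1
      simp only [List.length_cons] at hw
      omega

/-- A geodesic crosses exactly the walls that separate its ends. -/
theorem exists_geodesic_walls (g h : Chamber p q) : ∃ w : List (ContractedLeg p q),
    pathEnd g w = h ∧ w.length = (networkGraph p q).dist g h ∧ (pathWalls g w).Nodup ∧
      ∀ C, C ∈ pathWalls g w ↔ C ∈ sep g h := by
  obtain ⟨w, rfl, hl⟩ := exists_geodesic g h
  exact ⟨w, rfl, hl, nodup_pathWalls hl, fun C => mem_pathWalls_iff (nodup_pathWalls hl)⟩

theorem finite_sep (g h : Chamber p q) : (sep g h).Finite := by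
  obtain ⟨w, -, -, -, hC⟩ := exists_geodesic_walls g h
  exact (List.finite_toSet (pathWalls g w)).subset fun C h => (hC C).2 h

/-- Distance counts separating walls. -/
theorem dist_eq_ncard_sep (g h : Chamber p q) :
    (networkGraph p q).dist g h = (sep g h).ncard := by
  classical
  obtain ⟨w, -, hl, hn, hC⟩ := exists_geodesic_walls g h
  have : sep g h = ((pathWalls g w).toFinset : Set (Wall p q)) := by
    ext C; simp [hC]
  rw [this, Set.ncard_coe_finset, List.toFinset_card_of_nodup hn, length_pathWalls, hl]

/-- The edge `i` of `g` leads back to the center `o`: the wall through it separates `g` from `o`. -/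
def IsDescent (o g : Chamber p q) (i : ZMod p) : Prop := wallAt i g ∈ sep o g

theorem dist_neighbor_of_not_isDescent {o g : Chamber p q} {l : ContractedLeg p q}
    (h : ¬ IsDescent o g l.1) :
    (networkGraph p q).dist o (neighbor g l) = (networkGraph p q).dist o g + 1 := by
  rw [dist_eq_ncard_sep, dist_eq_ncard_sep, ← Set.ncard_insert_of_notMem h (finite_sep o g)]
  congr 1
  have h0 : side g (wallAt l.1 g) = side o (wallAt l.1 g) := not_not.1 h
  ext C
  by_cases hC : C = wallAt l.1 g
  · subst hC
    simp only [Set.mem_insert_iff, true_or, iff_true, sep, Set.mem_ofPred_eq, side_neighbor_self, h0]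
    simpa using l.2.2
  · simp [sep, side_neighbor_of_ne hC, hC]

theorem dist_neighbor_of_side_eq {o g : Chamber p q} {l : ContractedLeg p q}
    (h : IsDescent o g l.1)
    (h' : side (neighbor g l) (wallAt l.1 g) = side o (wallAt l.1 g)) :
    (networkGraph p q).dist o (neighbor g l) + 1 = (networkGraph p q).dist o g := by
  rw [dist_eq_ncard_sep, dist_eq_ncard_sep]
  have : sep o g = insert (wallAt l.1 g) (sep o (neighbor g l)) := by
    ext C
    by_cases hC : C = wallAt l.1 g
    · subst hC
      simp only [Set.mem_insert_iff, true_or, iff_true]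
      exact h
    · simp [sep, side_neighbor_of_ne hC, hC]
  rw [this, Set.ncard_insert_of_notMem (fun hm : _ ≠ _ => hm h') (finite_sep _ _)]

theorem dist_neighbor_of_side_ne {o g : Chamber p q} {l : ContractedLeg p q}
    (h : IsDescent o g l.1)
    (h' : side (neighbor g l) (wallAt l.1 g) ≠ side o (wallAt l.1 g)) :
    (networkGraph p q).dist o (neighbor g l) = (networkGraph p q).dist o g := by
  rw [dist_eq_ncard_sep, dist_eq_ncard_sep]
  congr 1
  ext C
  by_cases hC : C = wallAt l.1 g
  · subst hC
    exact ⟨fun _ => h, fun _ => h'⟩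
  · simp [sep, side_neighbor_of_ne hC]

/-- If a wall with label `i` can be crossed to reach the side `c`, some leg does so. -/
theorem exists_neighbor_side_eq (g : Chamber p q) (i : ZMod p) (c : ZMod q)
    (h : side g (wallAt i g) ≠ c) :
    ∃ l : ContractedLeg p q, l.1 = i ∧ side (neighbor g l) (wallAt i g) = c := by
  refine ⟨(i, ⟨c - side g (wallAt i g), fun h0 => h (sub_eq_zero.1 h0).symm⟩), rfl, ?_⟩
  rw [side_neighbor_self]
  simp

/-- The edges of a chamber that lead back to the center are pairwise adjacent. If `s_i` and `s_j` did
not commute, the end of a geodesic that crosses the wall through the edge `j`, and then the edge `i`,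
could be shortened by retraction into the neighborhood of this wall. -/
theorem near_of_isDescent {o g : Chamber p q} {i j : ZMod p} (hi : IsDescent o g i)
    (hj : IsDescent o g j) : Near j i := by
  by_contra hn
  obtain ⟨l, rfl, hl⟩ := exists_neighbor_side_eq g i _ hi
  have hdist := dist_neighbor_of_side_eq hi hl
  have hne : wallAt j g ≠ wallAt l.1 g := fun h => hn (Or.inl (wallAt_eq_iff.1 h).1.symm)
  have hmem : wallAt j g ∈ sep o (neighbor g l) := by
    change side _ _ ≠ _
    rw [side_neighbor_of_ne hne]
    exact hj
  obtain ⟨w, hw, hlen, -, hC⟩ := exists_geodesic_walls o (neighbor g l)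
  obtain ⟨w₁, m, w₂, rfl, hm⟩ := exists_of_mem_pathWalls ((hC _).2 hmem)
  obtain ⟨hjm, hm⟩ := wallAt_eq_iff.1 hm
  set h := pathEnd o w₁ with hh
  have hm' : h⁻¹ * g ∈ wallStab p q j := by simpa using inv_mem hm
  obtain ⟨l', hl', hback⟩ := exists_neighbor_symm g l
  have hg : g = h * (pathEnd 1 (m :: w₂) * gen p q l.1 ^ (l'.2 : ZMod q).val) := by
    rw [pathEnd_append, ← hh] at hw
    rw [← mul_assoc, ← mul_pathEnd, mul_one, hw, ← hl']
    exact hback.symm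
  have hret := retract_of_mem_wallStab hm'
  have hx : h⁻¹ * g = pathEnd 1 (m :: w₂) * gen p q l.1 ^ (l'.2 : ZMod q).val := by
    nth_rewrite 1 [hg]; rw [inv_mul_cancel_left]
  rw [hx, map_mul, map_pow, retract_gen_of_notMem hn, one_pow, mul_one, ← hx] at hret
  have h1 := dist_retract_le (Near j) h (m :: w₂)
  rw [hret, mul_inv_cancel_left] at h1
  have h2 := dist_pathEnd_le o w₁
  rw [← hh] at h2
  have h3 := dist_triangle o h g
  simp only [List.length_append, List.length_cons] at hlen h1
  omega

/-! ### Wedges in terms of sides -/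

theorem onTreeWall_iff {T g : Chamber p q} {i : ZMod p} :
    OnTreeWall T i g ↔ wallAt i g = wallAt i T := by
  constructor
  · intro h
    induction h with
    | base => rfl
    | step h j k _ hj ih => rw [wallAt_mul hj, ih]
  · intro h
    have hmem := (wallAt_eq_iff.1 h.symm).2
    suffices H : ∀ x ∈ wallStab p q i, OnTreeWall T i (T * x) by simpa using H _ hmem
    intro x hx
    induction hx using Subgroup.closure_induction_right with
    | one => rw [mul_one]; exact OnTreeWall.base
    | mul_right x y hx hy ih =>
      obtain ⟨j, hj, rfl⟩ := hy
      simpa [mul_assoc] using ih.step _ j 1 hj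
    | mul_inv_cancel x y hx hy ih =>
      obtain ⟨j, hj, rfl⟩ := hy
      have h1 : (gen p q j)⁻¹ = gen p q j ^ (q - 1) := by
        rw [inv_eq_iff_mul_eq_one, ← pow_succ', Nat.sub_add_cancel NeZero.one_le, gen_pow_q]
      rw [h1, ← mul_assoc]
      exact ih.step _ j _ hj

theorem reflTransGen_pathEnd {r : Chamber p q → Chamber p q → Prop} {g : Chamber p q}
    {w : List (ContractedLeg p q)}
    (h : ∀ h l, wallAt l.1 h ∈ pathWalls g w → r h (neighbor h l)) :
    Relation.ReflTransGen r g (pathEnd g w) := by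
  induction w generalizing g with
  | nil => exact Relation.ReflTransGen.refl
  | cons l w ih =>
    exact (ih fun h' l' hm => h h' l' (List.mem_cons_of_mem _ hm)).head
      (h g l List.mem_cons_self)

/-- A chamber is in the wedge of `(T, J)` when it is on the same side as `T` of each of its walls. -/
theorem mem_wedge_iff {T D : Chamber p q} {J : Set (ZMod p)} :
    D ∈ wedge T J ↔ ∀ i ∈ J, side D (wallAt i T) = side T (wallAt i T) := by
  constructor
  · intro hD i hi
    change Relation.ReflTransGen _ T D at hD
    induction hD with
    | refl => rfl
    | tail _ hstep ih =>
      obtain ⟨l, rfl, hl⟩ := hstep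
      rw [← ih]
      refine side_neighbor_of_ne fun hC => ?_
      obtain rfl := (wallAt_eq_iff.1 hC).1
      exact hl ⟨hi, onTreeWall_iff.2 hC.symm⟩
  · intro hside
    obtain ⟨w, rfl, -, -, hC⟩ := exists_geodesic_walls T D
    refine reflTransGen_pathEnd fun h l hm => ⟨l, rfl, ?_⟩
    rintro ⟨hJ, hon⟩
    rw [onTreeWall_iff.1 hon] at hm
    exact (hC _).1 hm (hside _ hJ)

end Geometry

/-! ### Regions through which operators can be pushed -/

section Region

variable {p q : ℕ} [NeZero p] [NeZero q]

open Classical in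
/-- The edges of `g` that lead back to the center `o`. -/
def descents (o g : Chamber p q) : Finset (ZMod p) := {i | IsDescent o g i}

theorem mem_descents {o g : Chamber p q} {i : ZMod p} : i ∈ descents o g ↔ IsDescent o g i := by
  simp [descents]

theorem natCast_ne_zero_of_lt {n : ℕ} (h0 : 0 < n) (h : n < p) : (n : ZMod p) ≠ 0 := fun hn =>
  absurd (Nat.le_of_dvd h0 ((ZMod.natCast_eq_zero_iff n p).1 hn)) (by omega)

/-- For `p ≥ 5`, two labels adjacent to a common one are not adjacent to each other. -/
theorem eq_of_near (hp : 5 ≤ p) {i j k : ZMod p} (hj : Near i j) (hk : Near i k) (hji : j ≠ i)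
    (hki : k ≠ i) (hjk : Near j k) : j = k := by
  have h1 : ((1 : ℕ) : ZMod p) ≠ 0 := natCast_ne_zero_of_lt (by omega) (by omega)
  have h2 : ((2 : ℕ) : ZMod p) ≠ 0 := natCast_ne_zero_of_lt (by omega) (by omega)
  have h3 : ((3 : ℕ) : ZMod p) ≠ 0 := natCast_ne_zero_of_lt (by omega) (by omega)
  push_cast at h1 h2 h3
  rcases hj with rfl | rfl | rfl
  · exact absurd rfl hji
  · rcases hk with rfl | rfl | rfl
    · exact absurd rfl hki
    · rfl
    · exfalso
      rcases hjk with h | h | h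
      · exact h2 (by linear_combination -h)
      · exact h3 (by linear_combination -h)
      · exact h1 (by linear_combination -h)
  · rcases hk with rfl | rfl | rfl
    · exact absurd rfl hki
    · exfalso
      rcases hjk with h | h | h
      · exact h2 (by linear_combination h)
      · exact h1 (by linear_combination h)
      · exact h3 (by linear_combination h)
    · rfl

theorem card_descents_le (hp : 5 ≤ p) (o g : Chamber p q) : (descents o g).card ≤ 2 := by
  by_contra! h
  obtain ⟨i, j, k, hi, hj, hk, hij, hik, hjk⟩ := Finset.two_lt_card_iff.1 h
  rw [mem_descents] at hi hj hk
  exact hjk (eq_of_near hp (near_of_isDescent hj hi) (near_of_isDescent hk hi) hij.symm hik.symm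
    (near_of_isDescent hk hj))

theorem exists_descent_not_near (hp : 5 ≤ p) {o g : Chamber p q} {i : ZMod p}
    (hi : ¬ IsDescent o g i) (h : 2 ≤ (descents o g).card) : ∃ j, IsDescent o g j ∧ ¬ Near i j := by
  by_contra! hall
  obtain ⟨j, hj, k, hk, hjk⟩ := Finset.one_lt_card.1 h
  rw [mem_descents] at hj hk
  exact hjk (eq_of_near hp (hall j hj) (hall k hk) (fun h => hi (h ▸ hj)) (fun h => hi (h ▸ hk))
    (near_of_isDescent hk hj))

/-- A region of the network such that the tiles of the region have at most one leg leading away from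
the center `o` and out of the region; a tile with such a leg and two edges towards the center has a
neighbor in its own layer, and in the region, without such a leg. -/
structure IsRegion (o : Chamber p q) (R : Set (Chamber p q)) : Prop where
  unique : ∀ g ∈ R, ∀ l l' : ContractedLeg p q, ¬ IsDescent o g l.1 → ¬ IsDescent o g l'.1 →
    neighbor g l ∉ R → neighbor g l' ∉ R → l = l'
  exists_neighbor : ∀ g ∈ R, ∀ l : ContractedLeg p q, ¬ IsDescent o g l.1 → neighbor g l ∉ R →
    2 ≤ (descents o g).card → ∃ l' : ContractedLeg p q, IsDescent o g l'.1 ∧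
      (networkGraph p q).dist o (neighbor g l') = (networkGraph p q).dist o g ∧
      neighbor g l' ∈ R ∧ ∀ m : ContractedLeg p q, ¬ IsDescent o (neighbor g l') m.1 →
        neighbor (neighbor g l') m ∈ R

theorem isRegion_univ (o : Chamber p q) : IsRegion o Set.univ where
  unique _ _ _ _ _ _ h := absurd (Set.mem_univ _) h
  exists_neighbor _ _ _ _ h := absurd (Set.mem_univ _) h

variable {o T : Chamber p q} {J : Set (ZMod p)}

theorem side_ne_of_center_notMem (h : ∀ i ∈ J, o ∉ wedge T {i}) {i : ZMod p} (hi : i ∈ J) :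
    side T (wallAt i T) ≠ side o (wallAt i T) := fun hside =>
  h i hi (mem_wedge_iff.2 fun j hj => by rw [Set.mem_singleton_iff.1 hj, hside])

/-- Away from the center, one does not leave a wedge. -/
theorem isRegion_wedge (h : ∀ i ∈ J, o ∉ wedge T {i}) : IsRegion o (wedge T J) := by
  have key : ∀ g ∈ wedge T J, ∀ l : ContractedLeg p q, ¬ IsDescent o g l.1 →
      neighbor g l ∈ wedge T J := by
    intro g hg l hl
    refine mem_wedge_iff.2 fun i hi => ?_
    have hgi := mem_wedge_iff.1 hg i hi
    rw [← hgi]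
    refine side_neighbor_of_ne fun hC => ?_
    have h0 : side g (wallAt l.1 g) = side o (wallAt l.1 g) := not_not.1 hl
    rw [← hC, hgi] at h0
    exact side_ne_of_center_notMem h hi h0
  exact ⟨fun g hg l _ hl _ h' _ => absurd (key g hg l hl) h',
    fun g hg l hl h' _ => absurd (key g hg l hl) h'⟩

/-- A tile outside a wedge is separated from it by one of its walls; the legs into the wedge all cross
this wall, to the side of the wedge. -/
theorem exists_wall_of_notMem_wedge {g : Chamber p q} (hg : g ∉ wedge T J) :
    ∃ i ∈ J, side g (wallAt i T) ≠ side T (wallAt i T) ∧ ∀ l : ContractedLeg p q,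
      neighbor g l ∈ wedge T J → wallAt i T = wallAt l.1 g ∧
        (l.2 : ZMod q) = side T (wallAt i T) - side g (wallAt i T) := by
  have : ¬ ∀ i ∈ J, side g (wallAt i T) = side T (wallAt i T) := fun h => hg (mem_wedge_iff.2 h)
  push Not at this
  obtain ⟨i, hi, hne⟩ := this
  refine ⟨i, hi, hne, fun l hl => ?_⟩
  have hside := mem_wedge_iff.1 hl i hi
  have hw : wallAt i T = wallAt l.1 g := by
    by_contra hw
    rw [side_neighbor_of_ne hw] at hside
    exact hne hside
  refine ⟨hw, ?_⟩
  rw [hw, side_neighbor_self] at hside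
  rw [hw, ← hside]
  ring

/-- The only way from a tile to the wedge crosses the wall, at a given edge and to a given side. If
two edges lead back to the center, one of them does not commute with this edge; crossing it within
the layer leads away from the wall. -/
theorem isRegion_compl_wedge (hp : 5 ≤ p) (hq : 3 ≤ q) :
    IsRegion o (wedge T J)ᶜ where
  unique g hg l l' _ _ h h' := by
    obtain ⟨i, -, -, hi⟩ := exists_wall_of_notMem_wedge hg
    obtain ⟨h1, h2⟩ := hi l (not_not.1 h)
    obtain ⟨h1', h2'⟩ := hi l' (not_not.1 h')
    refine Prod.ext ?_ (Subtype.ext (h2.trans h2'.symm))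
    rw [← (wallAt_eq_iff.1 h1).1, ← (wallAt_eq_iff.1 h1').1]
  exists_neighbor g hg l hl h hcard := by
    obtain ⟨i, hiJ, hne, hi⟩ := exists_wall_of_notMem_wedge hg
    obtain ⟨hw, -⟩ := hi l (not_not.1 h)
    obtain ⟨j, hj, hnear⟩ := exists_descent_not_near hp hl hcard
    have hil := (wallAt_eq_iff.1 hw).1
    -- one of the `q - 1 ≥ 2` legs at the edge `j` does not lead to the side of the center
    obtain ⟨k, hk⟩ : ∃ k : ZMod q, k ∉ ({0, side o (wallAt j g) - side g (wallAt j g)} :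
        Finset (ZMod q)) := by
      by_contra! hall
      have h1 := Finset.card_le_card (fun k _ => hall k : (Finset.univ : Finset (ZMod q)) ⊆ _)
      have h2 := h1.trans Finset.card_le_two
      rw [Finset.card_univ, ZMod.card] at h2
      omega
    simp only [Finset.mem_insert, Finset.mem_singleton, not_or] at hk
    have hside : side (neighbor g (j, ⟨k, hk.1⟩)) (wallAt i T) = side g (wallAt i T) :=
      side_neighbor_of_ne fun hC => hnear (by
        rw [← hil, (wallAt_eq_iff.1 hC).1]
        exact Or.inl rfl)
    have hnot : ∀ m : ContractedLeg p q, neighbor (neighbor g (j, ⟨k, hk.1⟩)) m ∉ wedge T J := by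
      intro m hm
      have hsm := mem_wedge_iff.1 hm i hiJ
      by_cases hC : wallAt i T = wallAt m.1 (neighbor g (j, ⟨k, hk.1⟩))
      · have him := (wallAt_eq_iff.1 hC).1
        rw [hw, ← him, ← hil] at hC
        have := (wallAt_eq_iff.1 hC).2
        rw [neighbor, inv_mul_cancel_left] at this
        exact gen_notMem_wallStab (l := (j, ⟨k, hk.1⟩)) (by rwa [hil]) this
      · rw [side_neighbor_of_ne hC, hside] at hsm
        exact hne hsm
    refine ⟨(j, ⟨k, hk.1⟩), hj, dist_neighbor_of_side_ne hj fun h0 => hk.2 ?_, fun hm => ?_,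
      fun m _ => hnot m⟩
    · have h1 := side_neighbor_self g ((j, ⟨k, hk.1⟩) : ContractedLeg p q)
      simp only at h0 h1
      rw [← h0, h1]
      ring
    · have hsm := mem_wedge_iff.1 hm i hiJ
      rw [hside] at hsm
      exact hne hsm

end Region

/-! ### Layers of the network -/

section Layer

variable {p q : ℕ} [NeZero p] [NeZero q]

/-- `S` is the layer of the tiles at distance `n` from `o`. For a region `R`, the links of `Bin R` lead
from the preceding layer to the tiles of `S` in `R`, and those of `Bout R` lead from `S` to the tiles of
the following layer in `R`. -/
structure IsLayer (o : Chamber p q) (n : ℕ) (S : Finset (Chamber p q))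
    (Bin Bout : Set (Chamber p q) → Finset (Sym2 (Chamber p q))) : Prop where
  mem_iff : ∀ g, g ∈ S ↔ (networkGraph p q).dist o g = n
  mem_in : ∀ R x, x ∈ Bin R ↔ ∃ g ∈ S, ∃ l : ContractedLeg p q, x = link g l ∧
    (networkGraph p q).dist o (neighbor g l) < n ∧ g ∈ R
  mem_out : ∀ R x, x ∈ Bout R ↔ ∃ g ∈ S, ∃ l : ContractedLeg p q, x = link g l ∧
    n < (networkGraph p q).dist o (neighbor g l) ∧ neighbor g l ∈ R

theorem link_eq_link_iff {g h : Chamber p q} {l m : ContractedLeg p q} :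
    link g l = link h m ↔ (g = h ∧ l = m) ∨ (h = neighbor g l ∧ g = neighbor h m) := by
  unfold link
  rw [Sym2.eq_iff]
  constructor
  · rintro (⟨rfl, h⟩ | ⟨h, h'⟩)
    · exact Or.inl ⟨rfl, neighbor_injective g h⟩
    · exact Or.inr ⟨h'.symm, h⟩
  · rintro (⟨rfl, rfl⟩ | ⟨h, h'⟩)
    · exact Or.inl ⟨rfl, rfl⟩
    · exact Or.inr ⟨h', h.symm⟩

theorem mem_linksAt {S : Finset (Chamber p q)} {x : Sym2 (Chamber p q)} :
    x ∈ Network.linksAt S ↔ ∃ g ∈ S, ∃ l : ContractedLeg p q, link g l = x := by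
  simp [Network.linksAt]

variable {o : Chamber p q} {n : ℕ} {S : Finset (Chamber p q)}
  {Bin Bout : Set (Chamber p q) → Finset (Sym2 (Chamber p q))} {R : Set (Chamber p q)}

section

variable (hL : IsLayer o n S Bin Bout)
include hL

theorem IsLayer.link_mem_in {g : Chamber p q} (hg : g ∈ S) {l : ContractedLeg p q} :
    link g l ∈ Bin R ↔ (networkGraph p q).dist o (neighbor g l) < n ∧ g ∈ R := by
  rw [hL.mem_in]
  constructor
  · rintro ⟨h, hh, m, hx, hd, hR⟩
    rcases link_eq_link_iff.1 hx with ⟨rfl, rfl⟩ | ⟨-, h2⟩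
    · exact ⟨hd, hR⟩
    · rw [← h2, (hL.mem_iff g).1 hg] at hd
      exact absurd hd (lt_irrefl _)
  · exact fun h => ⟨g, hg, l, rfl, h⟩

theorem IsLayer.link_mem_out {g : Chamber p q} (hg : g ∈ S) {l : ContractedLeg p q} :
    link g l ∈ Bout R ↔ n < (networkGraph p q).dist o (neighbor g l) ∧ neighbor g l ∈ R := by
  rw [hL.mem_out]
  constructor
  · rintro ⟨h, hh, m, hx, hd, hR⟩
    rcases link_eq_link_iff.1 hx with ⟨rfl, rfl⟩ | ⟨-, h2⟩
    · exact ⟨hd, hR⟩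
    · rw [← h2, (hL.mem_iff g).1 hg] at hd
      exact absurd hd (lt_irrefl _)
  · exact fun h => ⟨g, hg, l, rfl, h⟩

theorem IsLayer.out_subset (R R' : Set (Chamber p q)) (h : R ⊆ R') : Bout R ⊆ Bout R' := by
  intro x hx
  rw [hL.mem_out] at hx ⊢
  obtain ⟨g, hg, l, h1, h2, h3⟩ := hx
  exact ⟨g, hg, l, h1, h2, h h3⟩

theorem IsLayer.out_subset_linksAt (R : Set (Chamber p q)) : Bout R ⊆ Network.linksAt S := by
  intro x hx
  obtain ⟨g, hg, l, rfl, -⟩ := (hL.mem_out _ _).1 hx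
  exact mem_linksAt.2 ⟨g, hg, l, rfl⟩

theorem IsLayer.in_subset_linksAt (R : Set (Chamber p q)) : Bin R ⊆ Network.linksAt S := by
  intro x hx
  obtain ⟨g, hg, l, rfl, -⟩ := (hL.mem_in _ _).1 hx
  exact mem_linksAt.2 ⟨g, hg, l, rfl⟩

theorem IsLayer.disjoint_in_out (R R' : Set (Chamber p q)) : Disjoint (Bin R) (Bout R') := by
  refine Finset.disjoint_left.2 fun x hx hx' => ?_
  obtain ⟨g, hg, l, rfl, hd, -⟩ := (hL.mem_in _ _).1 hx
  have := ((hL.link_mem_out hg).1 hx').1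
  omega

/-- A link to another layer has a single end in `S`. -/
theorem IsLayer.eq_of_link_eq {g h : Chamber p q} (hg : g ∈ S) (hh : h ∈ S)
    {l m : ContractedLeg p q} (hlm : link g l = link h m)
    (hx : link g l ∈ Bin Set.univ ∪ Bout Set.univ) : g = h := by
  rcases link_eq_link_iff.1 hlm with ⟨h1, -⟩ | ⟨h1, -⟩
  · exact h1
  · rw [h1, hL.mem_iff] at hh
    rcases Finset.mem_union.1 hx with hx | hx
    · have := ((hL.link_mem_in hg).1 hx).1
      omega
    · have := ((hL.link_mem_out hg).1 hx).1
      omega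

/-- Every link within the layer is met twice, and every link to another layer once. -/
theorem IsLayer.card_mul_eq : S.card * (p * (q - 1)) =
    (Network.linksAt S \ Bin Set.univ).card + (Network.linksAt S \ Bout Set.univ).card := by
  classical
  have hcl : Fintype.card (ContractedLeg p q) = p * (q - 1) := by
    rw [Fintype.card_prod, ZMod.card, Fintype.card_subtype_compl, Fintype.card_subtype_eq, ZMod.card]
  have h1 : S.card * (p * (q - 1)) =
      (S ×ˢ (Finset.univ : Finset (ContractedLeg p q))).card := by
    rw [Finset.card_product, Finset.card_univ, hcl]
  rw [h1, Finset.card_eq_sum_card_image (fun x : Chamber p q × ContractedLeg p q => link x.1 x.2)]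
  have h2 : ∀ A : Finset (Sym2 (Chamber p q)), (Network.linksAt S \ A).card =
      ∑ x ∈ Network.linksAt S, if x ∈ A then 0 else 1 := by
    intro A
    rw [Finset.sdiff_eq_filter, Finset.card_filter]
    exact Finset.sum_congr rfl fun x _ => by by_cases hx : x ∈ A <;> simp [hx]
  rw [h2, h2, ← Finset.sum_add_distrib]
  refine Finset.sum_congr rfl fun x hx => ?_
  obtain ⟨g, hg, l, rfl⟩ := mem_linksAt.1 hx
  by_cases hB : link g l ∈ Bin Set.univ ∪ Bout Set.univ
  · have hf : (S ×ˢ (Finset.univ : Finset (ContractedLeg p q))).filter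
        (fun y => link y.1 y.2 = link g l) = {(g, l)} := by
      ext ⟨h, m⟩
      simp only [Finset.mem_filter, Finset.mem_product, Finset.mem_univ, and_true,
        Finset.mem_singleton, Prod.mk.injEq]
      constructor
      · rintro ⟨hh, hlm⟩
        obtain rfl := hL.eq_of_link_eq hg hh hlm.symm hB
        exact ⟨rfl, neighbor_injective g (by
          rcases link_eq_link_iff.1 hlm with ⟨-, h⟩ | ⟨h, -⟩
          · rw [h]
          · exact absurd h.symm (neighbor_ne _ _))⟩
      · rintro ⟨rfl, rfl⟩
        exact ⟨hg, rfl⟩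
    rw [hf, Finset.card_singleton]
    rcases Finset.mem_union.1 hB with hB | hB
    · rw [if_pos hB, if_neg (Finset.disjoint_left.1 (hL.disjoint_in_out _ _) hB)]
    · rw [if_pos hB, if_neg (Finset.disjoint_right.1 (hL.disjoint_in_out _ _) hB)]
  · simp only [Finset.mem_union, not_or] at hB
    rw [if_neg hB.1, if_neg hB.2]
    rw [hL.link_mem_in hg, hL.link_mem_out hg] at hB
    simp only [Set.mem_univ, and_true, not_lt] at hB
    have hn : neighbor g l ∈ S := (hL.mem_iff _).2 (le_antisymm hB.2 hB.1)
    obtain ⟨m, -, hm⟩ := exists_neighbor_symm g l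
    have hf : (S ×ˢ (Finset.univ : Finset (ContractedLeg p q))).filter
        (fun y => link y.1 y.2 = link g l) = {(g, l), (neighbor g l, m)} := by
      ext ⟨h, m'⟩
      simp only [Finset.mem_filter, Finset.mem_product, Finset.mem_univ, and_true,
        Finset.mem_insert, Finset.mem_singleton, Prod.mk.injEq]
      constructor
      · rintro ⟨hh, hlm⟩
        rcases link_eq_link_iff.1 hlm.symm with ⟨rfl, rfl⟩ | ⟨rfl, h2⟩
        · exact Or.inl ⟨rfl, rfl⟩
        · exact Or.inr ⟨rfl, neighbor_injective _ (by rw [hm, ← h2])⟩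
      · rintro (⟨rfl, rfl⟩ | ⟨rfl, rfl⟩)
        · exact ⟨hg, rfl⟩
        · exact ⟨hn, link_eq_link_iff.2 (Or.inr ⟨hm.symm, rfl⟩)⟩
    rw [hf, Finset.card_pair (fun h => neighbor_ne g l (congrArg Prod.fst h).symm)]

end

/-! ### The wiring of a layer -/

/-- The sites of the tiles of `S`: the links at `S` and the bulk legs of `S`. -/
abbrev Site (S : Finset (Chamber p q)) : Type :=
  Network.linksAt S ⊕ (S ×ˢ (Finset.univ : Finset (Fin (q - 1))) : Finset _)

/-- The site of a leg of a tile of `S`. -/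
def wire (S : Finset (Chamber p q)) (g : S) : Leg p q → Site S :=
  Sum.elim
    (fun l => Sum.inl ⟨link g l, Finset.mem_image.2
      ⟨(g, l), Finset.mem_product.2 ⟨g.2, Finset.mem_univ _⟩, rfl⟩⟩)
    (fun m => Sum.inr ⟨(g, m), Finset.mem_product.2 ⟨g.2, Finset.mem_univ _⟩⟩)

open Classical in
/-- The sites given by a set of links and a set of bulk legs. -/
def siteSet (S : Finset (Chamber p q)) (A : Finset (Sym2 (Chamber p q)))
    (b : Finset (Chamber p q × Fin (q - 1))) : Finset (Site S) :=
  {s | Sum.elim (fun x => x.1 ∈ A) (fun y => y.1 ∈ b) s}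

theorem inl_mem_siteSet {A : Finset (Sym2 (Chamber p q))} {b : Finset (Chamber p q × Fin (q - 1))}
    {x : Network.linksAt S} : Sum.inl x ∈ siteSet S A b ↔ x.1 ∈ A := by simp [siteSet]

theorem inr_mem_siteSet {A : Finset (Sym2 (Chamber p q))} {b : Finset (Chamber p q × Fin (q - 1))}
    {y : (S ×ˢ (Finset.univ : Finset (Fin (q - 1))) : Finset _)} :
    Sum.inr y ∈ siteSet S A b ↔ y.1 ∈ b := by simp [siteSet]

/-- The sites whose labels are prescribed when the legs leading out of the layer into `R` are
contracted. -/
def fixedSites (S : Finset (Chamber p q)) (Bin Bout : Set (Chamber p q) → Finset (Sym2 (Chamber p q)))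
    (R : Set (Chamber p q)) : Finset (Site S) :=
  siteSet S (Bin Set.univ ∪ (Bout Set.univ \ Bout R)) (S ×ˢ Finset.univ)

theorem wire_cover (s : Site S) : ∃ g l, wire S g l = s := by
  rcases s with ⟨x, hx⟩ | ⟨⟨g, m⟩, hy⟩
  · obtain ⟨g, hg, l, rfl⟩ := mem_linksAt.1 hx
    exact ⟨⟨g, hg⟩, Sum.inl l, rfl⟩
  · exact ⟨⟨g, (Finset.mem_product.1 hy).1⟩, Sum.inr m, rfl⟩

theorem link_eq_of_wire_eq {u v : S} {l : ContractedLeg p q} {l' : Leg p q}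
    (h : wire S u (Sum.inl l) = wire S v l') : ∃ m, l' = Sum.inl m ∧ link u.1 l = link v.1 m := by
  rcases l' with m | m
  · exact ⟨m, rfl, congrArg Subtype.val (Sum.inl.inj h)⟩
  · exact absurd h (by simp [wire])

theorem eq_of_wire_inr_eq {u v : S} {m : Fin (q - 1)} {l' : Leg p q}
    (h : wire S u (Sum.inr m) = wire S v l') : u = v ∧ l' = Sum.inr m := by
  rcases l' with m' | m'
  · exact absurd h (by simp [wire])
  · have := congrArg Subtype.val (Sum.inr.inj h)
    simp only [Prod.mk.injEq] at this
    exact ⟨Subtype.ext this.1, by rw [this.2]⟩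

theorem IsLayer.wiring (hL : IsLayer o n S Bin Bout) (R : Set (Chamber p q)) :
    Wiring (wire S) (fixedSites S Bin Bout R) (siteSet S (Bout R) ∅) where
  injective g l l' h := by
    rcases l with l | m
    · obtain ⟨m, rfl, hm⟩ := link_eq_of_wire_eq h
      rcases link_eq_link_iff.1 hm with ⟨-, rfl⟩ | ⟨h, -⟩
      · rfl
      · exact absurd h.symm (neighbor_ne _ _)
    · exact (eq_of_wire_inr_eq h).2.symm
  disjoint := by
    refine Finset.disjoint_left.2 fun s hs hs' => ?_
    rcases s with x | y
    · rw [fixedSites, inl_mem_siteSet] at hs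
      rw [inl_mem_siteSet] at hs'
      rcases Finset.mem_union.1 hs with hs | hs
      · exact Finset.disjoint_left.1 (hL.disjoint_in_out _ _) hs hs'
      · exact (Finset.mem_sdiff.1 hs).2 hs'
    · rw [inr_mem_siteSet] at hs'
      exact absurd hs' (Finset.notMem_empty _)
  isOpen u v l l' hs h := by
    rcases l with l | m
    · obtain ⟨m, rfl, hm⟩ := link_eq_of_wire_eq h
      refine Subtype.ext (hL.eq_of_link_eq u.2 v.2 hm ?_)
      rcases Finset.mem_union.1 hs with hs | hs
      · have := inl_mem_siteSet.1 hs
        rcases Finset.mem_union.1 this with h1 | h1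
        · exact Finset.mem_union_left _ h1
        · exact Finset.mem_union_right _ (Finset.mem_sdiff.1 h1).1
      · exact Finset.mem_union_right _
          (hL.out_subset _ _ (Set.subset_univ _) (inl_mem_siteSet.1 hs))
    · exact (eq_of_wire_inr_eq h).1
  two u v w l l' l'' h h' := by
    rcases l with l | m
    · obtain ⟨m, rfl, hm⟩ := link_eq_of_wire_eq h
      obtain ⟨m', rfl, hm'⟩ := link_eq_of_wire_eq h'
      rcases link_eq_link_iff.1 hm with ⟨h1, -⟩ | ⟨h1, -⟩
      · exact Or.inl (Subtype.ext h1)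
      · rcases link_eq_link_iff.1 hm' with ⟨h2, -⟩ | ⟨h2, -⟩
        · exact Or.inr (Or.inl (Subtype.ext h2))
        · exact Or.inr (Or.inr (Subtype.ext (h1.trans h2.symm)))
    · exact Or.inl (eq_of_wire_inr_eq h).1

open Classical in
/-- The tiles of `S` in the region `R`. -/
def tilesIn (S : Finset (Chamber p q)) (R : Set (Chamber p q)) : Finset S := {g | g.1 ∈ R}

theorem mem_tilesIn {g : S} : g ∈ tilesIn S R ↔ g.1 ∈ R := by simp [tilesIn]

theorem card_contractedLeg_filter (D : Finset (ZMod p)) :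
    ((Finset.univ : Finset (ContractedLeg p q)).filter fun l => l.1 ∈ D).card =
      D.card * (q - 1) := by
  have : (Finset.univ : Finset (ContractedLeg p q)).filter (fun l => l.1 ∈ D) =
      D ×ˢ Finset.univ := by
    ext ⟨i, k⟩; simp
  rw [this, Finset.card_product, Finset.card_univ, Fintype.card_subtype_compl,
    Fintype.card_subtype_eq, ZMod.card]

/-- The tiles of a region in a layer can be removed one after the other, those with a leg leading
away from the center and out of the region last. A tile has at most `2 (q - 1)` legs at its edges
towards the center, and `q - 1` bulk legs; a leg out of the region is compensated by a leg to a tile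
removed before. As `p ≥ 5`, at most `3 (q - 1) ≤ (p + 1) (q - 1) / 2` legs are left. -/
theorem IsLayer.peelable (hL : IsLayer o n S Bin Bout) (hp : 5 ≤ p) (hq : 3 ≤ q)
    (hR : IsRegion o R) : Peelable (wire S) (siteSet S (Bout R) ∅) (tilesIn S R) := by
  classical
  have hLeg : Fintype.card (Leg p q) = (p + 1) * (q - 1) := by
    rw [Fintype.card_sum, Fintype.card_prod, ZMod.card, Fintype.card_subtype_compl,
      Fintype.card_subtype_eq, ZMod.card, Fintype.card_fin]
    ring
  intro Q hQ
  let good : S → Prop := fun g => ∀ l : ContractedLeg p q, ¬ IsDescent o g.1 l.1 →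
    neighbor g.1 l ∈ R
  let left : S → Finset (Leg p q) := fun g =>
    Finset.univ.filter fun l => wire S g l ∉ siteSet S (Bout R) ∅ ∪ sitesOf (wire S) Q
  -- it suffices to bound the number of contracted legs that are left
  have hbound : ∀ (g : S) (A : Finset (ContractedLeg p q)), A.card ≤ 2 * (q - 1) →
      (∀ l, Sum.inl l ∈ left g → l ∈ A) → 2 * (left g).card ≤ Fintype.card (Leg p q) := by
    intro g A hA hl
    have hsub : left g ⊆ A.disjSum (Finset.univ : Finset (Fin (q - 1))) := by
      rintro (l | m) h
      · simpa using hl l h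
      · simp
    have h1 := Finset.card_le_card hsub
    rw [Finset.card_disjSum, Finset.card_univ, Fintype.card_fin] at h1
    rw [hLeg]
    have h3 : 6 * (q - 1) ≤ (p + 1) * (q - 1) := Nat.mul_le_mul_right _ (by omega)
    omega
  have hout : ∀ (g : S) (l : ContractedLeg p q), Sum.inl l ∈ left g → ¬ IsDescent o g.1 l.1 →
      neighbor g.1 l ∉ R := by
    intro g l hl hd hR'
    refine (Finset.mem_filter.1 hl).2 (Finset.mem_union_left _ (inl_mem_siteSet.2 ?_))
    refine (hL.link_mem_out g.2).2 ⟨?_, hR'⟩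
    rw [dist_neighbor_of_not_isDescent hd, (hL.mem_iff _).1 g.2]
    exact Nat.lt_succ_self n
  have hdesc : ∀ g : S, ((Finset.univ : Finset (ContractedLeg p q)).filter
      fun l => l.1 ∈ descents o g.1).card ≤ 2 * (q - 1) := fun g => by
    rw [card_contractedLeg_filter]
    exact Nat.mul_le_mul_right _ (card_descents_le hp o g.1)
  -- without a leg out of the region, at most two edges are left
  by_cases hgood : ∃ g ∈ tilesIn S R \ Q, good g
  · obtain ⟨g, hg, hgg⟩ := hgood
    refine ⟨g, hg, hbound g _ (hdesc g) fun l hl => ?_⟩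
    simp only [Finset.mem_filter, Finset.mem_univ, true_and, mem_descents]
    by_contra hd
    exact hout g l hl hd (hgg l hd)
  · obtain ⟨g, hgR, hgQ⟩ := Finset.exists_of_ssubset hQ
    have hg : g ∈ tilesIn S R \ Q := Finset.mem_sdiff.2 ⟨hgR, hgQ⟩
    have hbad : ¬ good g := fun h => hgood ⟨g, hg, h⟩
    simp only [good] at hbad
    push Not at hbad
    obtain ⟨l₀, hl₀, hl₀R⟩ := hbad
    have hgR' := mem_tilesIn.1 hgR
    by_cases hcard : 2 ≤ (descents o g.1).card
    -- the leg to the neighbor removed before makes up for the leg out of the region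
    · obtain ⟨m, hm, hmd, hmR, hmgood⟩ := hR.exists_neighbor g.1 hgR' l₀ hl₀ hl₀R hcard
      have hmS : neighbor g.1 m ∈ S := (hL.mem_iff _).2 (hmd.trans ((hL.mem_iff _).1 g.2))
      have hmQ : (⟨neighbor g.1 m, hmS⟩ : S) ∈ Q := by
        by_contra h
        exact hgood ⟨_, Finset.mem_sdiff.2 ⟨mem_tilesIn.2 hmR, h⟩, hmgood⟩
      refine ⟨g, hg, hbound g (insert l₀ (((Finset.univ : Finset (ContractedLeg p q)).filter
        fun l => l.1 ∈ descents o g.1).erase m)) ?_ fun l hl => ?_⟩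
      · refine (Finset.card_insert_le _ _).trans ?_
        rw [Finset.card_erase_add_one (by simpa [mem_descents] using hm)]
        exact hdesc g
      · rw [Finset.mem_insert]
        by_cases hd : IsDescent o g.1 l.1
        · refine Or.inr (Finset.mem_erase.2 ⟨?_, by simpa [mem_descents] using hd⟩)
          rintro rfl
          refine (Finset.mem_filter.1 hl).2 (Finset.mem_union_right _ ?_)
          obtain ⟨m', -, hm'⟩ := exists_neighbor_symm g.1 l
          refine mem_sitesOf.2 ⟨_, hmQ, Sum.inl m', ?_⟩
          exact congrArg Sum.inl (Subtype.ext (link_eq_link_iff.2 (Or.inr ⟨hm'.symm, rfl⟩)))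
        · exact Or.inl (hR.unique g.1 hgR' l l₀ hd hl₀ (hout g l hl hd) hl₀R)
    -- at most one edge leads towards the center, and `(q - 1) + 1 ≤ 2 (q - 1)`
    · refine ⟨g, hg, hbound g (insert l₀ ((Finset.univ : Finset (ContractedLeg p q)).filter
        fun l => l.1 ∈ descents o g.1)) ?_ fun l hl => ?_⟩
      · refine (Finset.card_insert_le _ _).trans ?_
        rw [card_contractedLeg_filter]
        have h1 : (descents o g.1).card * (q - 1) ≤ 1 * (q - 1) :=
          Nat.mul_le_mul_right _ (by omega)
        omega
      · rw [Finset.mem_insert]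
        by_cases hd : IsDescent o g.1 l.1
        · exact Or.inr (by simpa [mem_descents] using hd)
        · exact Or.inl (hR.unique g.1 hgR' l l₀ hd hl₀ (hout g l hl hd) hl₀R)

end Layer

/-! ### The contraction of a layer -/

section Amplify

variable {X Z X' Z' Y Y' : Type} [Fintype X] [DecidableEq X] [Fintype Z] [DecidableEq Z]
  [Fintype X'] [DecidableEq X'] [Fintype Z'] [DecidableEq Z'] [Fintype Y] [Fintype Y']

/-- `B ⊗ 1`, along an identification of `Y` with `X × Z`. -/
def ampl (e : Y ≃ X × Z) (B : Matrix X X ℂ) : Matrix Y Y ℂ :=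
  (B ⊗ₖ (1 : Matrix Z Z ℂ)).submatrix e e

theorem ampl_apply (e : Y ≃ X × Z) (B : Matrix X X ℂ) (y y' : Y) :
    ampl e B y y' = if (e y).2 = (e y').2 then B (e y).1 (e y').1 else 0 := by
  simp [ampl, Matrix.one_apply]

theorem ampl_mul_apply (e : Y ≃ X × Z) (B : Matrix X X ℂ) {W : Type} (C : Matrix Y W ℂ) (y : Y)
    (w : W) : (ampl e B * C) y w = ∑ x, B (e y).1 x * C (e.symm (x, (e y).2)) w := by
  rw [Matrix.mul_apply, ← e.symm.sum_comp, Fintype.sum_prod_type]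
  refine Finset.sum_congr rfl fun x _ => ?_
  rw [Finset.sum_eq_single (e y).2]
  · simp [ampl_apply]
  · intro z _ hz
    simp [ampl_apply, hz.symm]
  · simp

theorem mul_ampl_apply (e : Y ≃ X × Z) (B : Matrix X X ℂ) {W : Type} (C : Matrix W Y ℂ) (y : Y)
    (w : W) : (C * ampl e B) w y = ∑ x, C w (e.symm (x, (e y).2)) * B x (e y).1 := by
  rw [Matrix.mul_apply, ← e.symm.sum_comp, Fintype.sum_prod_type]
  refine Finset.sum_congr rfl fun x _ => ?_
  rw [Finset.sum_eq_single (e y).2]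
  · simp [ampl_apply]
  · intro z _ hz
    simp [ampl_apply, hz]
  · simp

/-- If the matrix `C`, from `X ⊗ Z` to `X' ⊗ Z'`, has Gram matrices over `X'` proportional to the
identity of `X`, operators on `X` can be pushed through `C` to operators on `X'`. -/
theorem exists_ampl_mul_eq (hdvd : Fintype.card X ≤ Fintype.card X' →
    Fintype.card X ∣ Fintype.card X') [Nonempty X] (e : Y ≃ X × Z) (e' : Y' ≃ X' × Z')
    (C : Matrix Y' Y ℂ) (hC0 : C ≠ 0)
    (hC : ∀ z₁ z₂ c₁ c₂, ∃ g : ℂ, ∀ x₁ x₂, ∑ x', conj (C (e'.symm (x', c₁)) (e.symm (x₁, z₁))) *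
      C (e'.symm (x', c₂)) (e.symm (x₂, z₂)) = if x₁ = x₂ then g else 0) :
    ∃ P : Matrix X X ℂ →⋆ₐ[ℂ] Matrix X' X' ℂ, ∀ B, ampl e' (P B) * C = C * ampl e B := by
  choose g hg using hC
  let F : Z × Z' → Matrix X' X ℂ := fun z => Matrix.of fun x' x =>
    C (e'.symm (x', z.2)) (e.symm (x, z.1))
  obtain ⟨P, hP⟩ := exists_starAlgHom_mul_eq hdvd F (fun z w => g z.1 w.1 z.2 w.2) (fun z w => by
    ext x₁ x₂
    simp only [Matrix.mul_apply, Matrix.conjTranspose_apply, F, Matrix.of_apply, Matrix.smul_apply,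
      Matrix.one_apply, smul_eq_mul, mul_ite, mul_one, mul_zero]
    exact hg _ _ _ _ _ _) (by
    by_contra! h
    refine hC0 (Matrix.ext fun y' y => ?_)
    have := congrFun (congrFun (h ((e y).2, (e' y').2)) (e' y').1) (e y).1
    simpa [F] using this)
  refine ⟨P, fun B => Matrix.ext fun y' y => ?_⟩
  rw [ampl_mul_apply, mul_ampl_apply]
  have := congrFun (congrFun (hP B ((e y).2, (e' y').2)) (e' y').1) (e y).1
  simpa [F, Matrix.mul_apply] using this

end Amplify

theorem card_labels_dvd {d a b : ℕ} (hd : d ≠ 0) (h : d ^ a ≤ d ^ b) : d ^ a ∣ d ^ b := by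
  rcases Nat.lt_or_ge 1 d with h1 | h1
  · exact pow_dvd_pow d ((Nat.pow_le_pow_iff_right h1).1 h)
  · obtain rfl : d = 1 := by omega
    simp

/-- A sum of products of two sums restricted to the same fibre of `r` is a sum over pairs on which `r`
coincides. -/
theorem sum_conj_mul_fiberwise {ζ ρ : Type} [Fintype ζ] [Fintype ρ] [DecidableEq ρ] (w : ℝ)
    (r : ζ → ρ) (f₁ f₂ A : ζ → ℂ) :
    ∑ x, conj ((w : ℂ) * ∑ z, (f₁ z * if r z = x then 1 else 0) * A z) *
      ((w : ℂ) * ∑ z, (f₂ z * if r z = x then 1 else 0) * A z) =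
    (w : ℂ) ^ 2 * ∑ z, ∑ z', (if r z = r z' then 1 else 0) *
      (conj (f₁ z) * f₂ z' * (conj (A z) * A z')) := by
  simp only [map_mul, map_sum, Complex.conj_ofReal, mul_mul_mul_comm (w : ℂ) _ (w : ℂ), ← sq,
    Finset.sum_mul_sum, ← Finset.mul_sum]
  congr 1
  rw [Finset.sum_comm]
  refine Finset.sum_congr rfl fun z _ => ?_
  simp only [Finset.mul_sum]
  rw [Finset.sum_comm]
  refine Finset.sum_congr rfl fun z' _ => ?_
  rw [Finset.sum_eq_single (r z)]
  · by_cases h : r z = r z'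
    · simp [h]; ring
    · simp [h, Ne.symm h]
  · intro x _ hx
    simp [hx.symm]
  · simp

section Contraction

variable {p q d : ℕ} [NeZero p] [NeZero q] (N : Network p q d)

/-- The bulk sites of the tiles of `S`. -/
abbrev bulkOf (S : Finset (Chamber p q)) : Finset (Chamber p q × Fin (q - 1)) := S ×ˢ Finset.univ

open Classical in
/-- The normalized contraction of the tiles of `S`, as a matrix from the ingoing links `I` and the bulk
legs of `S` to the outgoing links `U`. -/
def contraction (S : Finset (Chamber p q)) (I U : Finset (Sym2 (Chamber p q))) :
    Matrix (U → Fin d) ((I → Fin d) × (bulkOf S → Fin d)) ℂ :=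
  Matrix.of fun b' y => (Network.weight (d := d) S U : ℂ) *
    ∑ x : Network.linksAt S → Fin d, if Agree x y.1 ∧ Agree x b' then N.amplitude S x y.2 else 0

variable {S : Finset (Chamber p q)} {I U : Finset (Sym2 (Chamber p q))}

/-- The labels prescribed at the sites of `S` by labels of the open links and of the bulk legs. The value
at the other sites does not matter. -/
def openLabel [NeZero d] (S : Finset (Chamber p q)) (b : I → Fin d) (b' : U → Fin d)
    (γ : bulkOf S → Fin d) : Site S → Fin d :=
  Sum.elim (fun x => if h : x.1 ∈ I then b ⟨x.1, h⟩ else if h : x.1 ∈ U then b' ⟨x.1, h⟩ else 0) γ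

theorem contraction_eq [NeZero d] (hIU : Disjoint I U) (b' : U → Fin d)
    (y : (I → Fin d) × (bulkOf S → Fin d)) :
    contraction N S I U b' y = (Network.weight (d := d) S U : ℂ) * ∑ z : Site S → Fin d,
      eqOn (siteSet S (I ∪ U) (bulkOf S)) z (openLabel S y.1 b' y.2) *
        ∏ g : S, N.tensor g (z ∘ wire S g) := by
  classical
  unfold contraction
  rw [Matrix.of_apply]
  congr 1
  rw [← (Equiv.sumArrowEquivProdArrow _ _ _).symm.sum_comp, Fintype.sum_prod_type]
  refine Finset.sum_congr rfl fun x _ => ?_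
  rw [Finset.sum_eq_single y.2]
  · have h1 : eqOn (siteSet S (I ∪ U) (bulkOf S))
        ((Equiv.sumArrowEquivProdArrow _ _ _).symm (x, y.2)) (openLabel S y.1 b' y.2) =
        if Agree x y.1 ∧ Agree x b' then 1 else 0 := by
      unfold eqOn
      congr 1
      refine propext ⟨fun h => ⟨fun s hs hs' => ?_, fun s hs hs' => ?_⟩, ?_⟩
      · have := h (Sum.inl ⟨s, hs⟩) (inl_mem_siteSet.2 (Finset.mem_union_left _ hs'))
        simpa [openLabel, hs'] using this
      · have := h (Sum.inl ⟨s, hs⟩) (inl_mem_siteSet.2 (Finset.mem_union_right _ hs'))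
        simpa [openLabel, hs', Finset.disjoint_right.1 hIU hs'] using this
      · rintro ⟨hx, hx'⟩ (⟨s, hs⟩ | s) hm
        · by_cases hsI : s ∈ I
          · simpa [openLabel, hsI] using hx s hs hsI
          · have hsU : s ∈ U := (Finset.mem_union.1 (inl_mem_siteSet.1 hm)).resolve_left hsI
            simpa [openLabel, hsI, hsU] using hx' s hs hsU
        · rfl
    rw [h1, ite_mul, one_mul, zero_mul]
    have h2 : N.amplitude S x y.2 = ∏ g : S, N.tensor g
        ((Equiv.sumArrowEquivProdArrow _ _ _).symm (x, y.2) ∘ wire S g) := by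
      unfold Network.amplitude
      refine Finset.prod_congr rfl fun g _ => ?_
      congr 1
      funext l
      rcases l with l | m <;> rfl
    rw [h2]
  · intro γ _ hγ
    have : eqOn (siteSet S (I ∪ U) (bulkOf S))
        ((Equiv.sumArrowEquivProdArrow _ _ _).symm (x, γ)) (openLabel S y.1 b' y.2) = 0 := by
      refine if_neg fun h => hγ (funext fun s => ?_)
      exact h (Sum.inr s) (inr_mem_siteSet.2 s.2)
    rw [this, zero_mul]
  · simp

theorem openLabel_eq_of_mem_fixed [NeZero d] {V : Finset (Sym2 (Chamber p q))} (hV : V ⊆ U)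
    (b : I → Fin d) (γ : bulkOf S → Fin d) (x x' : V → Fin d) (c : (U \ V : Finset _) → Fin d)
    (hIU : Disjoint I U)
    (s : Site S) (hs : s ∈ siteSet S (I ∪ (U \ V)) (bulkOf S)) :
    openLabel S b ((splitLabels hV).symm (x, c)) γ s =
      openLabel S b ((splitLabels hV).symm (x', c)) γ s := by
  rcases s with s | s
  · rcases Finset.mem_union.1 (inl_mem_siteSet.1 hs) with h | h
    · simp [openLabel, h]
    · have h1 := Finset.mem_sdiff.1 h
      simp [openLabel, Finset.disjoint_right.1 hIU h1.1, h1.1, splitLabels, h1.2]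
  · rfl

theorem conj_eqOn {E : Type} [Fintype E] [DecidableEq E] (C : Finset E) (z z' : E → Fin d) :
    conj (eqOn C z z') = eqOn C z z' := by
  unfold eqOn
  split_ifs <;> simp

/-- The labels of the links in `V`. -/
def linkLabels {V : Finset (Sym2 (Chamber p q))} (hV : V ⊆ Network.linksAt S)
    (z : Site S → Fin d) : V → Fin d := fun s => z (Sum.inl ⟨s.1, hV s.2⟩)

open Classical in
theorem eqOn_siteSet {V : Finset (Sym2 (Chamber p q))} (hV : V ⊆ Network.linksAt S)
    (z z' : Site S → Fin d) :
    eqOn (siteSet S V ∅) z z' = if linkLabels hV z = linkLabels hV z' then 1 else 0 := by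
  unfold eqOn
  congr 1
  refine propext ⟨fun h => funext fun s => h _ (inl_mem_siteSet.2 s.2), fun h s hs => ?_⟩
  rcases s with s | s
  · exact congrFun h ⟨s.1, inl_mem_siteSet.1 hs⟩
  · exact absurd (inr_mem_siteSet.1 hs) (Finset.notMem_empty _)

theorem siteSet_union_sdiff {V : Finset (Sym2 (Chamber p q))} (hV : V ⊆ U) :
    siteSet S (I ∪ U) (bulkOf S) = siteSet S (I ∪ (U \ V)) (bulkOf S) ∪ siteSet S V ∅ := by
  ext s
  rcases s with s | s
  · simp only [Finset.mem_union, inl_mem_siteSet, Finset.mem_sdiff]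
    constructor
    · rintro (h | h)
      · exact Or.inl (Or.inl h)
      · by_cases hs : s.1 ∈ V
        · exact Or.inr hs
        · exact Or.inl (Or.inr ⟨h, hs⟩)
    · rintro ((h | h) | h)
      · exact Or.inl h
      · exact Or.inr h.1
      · exact Or.inr (hV h)
  · simp only [Finset.mem_union, inr_mem_siteSet, Finset.notMem_empty, or_false]

open Classical in
theorem eqOn_openLabel [NeZero d] (hIU : Disjoint I U) (hU : U ⊆ Network.linksAt S)
    {V : Finset (Sym2 (Chamber p q))} (hV : V ⊆ U) (x₀ x' : V → Fin d) (b : I → Fin d)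
    (γ : bulkOf S → Fin d) (c : (U \ V : Finset _) → Fin d) (z : Site S → Fin d) :
    eqOn (siteSet S (I ∪ U) (bulkOf S)) z (openLabel S b ((splitLabels hV).symm (x', c)) γ) =
      eqOn (siteSet S (I ∪ (U \ V)) (bulkOf S)) z
          (openLabel S b ((splitLabels hV).symm (x₀, c)) γ) *
        if linkLabels (hV.trans hU) z = x' then 1 else 0 := by
  rw [siteSet_union_sdiff hV, eqOn_union]
  congr 1
  · exact eqOn_congr (fun _ _ => rfl) fun s hs =>
      openLabel_eq_of_mem_fixed hV b γ x' x₀ c hIU s hs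
  · unfold eqOn
    congr 1
    refine propext ⟨fun h => funext fun s => ?_, fun h s hs => ?_⟩
    · have := h (Sum.inl ⟨s.1, hU (hV s.2)⟩) (inl_mem_siteSet.2 s.2)
      simpa [openLabel, Finset.disjoint_right.1 hIU (hV s.2), hV s.2, splitLabels, linkLabels]
        using this
    · rcases s with s | s
      · have hs' := inl_mem_siteSet.1 hs
        have := congrFun h ⟨s.1, hs'⟩
        simpa [openLabel, Finset.disjoint_right.1 hIU (hV hs'), hV hs', splitLabels, linkLabels,
          hs'] using this
      · exact absurd (inr_mem_siteSet.1 hs) (Finset.notMem_empty _)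

/-- Summing over the outgoing labels in `V` yields a contraction of two copies of the layer. -/
theorem sum_conj_contraction [NeZero d] (hIU : Disjoint I U)
    (hU : U ⊆ Network.linksAt S) {V : Finset (Sym2 (Chamber p q))} (hV : V ⊆ U)
    (x₀ : V → Fin d) (y₁ y₂ : (I → Fin d) × (bulkOf S → Fin d))
    (c₁ c₂ : (U \ V : Finset _) → Fin d) :
    ∑ x' : V → Fin d, conj (contraction N S I U ((splitLabels hV).symm (x', c₁)) y₁) *
      contraction N S I U ((splitLabels hV).symm (x', c₂)) y₂ =
    (Network.weight (d := d) S U : ℂ) ^ 2 * doubleSum (fun g : S => N.tensor g) (wire S) Finset.univ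
      (siteSet S V ∅) (fun z z' =>
        eqOn (siteSet S (I ∪ (U \ V)) (bulkOf S)) z
            (openLabel S y₁.1 ((splitLabels hV).symm (x₀, c₁)) y₁.2) *
          eqOn (siteSet S (I ∪ (U \ V)) (bulkOf S)) z'
            (openLabel S y₂.1 ((splitLabels hV).symm (x₀, c₂)) y₂.2)) := by
  classical
  have h1 : ∀ (y : (I → Fin d) × (bulkOf S → Fin d)) (c : (U \ V : Finset _) → Fin d)
      (x' : V → Fin d), contraction N S I U ((splitLabels hV).symm (x', c)) y = _ :=
    fun y c x' => (contraction_eq N hIU _ y).trans (congrArg _ (Finset.sum_congr rfl fun z _ =>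
      congrArg (· * _) (eqOn_openLabel hIU hU hV x₀ x' y.1 y.2 c z)))
  rw [Finset.sum_congr rfl fun x' _ => by rw [h1 y₁ c₁ x', h1 y₂ c₂ x']]
  rw [sum_conj_mul_fiberwise]
  refine congrArg (_ * ·) ?_
  unfold doubleSum
  refine Finset.sum_congr rfl fun z _ => Finset.sum_congr rfl fun z' _ => ?_
  rw [eqOn_siteSet (hV.trans hU), conj_eqOn, Finset.prod_mul_distrib, map_prod]

end Contraction

/-! ### Isometry of a layer and pushing through a layer -/

section Push

variable {p q d : ℕ} [NeZero p] [NeZero q] (N : Network p q d)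
  {n : ℕ} {S : Finset (Chamber p q)}
  {Bin Bout : Set (Chamber p q) → Finset (Sym2 (Chamber p q))} {R : Set (Chamber p q)}

theorem card_siteSet {A : Finset (Sym2 (Chamber p q))} {b : Finset (Chamber p q × Fin (q - 1))}
    (hA : A ⊆ Network.linksAt S) (hb : b ⊆ bulkOf S) : (siteSet S A b).card = A.card + b.card := by
  classical
  have h : ∀ {α : Type} [DecidableEq α] (T A : Finset α), A ⊆ T →
      ((Finset.univ : Finset T).filter fun x => x.1 ∈ A).card = A.card := by
    intro α _ T A hAT
    rw [← Finset.card_map (Function.Embedding.subtype _)]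
    congr 1
    ext x
    simp only [Finset.mem_map, Finset.mem_filter, Finset.mem_univ, true_and,
      Function.Embedding.subtype_apply, Subtype.exists, exists_and_left, exists_prop, exists_eq_right_right]
    exact ⟨fun h => h.1, fun h => ⟨h, hAT h⟩⟩
  rw [← h _ _ hA, ← h _ _ hb, ← Finset.card_disjSum]
  congr 1
  ext s
  rcases s with s | s
  · simp [inl_mem_siteSet]
  · simp [inr_mem_siteSet]

theorem openLabel_eqOn_fixed [NeZero d] {I U : Finset (Sym2 (Chamber p q))}
    (hI : I ⊆ Network.linksAt S) (y₁ y₂ : (I → Fin d) × (bulkOf S → Fin d)) (b' : U → Fin d) :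
    eqOn (siteSet S (I ∪ (U \ U)) (bulkOf S)) (openLabel S y₁.1 b' y₁.2) (openLabel S y₂.1 b' y₂.2) =
      if y₁ = y₂ then 1 else 0 := by
  classical
  unfold eqOn
  congr 1
  refine propext ⟨fun h => Prod.ext (funext fun s => ?_) (funext fun s => ?_), ?_⟩
  · have := h (Sum.inl ⟨s.1, hI s.2⟩) (inl_mem_siteSet.2 (Finset.mem_union_left _ s.2))
    simpa [openLabel] using this
  · exact h (Sum.inr s) (inr_mem_siteSet.2 s.2)
  · rintro rfl s _
    rfl

/-- The contraction of a layer is an isometry from the ingoing links and the bulk legs. -/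
theorem IsLayer.contraction_isometry [NeZero d] (hp : 5 ≤ p) (hq : 3 ≤ q)
    (hL : IsLayer N.center n S Bin Bout) :
    (contraction N S (Bin Set.univ) (Bout Set.univ)).conjTranspose *
      contraction N S (Bin Set.univ) (Bout Set.univ) = 1 := by
  classical
  ext y₁ y₂
  have hd : d ≠ 0 := NeZero.ne d
  have hIU := hL.disjoint_in_out Set.univ Set.univ
  have hI := hL.in_subset_linksAt Set.univ
  have hU := hL.out_subset_linksAt Set.univ
  rw [Matrix.mul_apply, Matrix.one_apply,
    ← (splitLabels (d := d) (Finset.Subset.refl (Bout Set.univ))).symm.sum_comp,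
    Fintype.sum_prod_type]
  let c : (Bout Set.univ \ Bout Set.univ : Finset _) → Fin d := fun _ => 0
  have hsub : Subsingleton ((Bout Set.univ \ Bout Set.univ : Finset _) → Fin d) := by
    rw [Finset.sdiff_self]; infer_instance
  simp only [Fintype.sum_subsingleton _ c, Matrix.conjTranspose_apply, RCLike.star_def]
  rw [sum_conj_contraction N hIU hU (Finset.Subset.refl _) (fun _ => 0)]
  have huniv : tilesIn S (Set.univ : Set (Chamber p q)) = Finset.univ := by
    ext g; simp [mem_tilesIn]
  have hpeel := hL.peelable hp hq (isRegion_univ N.center)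
  rw [huniv] at hpeel
  have key := doubleSum_univ hd (fun g : S => N.perfect g) (fun g : S => N.normalized g)
    (hL.wiring Set.univ) hpeel wire_cover
    (openLabel S y₁.1 ((splitLabels (Finset.Subset.refl _)).symm (fun _ => 0, c)) y₁.2)
    (openLabel S y₂.1 ((splitLabels (Finset.Subset.refl _)).symm (fun _ => 0, c)) y₂.2)
  unfold fixedSites at key
  rw [openLabel_eqOn_fixed hI] at key
  have hd' : (d : ℂ) ≠ 0 := Nat.cast_ne_zero.2 hd
  refine mul_left_cancel₀ (pow_ne_zero (Fintype.card S * Fintype.card (Leg p q)) hd') ?_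
  rw [mul_left_comm, key, ← mul_assoc]
  congr 1
  have hw : (Network.weight (d := d) S (Bout Set.univ) : ℂ) ^ 2 =
      (d : ℂ) ^ ((Network.linksAt S \ Bout Set.univ).card + S.card * (q - 1)) := by
    unfold Network.weight
    rw [← Complex.ofReal_pow, ← pow_mul, mul_comm, pow_mul, Real.sq_sqrt (Nat.cast_nonneg d)]
    push_cast
    rfl
  rw [hw, ← pow_add]
  congr 1
  have hcard := hL.card_mul_eq
  have hcl : Fintype.card (Leg p q) = p * (q - 1) + (q - 1) := by
    rw [Fintype.card_sum, Fintype.card_prod, ZMod.card, Fintype.card_subtype_compl,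
      Fintype.card_subtype_eq, ZMod.card, Fintype.card_fin]
  have hE : Fintype.card (Site S) = (Network.linksAt S).card + (bulkOf S).card := by
    rw [Fintype.card_sum, Fintype.card_coe, Fintype.card_coe]
  rw [card_siteSet (by rw [Finset.sdiff_self, Finset.union_empty]; exact hI)
    (Finset.Subset.refl _), hE, hcl, Fintype.card_coe, mul_add, hcard, Finset.card_sdiff_of_subset hI, Finset.sdiff_self, Finset.union_empty]
  have := Finset.card_le_card hI
  omega

/-- The identification of the labels of a pair of systems with pairs of labels inside and outside. -/
def pairSplit {α β : Type} [DecidableEq α] [DecidableEq β] {A I : Finset α} {b B : Finset β}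
    (hA : A ⊆ I) (hb : b ⊆ B) : ((I → Fin d) × (B → Fin d)) ≃
      ((A → Fin d) × (b → Fin d)) × (((I \ A : Finset _) → Fin d) × ((B \ b : Finset _) → Fin d)) :=
  ((splitLabels hA).prodCongr (splitLabels hb)).trans (Equiv.prodProdProdComm _ _ _ _)

theorem eqOn_openLabel_pairSplit [NeZero d] {I U A : Finset (Sym2 (Chamber p q))}
    {b : Finset (Chamber p q × Fin (q - 1))} (hI : I ⊆ Network.linksAt S) (hA : A ⊆ I)
    (hb : b ⊆ bulkOf S) (x₁ x₂ : (A → Fin d) × (b → Fin d))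
    (z₁ z₂ : ((I \ A : Finset _) → Fin d) × ((bulkOf S \ b : Finset _) → Fin d))
    (c₁ c₂ : U → Fin d) :
    eqOn (siteSet S A b)
      (openLabel S ((pairSplit hA hb).symm (x₁, z₁)).1 c₁ ((pairSplit hA hb).symm (x₁, z₁)).2)
      (openLabel S ((pairSplit hA hb).symm (x₂, z₂)).1 c₂ ((pairSplit hA hb).symm (x₂, z₂)).2) =
      if x₁ = x₂ then 1 else 0 := by
  classical
  unfold eqOn
  congr 1
  refine propext ⟨fun h => Prod.ext (funext fun s => ?_) (funext fun s => ?_), ?_⟩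
  · have := h (Sum.inl ⟨s.1, hI (hA s.2)⟩) (inl_mem_siteSet.2 s.2)
    simpa [openLabel, hA s.2, pairSplit, splitLabels] using this
  · have := h (Sum.inr ⟨s.1, hb s.2⟩) (inr_mem_siteSet.2 s.2)
    simpa [openLabel, pairSplit, splitLabels] using this
  · rintro rfl (s | s) hs
    · have hs' := inl_mem_siteSet.1 hs
      simp [openLabel, hA hs', pairSplit, splitLabels, hs']
    · have hs' := inr_mem_siteSet.1 hs
      simp [openLabel, pairSplit, splitLabels, hs']

theorem openLabel_pairSplit_of_notMem [NeZero d] {I U A : Finset (Sym2 (Chamber p q))}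
    {b : Finset (Chamber p q × Fin (q - 1))} (hA : A ⊆ I)
    (hb : b ⊆ bulkOf S) (x₁ x₂ : (A → Fin d) × (b → Fin d))
    (z : ((I \ A : Finset _) → Fin d) × ((bulkOf S \ b : Finset _) → Fin d))
    (c : U → Fin d) (s : Site S) (hs : s ∉ siteSet S A b) :
    openLabel S ((pairSplit hA hb).symm (x₁, z)).1 c ((pairSplit hA hb).symm (x₁, z)).2 s =
      openLabel S ((pairSplit hA hb).symm (x₂, z)).1 c ((pairSplit hA hb).symm (x₂, z)).2 s := by
  rcases s with s | s
  · rw [inl_mem_siteSet] at hs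
    simp [openLabel, pairSplit, splitLabels, hs]
  · rw [inr_mem_siteSet] at hs
    simp [openLabel, pairSplit, splitLabels, hs]

theorem contraction_ne_zero [NeZero d] (hp : 5 ≤ p) (hq : 3 ≤ q)
    (hL : IsLayer N.center n S Bin Bout) :
    contraction N S (Bin Set.univ) (Bout Set.univ) ≠ 0 := by
  intro h
  have := hL.contraction_isometry N hp hq
  rw [h, Matrix.mul_zero] at this
  exact zero_ne_one this

/-- Operators on the links into a region and on the bulk legs of the region are pushed through a layer
to the links leading out of this layer into the region. -/
theorem IsLayer.exists_push [NeZero d] (hp : 5 ≤ p) (hq : 3 ≤ q)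
    (hL : IsLayer N.center n S Bin Bout) (hR : IsRegion N.center R)
    {b : Finset (Chamber p q × Fin (q - 1))} (hb : b ⊆ bulkOf S) (hbR : ∀ s ∈ b, s.1 ∈ R)
    (hin : Bin R ⊆ Bin Set.univ) (hout : Bout R ⊆ Bout Set.univ) :
    ∃ P : Matrix ((Bin R → Fin d) × (b → Fin d)) ((Bin R → Fin d) × (b → Fin d)) ℂ →⋆ₐ[ℂ]
        Matrix (Bout R → Fin d) (Bout R → Fin d) ℂ,
      ∀ B, ampl (splitLabels hout) (P B) * contraction N S (Bin Set.univ) (Bout Set.univ) =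
        contraction N S (Bin Set.univ) (Bout Set.univ) * ampl (pairSplit hin hb) B := by
  classical
  have hd : d ≠ 0 := NeZero.ne d
  have hIU := hL.disjoint_in_out Set.univ Set.univ
  have hI := hL.in_subset_linksAt Set.univ
  have hU := hL.out_subset_linksAt Set.univ
  refine exists_ampl_mul_eq ?_ _ _ _ (contraction_ne_zero N hp hq hL) fun z₁ z₂ c₁ c₂ => ?_
  · simp only [Fintype.card_prod, Fintype.card_fun, Fintype.card_fin, ← pow_add]
    exact card_labels_dvd hd
  let x₀ : (Bin R → Fin d) × (b → Fin d) := (fun _ => 0, fun _ => 0)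
  let a : (Bin R → Fin d) × (b → Fin d) → (((Bin Set.univ \ Bin R : Finset _) → Fin d) ×
      ((bulkOf S \ b : Finset _) → Fin d)) → ((Bout Set.univ \ Bout R : Finset _) → Fin d) →
      Site S → Fin d := fun x z c => openLabel S ((pairSplit hin hb).symm (x, z)).1
        ((splitLabels hout).symm (fun _ => 0, c)) ((pairSplit hin hb).symm (x, z)).2
  let F := fixedSites S Bin Bout R
  let X := siteSet S (Bin R) b
  have hXF : X ⊆ F := by
    intro s hs
    rcases s with s | s
    · exact inl_mem_siteSet.2 (Finset.mem_union_left _ (hin (inl_mem_siteSet.1 hs)))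
    · exact inr_mem_siteSet.2 (hb (inr_mem_siteSet.1 hs))
  have hXK : X ⊆ sitesOf (wire S) (tilesIn S R) := by
    intro s hs
    rcases s with s | s
    · obtain ⟨g, hg, l, hl, -, hgR⟩ := (hL.mem_in _ _).1 (inl_mem_siteSet.1 hs)
      exact mem_sitesOf.2 ⟨⟨g, hg⟩, mem_tilesIn.2 hgR, Sum.inl l,
        congrArg Sum.inl (Subtype.ext hl.symm)⟩
    · exact mem_sitesOf.2 ⟨⟨s.1.1, (Finset.mem_product.1 s.2).1⟩,
        mem_tilesIn.2 (hbR _ (inr_mem_siteSet.1 hs)), Sum.inr s.1.2, rfl⟩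
  obtain ⟨g, hg⟩ := doubleSum_eq_ite hd (fun g : S => N.perfect g) (fun g : S => N.normalized g)
    (hL.wiring R) (hL.peelable hp hq hR) hXF hXK
    (k := fun z z' => eqOn (F \ X) z (a x₀ z₁ c₁) * eqOn (F \ X) z' (a x₀ z₂ c₂))
    (fun z z' w w' h h' => by
      simp only []
      rw [eqOn_congr (w := w) (w' := a x₀ z₁ c₁) h fun _ _ => rfl,
        eqOn_congr (w := w') (w' := a x₀ z₂ c₂) h' fun _ _ => rfl])
  refine ⟨(Network.weight (d := d) S (Bout Set.univ) : ℂ) ^ 2 * g, fun x₁ x₂ => ?_⟩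
  rw [sum_conj_contraction N hIU hU hout (fun _ => 0)]
  have hsplit : ∀ x z c (y : Site S → Fin d), eqOn F y (a x z c) =
      eqOn X y (a x z c) * eqOn (F \ X) y (a x₀ z c) := by
    intro x z c y
    nth_rewrite 1 [← Finset.union_sdiff_of_subset hXF]
    rw [eqOn_union]
    congr 1
    exact eqOn_congr (fun _ _ => rfl) fun s hs =>
      openLabel_pairSplit_of_notMem hin hb x x₀ z _ s (Finset.mem_sdiff.1 hs).2
  have hfun : (fun y y' : Site S → Fin d => eqOn F y (a x₁ z₁ c₁) * eqOn F y' (a x₂ z₂ c₂)) =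
      fun y y' => (eqOn X y (a x₁ z₁ c₁) * eqOn X y' (a x₂ z₂ c₂)) *
        (eqOn (F \ X) y (a x₀ z₁ c₁) * eqOn (F \ X) y' (a x₀ z₂ c₂)) := by
    funext y y'
    rw [hsplit, hsplit, mul_mul_mul_comm]
  have h1 := hg (a x₁ z₁ c₁) (a x₂ z₂ c₂)
  rw [← hfun, eqOn_openLabel_pairSplit hI] at h1
  refine (congrArg (_ * ·) h1).trans ?_
  split_ifs <;> simp

end Push

/-! ### The truncated networks as products of layers -/

section Truncation

variable {p q d : ℕ} [NeZero p] [NeZero q] (N : Network p q d)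

theorem Network.mem_ball {Λ : ℕ} {g : Chamber p q} :
    g ∈ N.ball Λ ↔ (networkGraph p q).dist N.center g ≤ Λ := by
  simp [Network.ball]

theorem Network.mem_shell {Λ : ℕ} {g : Chamber p q} :
    g ∈ N.shell Λ ↔ (networkGraph p q).dist N.center g = Λ + 1 := by
  rw [Network.shell, Finset.mem_sdiff, N.mem_ball, N.mem_ball]
  omega

theorem Network.mem_boundaryLegs {Λ : ℕ} {R : Set (Chamber p q)} {x : Sym2 (Chamber p q)} :
    x ∈ N.boundaryLegs Λ R ↔ ∃ (g : Chamber p q) (l : ContractedLeg p q), x = link g l ∧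
      (networkGraph p q).dist N.center g ≤ Λ ∧
      Λ < (networkGraph p q).dist N.center (neighbor g l) ∧ neighbor g l ∈ R := by
  classical
  simp only [Network.boundaryLegs, Finset.mem_image, Finset.mem_filter, Finset.mem_product,
    Finset.mem_univ, and_true, N.mem_ball, not_le]
  constructor
  · rintro ⟨⟨g, l⟩, ⟨h1, h2, h3⟩, rfl⟩
    exact ⟨g, l, rfl, h1, h2, h3⟩
  · rintro ⟨g, l, rfl, h1, h2, h3⟩
    exact ⟨(g, l), ⟨h1, h2, h3⟩, rfl⟩

theorem dist_neighbor_le_succ (o g : Chamber p q) (l : ContractedLeg p q) :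
    (networkGraph p q).dist o (neighbor g l) ≤ (networkGraph p q).dist o g + 1 := by
  have h1 := dist_triangle o g (neighbor g l)
  have h2 := dist_neighbor_le g l
  omega

theorem Network.mem_boundaryLegs_out {Λ : ℕ} {R : Set (Chamber p q)} {x : Sym2 (Chamber p q)} :
    x ∈ N.boundaryLegs Λ R ↔ ∃ g, (networkGraph p q).dist N.center g = Λ ∧
      ∃ l : ContractedLeg p q, x = link g l ∧
        Λ < (networkGraph p q).dist N.center (neighbor g l) ∧ neighbor g l ∈ R := by
  rw [N.mem_boundaryLegs]
  constructor
  · rintro ⟨g, l, rfl, h1, h2, h3⟩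
    have := dist_neighbor_le_succ N.center g l
    exact ⟨g, by omega, l, rfl, h2, h3⟩
  · rintro ⟨g, h1, l, rfl, h2, h3⟩
    exact ⟨g, l, rfl, h1.le, h2, h3⟩

theorem Network.isLayer_ball_zero : IsLayer N.center 0 (N.ball 0) (fun _ => ∅) (N.boundaryLegs 0) where
  mem_iff g := by rw [N.mem_ball, Nat.le_zero]
  mem_in R x := by simp
  mem_out R x := by
    rw [N.mem_boundaryLegs_out]
    simp only [N.mem_ball, Nat.le_zero]

theorem Network.isLayer_shell (Λ : ℕ) :
    IsLayer N.center (Λ + 1) (N.shell Λ) (N.boundaryLegs Λ) (N.boundaryLegs (Λ + 1)) where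
  mem_iff g := N.mem_shell
  mem_in R x := by
    simp only [N.mem_shell]
    rw [N.mem_boundaryLegs]
    constructor
    · rintro ⟨g, l, rfl, h1, h2, h3⟩
      have := dist_neighbor_le_succ N.center g l
      obtain ⟨m, -, hm⟩ := exists_neighbor_symm g l
      refine ⟨neighbor g l, by omega, m, link_eq_link_iff.2 (Or.inr ⟨rfl, hm.symm⟩), ?_, h3⟩
      rw [hm]; omega
    · rintro ⟨g, h1, l, rfl, h2, h3⟩
      obtain ⟨m, -, hm⟩ := exists_neighbor_symm g l
      refine ⟨neighbor g l, m, link_eq_link_iff.2 (Or.inr ⟨rfl, hm.symm⟩), by omega, ?_, ?_⟩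
      · rw [hm]; omega
      · rwa [hm]
  mem_out R x := by
    rw [N.mem_boundaryLegs_out]
    simp only [N.mem_shell]

/-- Restriction of a labelling to a smaller set of sites. -/
def resLabels {α : Type} {A B : Finset α} (h : A ⊆ B) (y : B → Fin d) : A → Fin d :=
  fun s => y ⟨s.1, h s.2⟩

open Classical in
/-- The matrix of the bulk-to-boundary map. -/
def Network.bulkMatrix (Λ : ℕ) :
    Matrix (N.boundaryLegs Λ Set.univ → Fin d) (N.bulkSites Λ Set.univ → Fin d) ℂ :=
  Matrix.of fun b β => (Network.weight (d := d) (N.ball Λ) (N.boundaryLegs Λ Set.univ) : ℂ) *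
    ∑ x : Network.linksAt (N.ball Λ) → Fin d, if Agree x b then
      N.amplitude (N.ball Λ) x (fun s => β ⟨s, by simp [Network.bulkSites]⟩) else 0

/-- The contraction of layer `Λ + 1`. -/
def Network.layerContraction (Λ : ℕ) : Matrix (N.boundaryLegs (Λ + 1) Set.univ → Fin d)
    ((N.boundaryLegs Λ Set.univ → Fin d) × (bulkOf (N.shell Λ) → Fin d)) ℂ :=
  contraction N (N.shell Λ) (N.boundaryLegs Λ Set.univ) (N.boundaryLegs (Λ + 1) Set.univ)

theorem Network.bulkToBoundary_eq (Λ : ℕ) :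
    N.bulkToBoundary Λ = Matrix.toEuclideanLin (N.bulkMatrix Λ) := rfl

/-- The matrix of the contraction of layer `Λ + 1` with its bulk legs in the state `χ`. -/
def Network.layerMatrix (Λ : ℕ) (χ : Qudits d (bulkOf (N.shell Λ))) :
    Matrix (N.boundaryLegs (Λ + 1) Set.univ → Fin d) (N.boundaryLegs Λ Set.univ → Fin d) ℂ :=
  Matrix.of fun b' b => ∑ β, N.layerContraction Λ b' (b, β) * χ β

theorem Network.layerMap_eq (Λ : ℕ) (χ : Qudits d (bulkOf (N.shell Λ))) :
    N.layerMap Λ χ = Matrix.toEuclideanLin (N.layerMatrix Λ χ) := by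
  unfold Network.layerMap
  congr 1
  ext b' b
  simp only [Network.layerMatrix, Network.layerContraction, contraction, Matrix.of_apply,
    mul_assoc, Finset.sum_mul]
  rw [← Finset.mul_sum, Finset.sum_comm]
  congr 1
  refine Finset.sum_congr rfl fun x _ => ?_
  split_ifs
  · exact Finset.sum_congr rfl fun β _ => mul_comm _ _
  · simp

theorem Network.mem_bulkSites {Λ : ℕ} {R : Set (Chamber p q)} {s : Chamber p q × Fin (q - 1)} :
    s ∈ N.bulkSites Λ R ↔ s.1 ∈ N.ball Λ ∧ s.1 ∈ R := by
  classical
  simp [Network.bulkSites]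

theorem Network.shell_bulk_subset (Λ : ℕ) :
    bulkOf (N.shell Λ) ⊆ N.bulkSites (Λ + 1) Set.univ := by
  intro s hs
  rw [N.mem_bulkSites]
  exact ⟨(Finset.mem_sdiff.1 (Finset.mem_product.1 hs).1).1, Set.mem_univ _⟩

theorem Network.ball_zero_bulk : N.bulkSites 0 Set.univ = bulkOf (N.ball 0) := by
  ext s
  rw [N.mem_bulkSites]
  simp

/-- Pairs of labellings that agree at the common sites are the labellings of the union. -/
theorem sum_glue {α : Type} [DecidableEq α] {A B C : Finset α} (hA : A ⊆ C) (hB : B ⊆ C)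
    (hC : C ⊆ A ∪ B) (f : (A → Fin d) → ℂ) (g : (B → Fin d) → ℂ)
    [∀ (x : A → Fin d) (y : B → Fin d), Decidable (Agree x y)] :
    ∑ x : C → Fin d, f (resLabels hA x) * g (resLabels hB x) =
      ∑ x : A → Fin d, ∑ y : B → Fin d, if Agree x y then f x * g y else 0 := by
  rw [← Fintype.sum_prod_type', ← Finset.sum_filter]
  refine Finset.sum_nbij' (fun x => (resLabels hA x, resLabels hB x))
    (fun x s => if h : s.1 ∈ A then x.1 ⟨s.1, h⟩ else if h' : s.1 ∈ B then x.2 ⟨s.1, h'⟩ else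
      absurd (Finset.mem_union.1 (hC s.2)) (by simp [h, h'])) ?_ ?_ ?_ ?_ ?_
  · intro x _
    simp only [Finset.mem_filter, Finset.mem_univ, true_and]
    intro s _ _
    rfl
  · simp
  · intro x _
    funext s
    by_cases h : s.1 ∈ A
    · simp [h, resLabels]
    · have h' := (Finset.mem_union.1 (hC s.2)).resolve_left h
      simp [h, h', resLabels]
  · rintro ⟨x, y⟩ hxy
    simp only [Finset.mem_filter, Finset.mem_univ, true_and] at hxy
    refine Prod.ext (funext fun s => ?_) (funext fun s => ?_)
    · simp [resLabels]
    · by_cases h : s.1 ∈ A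
      · simpa [resLabels, h] using hxy s.1 h s.2
      · simp [resLabels, h]
  · intro x _
    rfl

/-- Summing over the labels of the common sites identifies the labels there. -/
theorem sum_agree {α : Type} [DecidableEq α] {A B I : Finset α} (hIA : I ⊆ A)
    (hI : ∀ s ∈ A, s ∈ B → s ∈ I) (x : A → Fin d) (y : B → Fin d)
    [∀ b : I → Fin d, Decidable (Agree x b)] [∀ b : I → Fin d, Decidable (Agree y b)]
    [Decidable (Agree x y)] :
    ∑ b : I → Fin d, (if Agree x b then if Agree y b then (1 : ℂ) else 0 else 0) =
      if Agree x y then 1 else 0 := by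
  rw [Finset.sum_eq_single (resLabels hIA x)]
  · have h1 : Agree x (resLabels hIA x) := fun s _ _ => rfl
    rw [if_pos h1]
    congr 1
    refine propext ⟨fun h s hs hs' => ?_, fun h s hs hs' => ?_⟩
    · exact (h s hs' (hI s hs hs')).symm
    · exact (h s (hIA hs') hs).symm
  · intro b _ hb
    rw [if_neg]
    intro h
    exact hb (funext fun s => (h s.1 (hIA s.2) s.2).symm)
  · simp

theorem Network.linksAt_union (Λ : ℕ) : Network.linksAt (N.ball (Λ + 1)) =
    Network.linksAt (N.shell Λ) ∪ Network.linksAt (N.ball Λ) := by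
  ext x
  simp only [Finset.mem_union, mem_linksAt, Network.shell, Finset.mem_sdiff]
  constructor
  · rintro ⟨g, hg, l, rfl⟩
    by_cases h : g ∈ N.ball Λ
    · exact Or.inr ⟨g, h, l, rfl⟩
    · exact Or.inl ⟨g, ⟨hg, h⟩, l, rfl⟩
  · rintro (⟨g, hg, l, rfl⟩ | ⟨g, hg, l, rfl⟩)
    · exact ⟨g, hg.1, l, rfl⟩
    · exact ⟨g, N.ball_mono Λ hg, l, rfl⟩

theorem Network.mem_boundaryLegs_of_mem_linksAt {Λ : ℕ} {x : Sym2 (Chamber p q)}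
    (h : x ∈ Network.linksAt (N.shell Λ)) (h' : x ∈ Network.linksAt (N.ball Λ)) :
    x ∈ N.boundaryLegs Λ Set.univ := by
  obtain ⟨g, hg, l, rfl⟩ := mem_linksAt.1 h
  obtain ⟨g', hg', l', hl⟩ := mem_linksAt.1 h'
  rw [N.mem_shell] at hg
  rw [N.mem_ball] at hg'
  rw [N.mem_boundaryLegs]
  rcases link_eq_link_iff.1 hl with ⟨rfl, -⟩ | ⟨h1, -⟩
  · omega
  · exact ⟨g', l', hl.symm, hg', by rw [← h1, hg]; omega, Set.mem_univ _⟩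

theorem Network.weight_succ (Λ : ℕ) :
    Network.weight (d := d) (N.ball (Λ + 1)) (N.boundaryLegs (Λ + 1) Set.univ) =
      Network.weight (d := d) (N.shell Λ) (N.boundaryLegs (Λ + 1) Set.univ) *
        Network.weight (d := d) (N.ball Λ) (N.boundaryLegs Λ Set.univ) := by
  unfold Network.weight
  rw [← pow_add]
  congr 1
  have h1 : (N.ball (Λ + 1)).card = (N.shell Λ).card + (N.ball Λ).card := by
    rw [Network.shell, Finset.card_sdiff_add_card_eq_card (N.ball_mono Λ)]
  have h2 : Network.linksAt (N.ball (Λ + 1)) \ N.boundaryLegs (Λ + 1) Set.univ =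
      (Network.linksAt (N.shell Λ) \ N.boundaryLegs (Λ + 1) Set.univ) ∪
        (Network.linksAt (N.ball Λ) \ N.boundaryLegs Λ Set.univ) := by
    rw [N.linksAt_union]
    ext x
    simp only [Finset.mem_sdiff, Finset.mem_union]
    have h3 : x ∈ Network.linksAt (N.ball Λ) → x ∉ N.boundaryLegs (Λ + 1) Set.univ := by
      intro hx hx'
      obtain ⟨g, hg, l, rfl⟩ := mem_linksAt.1 hx
      obtain ⟨g', hg', l', hl, hd, -⟩ := N.mem_boundaryLegs_out.1 hx'
      rw [N.mem_ball] at hg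
      rcases link_eq_link_iff.1 hl with ⟨rfl, -⟩ | ⟨h, h'⟩
      · omega
      · rw [← h'] at hd
        omega
    have h4 : x ∈ N.boundaryLegs Λ Set.univ → x ∈ Network.linksAt (N.shell Λ) :=
      fun hx => (N.isLayer_shell Λ).in_subset_linksAt _ hx
    constructor
    · rintro ⟨h | h, hx⟩
      · exact Or.inl ⟨h, hx⟩
      · by_cases hb : x ∈ N.boundaryLegs Λ Set.univ
        · exact Or.inl ⟨h4 hb, hx⟩
        · exact Or.inr ⟨h, hb⟩
    · rintro (⟨h, hx⟩ | ⟨h, hx⟩)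
      · exact ⟨Or.inl h, hx⟩
      · exact ⟨Or.inr h, h3 h⟩
  rw [h2, Finset.card_union_of_disjoint, h1]
  · ring
  · refine Finset.disjoint_left.2 fun x hx hx' => ?_
    exact (Finset.mem_sdiff.1 hx').2 (N.mem_boundaryLegs_of_mem_linksAt (Finset.mem_sdiff.1 hx).1
      (Finset.mem_sdiff.1 hx').1)

theorem Network.shell_linksAt_subset (Λ : ℕ) :
    Network.linksAt (N.shell Λ) ⊆ Network.linksAt (N.ball (Λ + 1)) := by
  rw [N.linksAt_union]; exact Finset.subset_union_left

theorem Network.ball_linksAt_subset (Λ : ℕ) :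
    Network.linksAt (N.ball Λ) ⊆ Network.linksAt (N.ball (Λ + 1)) := by
  rw [N.linksAt_union]; exact Finset.subset_union_right

theorem Network.amplitude_succ (Λ : ℕ) (x : Network.linksAt (N.ball (Λ + 1)) → Fin d)
    (β : N.bulkSites (Λ + 1) Set.univ → Fin d) :
    N.amplitude (N.ball (Λ + 1)) x (fun s => β ⟨s, by simp [Network.bulkSites]⟩) =
      N.amplitude (N.shell Λ) (resLabels (N.shell_linksAt_subset Λ) x)
          (resLabels (N.shell_bulk_subset Λ) β) *
        N.amplitude (N.ball Λ) (resLabels (N.ball_linksAt_subset Λ) x)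
          (fun s => resLabels (N.bulkSites_mono Λ Set.univ) β
            ⟨s, by simp [Network.bulkSites]⟩) := by
  unfold Network.amplitude
  let f : {g // g ∈ N.ball (Λ + 1)} → ℂ := fun g => N.tensor g (Sum.elim
    (fun l => x ⟨link g l, Finset.mem_image.2
      ⟨(g, l), Finset.mem_product.2 ⟨g.2, Finset.mem_univ _⟩, rfl⟩⟩)
    (fun m => β ⟨(g, m), N.mem_bulkSites.2 ⟨g.2, Set.mem_univ _⟩⟩))
  change ∏ g, f g = (∏ g : N.shell Λ, f ⟨g.1, (Finset.mem_sdiff.1 g.2).1⟩) *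
    ∏ g : N.ball Λ, f ⟨g.1, N.ball_mono Λ g.2⟩
  let F : Chamber p q → ℂ := fun g => if h : g ∈ N.ball (Λ + 1) then f ⟨g, h⟩ else 1
  have h1 : ∀ (T : Finset (Chamber p q)) (hT : T ⊆ N.ball (Λ + 1)),
      ∏ g : T, f ⟨g.1, hT g.2⟩ = ∏ g ∈ T, F g := by
    intro T hT
    rw [← Finset.prod_coe_sort T F]
    refine Finset.prod_congr rfl fun g _ => ?_
    simp only [F, dif_pos (hT g.2)]
  rw [h1 (N.shell Λ) Finset.sdiff_subset, h1 (N.ball Λ) (N.ball_mono Λ),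
    show ∏ g, f g = ∏ g ∈ N.ball (Λ + 1), F g from h1 _ (Finset.Subset.refl _), Network.shell,
    Finset.prod_sdiff (N.ball_mono Λ)]

/-- The truncation at `Λ + 1` is the truncation at `Λ` followed by layer `Λ + 1`. -/
theorem Network.bulkMatrix_succ (Λ : ℕ) (b' : N.boundaryLegs (Λ + 1) Set.univ → Fin d)
    (β : N.bulkSites (Λ + 1) Set.univ → Fin d) :
    N.bulkMatrix (Λ + 1) b' β = ∑ b, N.layerContraction Λ b'
      (b, resLabels (N.shell_bulk_subset Λ) β) *
        N.bulkMatrix Λ b (resLabels (N.bulkSites_mono Λ Set.univ) β) := by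
  classical
  set γ := resLabels (N.shell_bulk_subset Λ) β
  set β₀ := resLabels (N.bulkSites_mono Λ Set.univ) β
  let f : (Network.linksAt (N.shell Λ) → Fin d) → ℂ := fun x =>
    if Agree x b' then N.amplitude (N.shell Λ) x γ else 0
  let g : (Network.linksAt (N.ball Λ) → Fin d) → ℂ := fun x =>
    N.amplitude (N.ball Λ) x (fun s => β₀ ⟨s, by simp [Network.bulkSites]⟩)
  have h1 : N.bulkMatrix (Λ + 1) b' β =
      (Network.weight (d := d) (N.ball (Λ + 1)) (N.boundaryLegs (Λ + 1) Set.univ) : ℂ) *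
      ∑ x : Network.linksAt (N.ball (Λ + 1)) → Fin d,
        f (resLabels (N.shell_linksAt_subset Λ) x) * g (resLabels (N.ball_linksAt_subset Λ) x) := by
    unfold Network.bulkMatrix
    rw [Matrix.of_apply]
    congr 1
    refine Finset.sum_congr rfl fun x _ => ?_
    have hag : Agree x b' ↔ Agree (resLabels (N.shell_linksAt_subset Λ) x) b' :=
      ⟨fun h s hs hs' => h s _ hs', fun h s hs hs' =>
        h s ((N.isLayer_shell Λ).out_subset_linksAt _ hs') hs'⟩
    rw [N.amplitude_succ]
    by_cases h : Agree x b'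
    · rw [if_pos h]
      simp only [f, if_pos (hag.1 h)]
      rfl
    · rw [if_neg h]
      simp only [f, if_neg (fun h' => h (hag.2 h')), zero_mul]
  rw [h1, sum_glue _ _ (N.linksAt_union Λ).subset]
  unfold Network.layerContraction contraction Network.bulkMatrix
  simp only [Matrix.of_apply]
  rw [N.weight_succ]
  push_cast
  rw [Finset.sum_congr rfl fun b _ => mul_mul_mul_comm _ _ _ _, ← Finset.mul_sum]
  refine congrArg₂ (· * ·) rfl ?_
  symm
  simp only [Finset.sum_mul_sum]
  rw [Finset.sum_comm]
  refine Finset.sum_congr rfl fun x _ => ?_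
  rw [Finset.sum_comm]
  refine Finset.sum_congr rfl fun y _ => ?_
  have h2 := sum_agree ((N.isLayer_shell Λ).in_subset_linksAt Set.univ)
    (fun s hs hs' => N.mem_boundaryLegs_of_mem_linksAt hs hs') x y
  have h3 : (if Agree x y then f x * g y else 0) =
      (if Agree x y then (1 : ℂ) else 0) * (f x * g y) := by
    split_ifs <;> simp
  rw [h3, ← h2, Finset.sum_mul]
  refine Finset.sum_congr rfl fun b _ => ?_
  by_cases hx : Agree x b <;> by_cases hy : Agree y b <;> simp [f, g, hx, hy]

theorem Network.bulkMatrix_zero (b' : N.boundaryLegs 0 Set.univ → Fin d)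
    (β : N.bulkSites 0 Set.univ → Fin d) :
    N.bulkMatrix 0 b' β = contraction N (N.ball 0) ∅ (N.boundaryLegs 0 Set.univ) b'
      (fun s => absurd s.2 (Finset.notMem_empty _),
        resLabels (N.ball_zero_bulk).superset β) := by
  classical
  unfold Network.bulkMatrix contraction
  rw [Matrix.of_apply, Matrix.of_apply]
  congr 1
  refine Finset.sum_congr rfl fun x _ => ?_
  have h : Agree x (fun s : (∅ : Finset (Sym2 (Chamber p q))) =>
      (absurd s.2 (Finset.notMem_empty _) : Fin d)) := fun s _ hs => absurd hs (Finset.notMem_empty _)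
  simp only [h, true_and]
  rfl

end Truncation

/-! ### Pushing through the truncated network -/

section Homs

variable {X X' Y Z : Type} [Fintype X] [DecidableEq X] [Fintype X'] [DecidableEq X'] [Fintype Y]
  [DecidableEq Y] [Fintype Z] [DecidableEq Z]

/-- `B ↦ B ⊗ 1`. -/
def kroneckerOneHom (X Z : Type) [Fintype X] [DecidableEq X] [Fintype Z] [DecidableEq Z] :
    Matrix X X ℂ →⋆ₐ[ℂ] Matrix (X × Z) (X × Z) ℂ where
  toFun B := B ⊗ₖ 1
  map_one' := by simp
  map_mul' A B := by rw [← Matrix.mul_kronecker_mul, one_mul]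
  map_zero' := by simp
  map_add' A B := by rw [Matrix.add_kronecker]
  commutes' c := by
    rw [Algebra.algebraMap_eq_smul_one, Algebra.algebraMap_eq_smul_one, Matrix.smul_kronecker,
      Matrix.one_kronecker_one]
  map_star' A := by
    simp [Matrix.star_eq_conjTranspose, Matrix.conjTranspose_kronecker]

/-- Relabelling of the indices. -/
def reindexHom (e : X ≃ Y) : Matrix X X ℂ →⋆ₐ[ℂ] Matrix Y Y ℂ where
  toFun B := B.submatrix e.symm e.symm
  map_one' := by simp
  map_mul' A B := by rw [Matrix.submatrix_mul_equiv]
  map_zero' := by simp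
  map_add' A B := rfl
  commutes' c := by
    rw [Algebra.algebraMap_eq_smul_one, Algebra.algebraMap_eq_smul_one]
    ext y y'
    simp [Matrix.one_apply]
  map_star' A := by simp [Matrix.star_eq_conjTranspose, Matrix.conjTranspose_submatrix]

/-- `φ ⊗ id`: apply `φ` to the blocks of a matrix. -/
def blockHom (Z : Type) [Fintype Z] [DecidableEq Z] (φ : Matrix X X ℂ →⋆ₐ[ℂ] Matrix X' X' ℂ) :
    Matrix (X × Z) (X × Z) ℂ →⋆ₐ[ℂ] Matrix (X' × Z) (X' × Z) ℂ where
  toFun A := Matrix.of fun i j => φ (Matrix.of fun x y => A (x, i.2) (y, j.2)) i.1 j.1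
  map_one' := by
    ext ⟨x, z⟩ ⟨y, w⟩
    have : (Matrix.of fun x y : X => (1 : Matrix (X × Z) (X × Z) ℂ) (x, z) (y, w)) =
        if z = w then 1 else 0 := by
      ext x y
      by_cases h : z = w <;> simp [Matrix.one_apply, h]
    rw [Matrix.of_apply, this]
    by_cases h : z = w <;> simp [h, Matrix.one_apply]
  map_mul' A B := by
    ext ⟨x, z⟩ ⟨y, w⟩
    have : (Matrix.of fun x y : X => (A * B) (x, z) (y, w)) =
        ∑ v, (Matrix.of fun x y : X => A (x, z) (y, v)) * Matrix.of fun x y : X => B (x, v) (y, w) := by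
      ext x y
      simp only [Matrix.of_apply, Matrix.mul_apply, Fintype.sum_prod_type, Matrix.sum_apply]
      exact Finset.sum_comm
    rw [Matrix.of_apply, this, map_sum, Matrix.sum_apply]
    simp only [map_mul, Matrix.mul_apply, Fintype.sum_prod_type, Matrix.of_apply]
    exact Finset.sum_comm
  map_zero' := by
    ext i j
    have : (Matrix.of fun x y : X => (0 : Matrix (X × Z) (X × Z) ℂ) (x, i.2) (y, j.2)) = 0 := by
      ext x y; simp
    rw [Matrix.of_apply, this]
    simp
  map_add' A B := by
    ext i j
    have : (Matrix.of fun x y : X => (A + B) (x, i.2) (y, j.2)) =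
        (Matrix.of fun x y : X => A (x, i.2) (y, j.2)) +
          Matrix.of fun x y : X => B (x, i.2) (y, j.2) := by
      ext x y; simp
    rw [Matrix.of_apply, this, map_add]
    rfl
  commutes' c := by
    ext ⟨x, z⟩ ⟨y, w⟩
    have : (Matrix.of fun x y : X => (algebraMap ℂ (Matrix (X × Z) (X × Z) ℂ) c) (x, z) (y, w)) =
        if z = w then algebraMap ℂ _ c else 0 := by
      ext x y
      by_cases h : z = w <;> simp [Matrix.algebraMap_matrix_apply, h]
    rw [Matrix.of_apply, this]
    by_cases h : z = w
    · rw [if_pos h, AlgHomClass.commutes]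
      simp [Matrix.algebraMap_matrix_apply, h]
    · simp [h, Matrix.algebraMap_matrix_apply]
  map_star' A := by
    ext i j
    have : (Matrix.of fun x y : X => (star A) (x, i.2) (y, j.2)) =
        star (Matrix.of fun x y : X => A (x, j.2) (y, i.2)) := by
      ext x y; simp [Matrix.star_apply]
    rw [Matrix.of_apply, this, map_star]
    simp [Matrix.star_apply]

theorem blockHom_apply (φ : Matrix X X ℂ →⋆ₐ[ℂ] Matrix X' X' ℂ) (A : Matrix (X × Z) (X × Z) ℂ)
    (i j : X' × Z) :
    blockHom Z φ A i j = φ (Matrix.of fun x y => A (x, i.2) (y, j.2)) i.1 j.1 := rfl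

theorem blockHom_kroneckerOneHom (φ : Matrix X X ℂ →⋆ₐ[ℂ] Matrix X' X' ℂ) (A : Matrix X X ℂ) :
    blockHom Z φ (kroneckerOneHom X Z A) = kroneckerOneHom X' Z (φ A) := by
  ext ⟨x, z⟩ ⟨y, w⟩
  have : (Matrix.of fun x y : X => kroneckerOneHom X Z A (x, z) (y, w)) =
      if z = w then A else 0 := by
    ext x y
    change (A ⊗ₖ (1 : Matrix Z Z ℂ)) (x, z) (y, w) = _
    by_cases h : z = w <;> simp [h]
  rw [blockHom_apply, this]
  change _ = (φ A ⊗ₖ (1 : Matrix Z Z ℂ)) (x, z) (y, w)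
  by_cases h : z = w <;> simp [h]

/-- Pushing an operator through `u ⊗ 1`, where `u` intertwines `φ A` and `A`: if `β` labels the pairs of
an input `res β` of `u` and a label `sh β` of further legs, then `u ⊗ 1` intertwines `(φ ⊗ id) A`
and `A`. -/
theorem ampl_blockHom_mul {Yb Zb Yc Zc G N Zg W XW Zw : Type} [Fintype Yb] [Fintype Zb]
    [DecidableEq Zb] [Fintype Yc] [Fintype Zc] [DecidableEq Zc] [Fintype G] [DecidableEq G]
    [Fintype N] [DecidableEq N] [Fintype Zg] [DecidableEq Zg] [Fintype W] [Fintype XW]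
    [DecidableEq XW] [Fintype Zw] [DecidableEq Zw]
    (eB : Yb ≃ X' × Zb) (eC : Yc ≃ X × Zc) (eG : G ≃ N × Zg) (eW : W ≃ XW × Zw) (eN : XW ≃ X × N)
    (res : W → Yc) (sh : W → G) (hW : ∀ β, (eW β).1 = eN.symm ((eC (res β)).1, (eG (sh β)).1))
    (hres : ∀ x n β, res (eW.symm (eN.symm (x, n), (eW β).2)) = eC.symm (x, (eC (res β)).2))
    (hsh : ∀ x n β, sh (eW.symm (eN.symm (x, n), (eW β).2)) = eG.symm (n, (eG (sh β)).2))
    (u : Matrix Yb Yc ℂ) (φ : Matrix X X ℂ →⋆ₐ[ℂ] Matrix X' X' ℂ)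
    (hφ : ∀ A, ampl eB (φ A) * u = u * ampl eC A) (A : Matrix XW XW ℂ) :
    ampl ((eB.prodCongr eG).trans (Equiv.prodProdProdComm _ _ _ _))
        (blockHom N φ (reindexHom eN A)) *
        (Matrix.of fun y β => if y.2 = sh β then u y.1 (res β) else 0 : Matrix (Yb × G) W ℂ) =
      (Matrix.of fun y β => if y.2 = sh β then u y.1 (res β) else 0 : Matrix (Yb × G) W ℂ) *
        ampl eW A := by
  ext ⟨b, γ⟩ β
  -- the block of `A` between the labels `γ` and `sh β` of the new bulk legs
  let A' : Matrix X X ℂ := Matrix.of fun x y => A (eN.symm (x, (eG γ).1)) (eN.symm (y, (eG (sh β)).1))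
  have key := congrFun (congrFun (hφ A') b) (res β)
  rw [ampl_mul_apply, mul_ampl_apply] at key
  rw [ampl_mul_apply, mul_ampl_apply, ← eN.symm.sum_comp, Fintype.sum_prod_type,
    Fintype.sum_prod_type]
  have hg : ∀ n, γ = eG.symm (n, (eG (sh β)).2) ↔ n = (eG γ).1 ∧ (eG γ).2 = (eG (sh β)).2 := by
    intro n
    rw [Equiv.eq_symm_apply, Prod.ext_iff]
    exact and_congr_left fun _ => eq_comm
  have hg' : ∀ n, eG.symm (n, (eG γ).2) = sh β ↔ n = (eG (sh β)).1 ∧ (eG γ).2 = (eG (sh β)).2 := by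
    intro n
    rw [Equiv.symm_apply_eq, Prod.ext_iff]
  simp only [Equiv.trans_apply, Equiv.symm_trans_apply, Equiv.prodCongr_apply, Prod.map,
    Equiv.prodProdProdComm_apply, Equiv.prodProdProdComm_symm, Equiv.prodCongr_symm,
    Matrix.of_apply, hres, hsh, hg, hg', hW β]
  by_cases h : (eG γ).2 = (eG (sh β)).2
  · simp only [h, and_true, mul_ite, ite_mul, mul_zero, zero_mul, Finset.sum_ite_eq',
      Finset.mem_univ, if_true]
    exact key
  · simp [h]

end Homs

section Maps

variable {p q d : ℕ} [NeZero p] [NeZero q] (N : Network p q d) {R : Set (Chamber p q)}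

/-- The new bulk sites of the region `R` in layer `Λ + 1`. -/
abbrev Network.newBulk (R : Set (Chamber p q)) (Λ : ℕ) : Finset (Chamber p q × Fin (q - 1)) :=
  N.bulkSites (Λ + 1) R \ N.bulkSites Λ R

theorem Network.newBulk_subset (R : Set (Chamber p q)) (Λ : ℕ) :
    N.newBulk R Λ ⊆ bulkOf (N.shell Λ) := by
  intro s hs
  obtain ⟨h1, h2⟩ := Finset.mem_sdiff.1 hs
  rw [N.mem_bulkSites] at h1 h2
  exact Finset.mem_product.2 ⟨Finset.mem_sdiff.2 ⟨h1.1, fun h => h2 ⟨h, h1.2⟩⟩, Finset.mem_univ _⟩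

theorem Network.newBulk_mem (Λ : ℕ) : ∀ s ∈ N.newBulk R Λ, s.1 ∈ R := fun _ hs =>
  (N.mem_bulkSites.1 (Finset.mem_sdiff.1 hs).1).2

theorem amplifyMatrix_eq_ampl {α : Type} [DecidableEq α] {A B : Finset α} (h : A ⊆ B)
    (M : Matrix (A → Fin d) (A → Fin d) ℂ) : amplifyMatrix d h M = ampl (splitLabels h) M := rfl

/-- The matrix of `u ⊗ 1`, where `u` is the bulk-to-boundary map at `Λ` and the identity acts on the bulk
legs of layer `Λ + 1`. -/
def Network.bulkTensorOne (Λ : ℕ) :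
    Matrix ((N.boundaryLegs Λ Set.univ → Fin d) × (bulkOf (N.shell Λ) → Fin d))
      (N.bulkSites (Λ + 1) Set.univ → Fin d) ℂ :=
  Matrix.of fun y β => if y.2 = resLabels (N.shell_bulk_subset Λ) β then
    N.bulkMatrix Λ y.1 (resLabels (N.bulkSites_mono Λ Set.univ) β) else 0

theorem Network.bulkMatrix_succ_eq_mul (Λ : ℕ) :
    N.bulkMatrix (Λ + 1) = N.layerContraction Λ * N.bulkTensorOne Λ := by
  ext b' β
  rw [N.bulkMatrix_succ, Matrix.mul_apply, Fintype.sum_prod_type]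
  refine Finset.sum_congr rfl fun b _ => ?_
  simp [Network.bulkTensorOne]

/-- If `φ` pushes operators of the bulk of `R` through the truncation at `Λ`, and `Q` pushes through layer
`Λ + 1`, then `Q ∘ (φ ⊗ id)` pushes operators through the truncation at `Λ + 1`. -/
theorem Network.matrix_step (Λ : ℕ)
    (Q : Matrix ((N.boundaryLegs Λ R → Fin d) × (N.newBulk R Λ → Fin d))
      ((N.boundaryLegs Λ R → Fin d) × (N.newBulk R Λ → Fin d)) ℂ →⋆ₐ[ℂ]
      Matrix (N.boundaryLegs (Λ + 1) R → Fin d) (N.boundaryLegs (Λ + 1) R → Fin d) ℂ)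
    (hQ : ∀ B, ampl (splitLabels (N.boundaryLegs_subset (Λ + 1) R)) (Q B) * N.layerContraction Λ =
      N.layerContraction Λ * ampl (pairSplit (N.boundaryLegs_subset Λ R) (N.newBulk_subset R Λ)) B)
    (φ : Matrix (N.bulkSites Λ R → Fin d) (N.bulkSites Λ R → Fin d) ℂ →⋆ₐ[ℂ]
      Matrix (N.boundaryLegs Λ R → Fin d) (N.boundaryLegs Λ R → Fin d) ℂ)
    (hφ : ∀ A, ampl (splitLabels (N.boundaryLegs_subset Λ R)) (φ A) * N.bulkMatrix Λ =
      N.bulkMatrix Λ * ampl (splitLabels (N.bulkSites_subset Λ R)) A)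
    (A : Matrix (N.bulkSites (Λ + 1) R → Fin d) (N.bulkSites (Λ + 1) R → Fin d) ℂ) :
    ampl (splitLabels (N.boundaryLegs_subset (Λ + 1) R))
        (Q (blockHom _ φ (reindexHom (splitLabels (N.bulkSites_mono Λ R)) A))) *
        N.bulkMatrix (Λ + 1) =
      N.bulkMatrix (Λ + 1) * ampl (splitLabels (N.bulkSites_subset (Λ + 1) R)) A := by
  rw [N.bulkMatrix_succ_eq_mul, ← Matrix.mul_assoc, hQ, Matrix.mul_assoc, Matrix.mul_assoc]
  refine congrArg _ ?_
  refine ampl_blockHom_mul _ _ (splitLabels (N.newBulk_subset R Λ)) _ _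
    (resLabels (N.bulkSites_mono Λ Set.univ)) (resLabels (N.shell_bulk_subset Λ)) ?_ ?_ ?_ _ φ hφ A
  · intro β
    rw [Equiv.eq_symm_apply]
    rfl
  · intro x n β
    rw [Equiv.eq_symm_apply]
    refine Prod.ext (funext fun s => ?_) (funext fun s => ?_)
    · simp [splitLabels, resLabels, N.bulkSites_mono Λ R s.2]
    · have hs := Finset.mem_sdiff.1 s.2
      have h1 : s.1 ∉ N.bulkSites (Λ + 1) R := fun h => hs.2 (N.mem_bulkSites.2
        ⟨(N.mem_bulkSites.1 hs.1).1, (N.mem_bulkSites.1 h).2⟩)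
      simp [splitLabels, resLabels, h1]
  · intro x n β
    rw [Equiv.eq_symm_apply]
    refine Prod.ext (funext fun s => ?_) (funext fun s => ?_)
    · have hs := Finset.mem_sdiff.1 s.2
      simp [splitLabels, resLabels, hs.1, hs.2]
    · have hs := Finset.mem_sdiff.1 s.2
      have h0 := Finset.mem_sdiff.1 (Finset.mem_product.1 hs.1).1
      have h1 : s.1 ∉ N.bulkSites (Λ + 1) R := fun h => hs.2 (Finset.mem_sdiff.2 ⟨h,
        fun h' => h0.2 (N.mem_bulkSites.1 h').1⟩)
      simp [splitLabels, resLabels, h1]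

end Maps

/-! ### Bulk-to-boundary and boundary-to-boundary maps at finite cutoff -/

section Pushing

variable {p q d : ℕ} [NeZero p] [NeZero q] (N : Network p q d) {R : Set (Chamber p q)}

theorem reindexHom_amplifyMatrix {α : Type} [DecidableEq α] {A B : Finset α} (h : A ⊆ B)
    (M : Matrix (A → Fin d) (A → Fin d) ℂ) :
    reindexHom (splitLabels h) (amplifyMatrix d h M) = kroneckerOneHom _ _ M := by
  ext x y
  change (M ⊗ₖ (1 : Matrix _ _ ℂ)) (splitLabels h ((splitLabels h).symm x))
    (splitLabels h ((splitLabels h).symm y)) = _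
  rw [Equiv.apply_symm_apply, Equiv.apply_symm_apply]
  rfl

/-- The center, as a layer without ingoing links. -/
theorem Network.exists_hom_zero [NeZero d] (hp : 5 ≤ p) (hq : 3 ≤ q) (hR : IsRegion N.center R) :
    ∃ φ : Matrix (N.bulkSites 0 R → Fin d) (N.bulkSites 0 R → Fin d) ℂ →⋆ₐ[ℂ]
        Matrix (N.boundaryLegs 0 R → Fin d) (N.boundaryLegs 0 R → Fin d) ℂ,
      ∀ A, ampl (splitLabels (N.boundaryLegs_subset 0 R)) (φ A) * N.bulkMatrix 0 =
        N.bulkMatrix 0 * ampl (splitLabels (N.bulkSites_subset 0 R)) A := by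
  have hb : N.bulkSites 0 R ⊆ bulkOf (N.ball 0) :=
    (N.bulkSites_subset 0 R).trans N.ball_zero_bulk.subset
  obtain ⟨P, hP⟩ := N.isLayer_ball_zero.exists_push N hp hq hR hb
    (fun s hs => (N.mem_bulkSites.1 hs).2) (Finset.Subset.refl _) (N.boundaryLegs_subset 0 R)
  let e : (N.bulkSites 0 R → Fin d) ≃
      ((∅ : Finset (Sym2 (Chamber p q))) → Fin d) × (N.bulkSites 0 R → Fin d) :=
    (Equiv.uniqueProd _ _).symm
  refine ⟨P.comp (reindexHom e), fun A => ?_⟩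
  ext b β
  have key := congrFun (congrFun (hP (reindexHom e A)) b)
    (fun s => absurd s.2 (Finset.notMem_empty _), resLabels N.ball_zero_bulk.superset β)
  rw [ampl_mul_apply, mul_ampl_apply, ← e.sum_comp] at key
  rw [ampl_mul_apply, mul_ampl_apply]
  simp only [N.bulkMatrix_zero]
  refine key.trans (Finset.sum_congr rfl fun x _ => ?_)
  congr 1

/-- The homomorphisms at finite cutoff, on matrices: `k` pushes `B ⊗ 1` through a layer, and `φ` is
built by recursion. -/
theorem Network.exists_matrix_homs [NeZero d] (hp : 5 ≤ p) (hq : 3 ≤ q)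
    (hR : IsRegion N.center R) :
    ∃ (φ : ∀ Λ, Matrix (N.bulkSites Λ R → Fin d) (N.bulkSites Λ R → Fin d) ℂ →⋆ₐ[ℂ]
        Matrix (N.boundaryLegs Λ R → Fin d) (N.boundaryLegs Λ R → Fin d) ℂ)
      (k : ∀ Λ, Matrix (N.boundaryLegs Λ R → Fin d) (N.boundaryLegs Λ R → Fin d) ℂ →⋆ₐ[ℂ]
        Matrix (N.boundaryLegs (Λ + 1) R → Fin d) (N.boundaryLegs (Λ + 1) R → Fin d) ℂ),
      (∀ Λ A, ampl (splitLabels (N.boundaryLegs_subset Λ R)) (φ Λ A) * N.bulkMatrix Λ =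
        N.bulkMatrix Λ * ampl (splitLabels (N.bulkSites_subset Λ R)) A) ∧
      (∀ Λ χ B, ampl (splitLabels (N.boundaryLegs_subset (Λ + 1) R)) (k Λ B) *
          N.layerMatrix Λ χ =
        N.layerMatrix Λ χ * ampl (splitLabels (N.boundaryLegs_subset Λ R)) B) ∧
      ∀ Λ A, k Λ (φ Λ A) = φ (Λ + 1) (amplifyMatrix d (N.bulkSites_mono Λ R) A) := by
  have hpush := fun Λ => (N.isLayer_shell Λ).exists_push N hp hq hR (N.newBulk_subset R Λ)
    (N.newBulk_mem Λ) (N.boundaryLegs_subset Λ R) (N.boundaryLegs_subset (Λ + 1) R)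
  choose P hP using hpush
  obtain ⟨φ₀, hφ₀⟩ := N.exists_hom_zero hp hq hR
  let φ : ∀ Λ, Matrix (N.bulkSites Λ R → Fin d) (N.bulkSites Λ R → Fin d) ℂ →⋆ₐ[ℂ]
      Matrix (N.boundaryLegs Λ R → Fin d) (N.boundaryLegs Λ R → Fin d) ℂ := fun Λ =>
    Nat.rec φ₀ (fun Λ f => ((P Λ).comp (blockHom _ f)).comp
      (reindexHom (splitLabels (N.bulkSites_mono Λ R)))) Λ
  have hφ : ∀ Λ A, ampl (splitLabels (N.boundaryLegs_subset Λ R)) (φ Λ A) * N.bulkMatrix Λ =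
      N.bulkMatrix Λ * ampl (splitLabels (N.bulkSites_subset Λ R)) A := by
    intro Λ
    induction Λ with
    | zero => exact hφ₀
    | succ Λ ih => exact N.matrix_step Λ (P Λ) (hP Λ) (φ Λ) ih
  refine ⟨φ, fun Λ => (P Λ).comp (kroneckerOneHom _ _), hφ, fun Λ χ B => ?_, fun Λ A => ?_⟩
  · ext b' b
    rw [ampl_mul_apply, mul_ampl_apply]
    simp only [Network.layerMatrix, Matrix.of_apply, Finset.mul_sum, Finset.sum_mul]
    rw [Finset.sum_comm]
    nth_rewrite 2 [Finset.sum_comm]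
    refine Finset.sum_congr rfl fun β _ => ?_
    have key := congrFun (congrFun (hP Λ (kroneckerOneHom _ _ B)) b') (b, β)
    rw [ampl_mul_apply, mul_ampl_apply, Fintype.sum_prod_type] at key
    have h1 : ∀ (x : N.boundaryLegs Λ R → Fin d) (y : N.newBulk R Λ → Fin d),
        kroneckerOneHom _ (N.newBulk R Λ → Fin d) B (x, y)
          (pairSplit (N.boundaryLegs_subset Λ R) (N.newBulk_subset R Λ) (b, β)).1 =
        if y = (splitLabels (N.newBulk_subset R Λ) β).1 then
          B x (splitLabels (N.boundaryLegs_subset Λ R) b).1 else 0 := by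
      intro x y
      change B x _ * (1 : Matrix _ _ ℂ) y _ = _
      rw [Matrix.one_apply, mul_ite, mul_one, mul_zero]
      rfl
    have h2 : ∀ x : N.boundaryLegs Λ R → Fin d,
        (pairSplit (N.boundaryLegs_subset Λ R) (N.newBulk_subset R Λ)).symm
          ((x, (splitLabels (N.newBulk_subset R Λ) β).1),
            (pairSplit (N.boundaryLegs_subset Λ R) (N.newBulk_subset R Λ) (b, β)).2) =
        ((splitLabels (N.boundaryLegs_subset Λ R)).symm
          (x, (splitLabels (N.boundaryLegs_subset Λ R) b).2), β) := by
      intro x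
      rw [Equiv.symm_apply_eq]
      simp [pairSplit]
    simp only [h1, mul_ite, mul_zero, Finset.sum_ite_eq', Finset.mem_univ, if_true, h2] at key
    have h3 := congrArg (· * χ β) key
    simp only [Finset.sum_mul] at h3
    simp only [← mul_assoc]
    refine h3.trans (Finset.sum_congr rfl fun x _ => mul_right_comm _ _ _)
  · change P Λ (kroneckerOneHom _ _ (φ Λ A)) = P Λ (blockHom _ (φ Λ) (reindexHom _ _))
    rw [reindexHom_amplifyMatrix, blockHom_kroneckerOneHom]

/-- The star isomorphism between matrices and operators. -/
abbrev opEquiv (d : ℕ) {α : Type} [DecidableEq α] (X : Finset α) :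
    Matrix (X → Fin d) (X → Fin d) ℂ ≃⋆ₐ[ℂ] Op d X :=
  Matrix.toEuclideanCLM (n := X → Fin d) (𝕜 := ℂ)

/-- The homomorphism of operators given by a homomorphism of matrices. -/
def opHom {α β : Type} [DecidableEq α] [DecidableEq β] {X : Finset α} {Y : Finset β}
    (φ : Matrix (X → Fin d) (X → Fin d) ℂ →⋆ₐ[ℂ] Matrix (Y → Fin d) (Y → Fin d) ℂ) :
    Op d X →⋆ₐ[ℂ] Op d Y :=
  ((opEquiv d Y : _ →⋆ₐ[ℂ] Op d Y).comp φ).comp ((opEquiv d X).symm : Op d X →⋆ₐ[ℂ] _)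

theorem opHom_apply {α β : Type} [DecidableEq α] [DecidableEq β] {X : Finset α} {Y : Finset β}
    (φ : Matrix (X → Fin d) (X → Fin d) ℂ →⋆ₐ[ℂ] Matrix (Y → Fin d) (Y → Fin d) ℂ)
    (M : Matrix (X → Fin d) (X → Fin d) ℂ) : opHom φ (opEquiv d X M) = opEquiv d Y (φ M) := by
  change opEquiv d Y (φ ((opEquiv d X).symm (opEquiv d X M))) = _
  rw [StarAlgEquiv.symm_apply_apply]

theorem amplify_toEuclideanLin {α β : Type} [DecidableEq α] [DecidableEq β] {X X' : Finset α}
    {Y Y' : Finset β} (h : X ⊆ X') (k : Y ⊆ Y')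
    (φ : Matrix (X → Fin d) (X → Fin d) ℂ →⋆ₐ[ℂ] Matrix (Y → Fin d) (Y → Fin d) ℂ)
    (C : Matrix (Y' → Fin d) (X' → Fin d) ℂ)
    (hC : ∀ A, ampl (splitLabels k) (φ A) * C = C * ampl (splitLabels h) A)
    (A : Op d X) (ψ : Qudits d X') :
    amplify d k (opHom φ A) (Matrix.toEuclideanLin C ψ) =
      Matrix.toEuclideanLin C (amplify d h A ψ) := by
  obtain ⟨M, rfl⟩ := EquivLike.surjective (opEquiv d X) A
  have h1 : amplify d h (opEquiv d X M) = opEquiv d X' (ampl (splitLabels h) M) :=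
    opHom_apply (amplifyMatrix d h) M
  have h2 : amplify d k (opEquiv d Y (φ M)) = opEquiv d Y' (ampl (splitLabels k) (φ M)) :=
    opHom_apply (amplifyMatrix d k) (φ M)
  rw [opHom_apply, h1, h2]
  change WithLp.toLp 2 (Matrix.mulVec _ (Matrix.mulVec _ _)) =
    WithLp.toLp 2 (Matrix.mulVec _ (Matrix.mulVec _ _))
  rw [Matrix.mulVec_mulVec, Matrix.mulVec_mulVec, hC]
  rfl

/-- The bulk-to-boundary maps `ι` and the boundary-to-boundary maps `κ` of a region. -/
theorem Network.exists_homs [NeZero d] (hp : 5 ≤ p) (hq : 3 ≤ q)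
    (hR : IsRegion N.center R) :
    ∃ (ι : ∀ Λ, N.ACode R Λ →⋆ₐ[ℂ] N.APhys R Λ) (κ : ∀ Λ, N.APhys R Λ →⋆ₐ[ℂ] N.APhys R (Λ + 1)),
      (∀ Λ A ψ, N.physAct R Λ (ι Λ A) (N.bulkToBoundary Λ ψ) =
        N.bulkToBoundary Λ (N.codeAct R Λ A ψ)) ∧
      (∀ Λ χ B ψ, N.physAct R (Λ + 1) (κ Λ B) (N.layerMap Λ χ ψ) =
        N.layerMap Λ χ (N.physAct R Λ B ψ)) ∧
      ∀ Λ A, κ Λ (ι Λ A) = ι (Λ + 1) (N.codeAlgStep R Λ A) := by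
  obtain ⟨φ, k, h1, h2, h3⟩ := N.exists_matrix_homs hp hq hR
  refine ⟨fun Λ => opHom (φ Λ), fun Λ => opHom (k Λ), fun Λ A ψ => ?_, fun Λ χ B ψ => ?_,
    fun Λ A => ?_⟩
  · rw [N.bulkToBoundary_eq]
    exact amplify_toEuclideanLin _ _ _ _ (h1 Λ) A ψ
  · rw [N.layerMap_eq]
    exact amplify_toEuclideanLin _ _ _ _ (h2 Λ χ) B ψ
  · obtain ⟨M, rfl⟩ := EquivLike.surjective (opEquiv d _) A
    have h4 : N.codeAlgStep R Λ (opEquiv d _ M) = opEquiv d _ (amplifyMatrix d _ M) :=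
      opHom_apply (amplifyMatrix d (N.bulkSites_mono Λ R)) M
    simp only [h4, opHom_apply, h3]

end Pushing

/-! ### Isometries between the truncated spaces -/

section Isometries

variable {p q d : ℕ} [NeZero p] [NeZero q] (N : Network p q d)

theorem norm_toEuclideanLin {X Y : Type} [Fintype X] [DecidableEq X] [Fintype Y] [DecidableEq Y]
    {C : Matrix Y X ℂ} (hC : C.conjTranspose * C = 1) (ψ : EuclideanSpace ℂ X) :
    ‖Matrix.toEuclideanLin C ψ‖ = ‖ψ‖ := by
  have h : inner ℂ (Matrix.toEuclideanLin C ψ) (Matrix.toEuclideanLin C ψ) = inner ℂ ψ ψ := by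
    rw [← LinearMap.adjoint_inner_left, ← Matrix.toEuclideanLin_conjTranspose_eq_adjoint]
    congr 1
    change WithLp.toLp 2 (Matrix.mulVec _ (Matrix.mulVec _ _)) = _
    rw [Matrix.mulVec_mulVec, hC, Matrix.one_mulVec]
    rfl
  rw [norm_eq_sqrt_re_inner (𝕜 := ℂ), h, ← norm_eq_sqrt_re_inner]

theorem Network.newBulk_univ (Λ : ℕ) : N.newBulk Set.univ Λ = bulkOf (N.shell Λ) := by
  ext s
  rw [Finset.mem_sdiff, N.mem_bulkSites, N.mem_bulkSites]
  simp [Network.shell]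

theorem sum_resLabels {α : Type} [DecidableEq α] {A B C : Finset α} (hA : A ⊆ B) (hC : B \ A = C)
    (hCB : C ⊆ B) (f : (A → Fin d) → (C → Fin d) → ℂ) :
    ∑ y : B → Fin d, f (resLabels hA y) (resLabels hCB y) = ∑ x, ∑ z, f x z := by
  subst hC
  rw [← Fintype.sum_prod_type']
  exact (splitLabels hA).sum_comp (fun z => f z.1 z.2)

theorem resLabels_eq_iff {α : Type} [DecidableEq α] {A B C : Finset α} (hA : A ⊆ B)
    (hC : B \ A = C) (hCB : C ⊆ B) (y y' : B → Fin d) :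
    y = y' ↔ resLabels hA y = resLabels hA y' ∧ resLabels hCB y = resLabels hCB y' := by
  subst hC
  rw [← (splitLabels hA).injective.eq_iff, Prod.ext_iff]
  rfl

/-- By induction: `u` at `Λ + 1` is `u ⊗ 1` followed by the isometry of layer `Λ + 1`. -/
theorem Network.bulkMatrix_isometry [NeZero d] (hp : 5 ≤ p) (hq : 3 ≤ q) (Λ : ℕ) :
    (N.bulkMatrix Λ).conjTranspose * N.bulkMatrix Λ = 1 := by
  induction Λ with
  | zero =>
    ext β β'
    have key := congrFun (congrFun (N.isLayer_ball_zero.contraction_isometry N hp hq)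
      (fun s => absurd s.2 (Finset.notMem_empty _), resLabels N.ball_zero_bulk.superset β))
      (fun s => absurd s.2 (Finset.notMem_empty _), resLabels N.ball_zero_bulk.superset β')
    rw [Matrix.mul_apply] at key ⊢
    simp only [Matrix.conjTranspose_apply, N.bulkMatrix_zero]
    refine key.trans ?_
    rw [Matrix.one_apply, Matrix.one_apply]
    congr 1
    refine propext ⟨fun h => ?_, fun h => by rw [h]⟩
    funext s
    exact congrFun (congrArg Prod.snd h) ⟨s.1, N.ball_zero_bulk.subset s.2⟩
  | succ Λ ih =>
    have hC : (N.layerContraction Λ).conjTranspose * N.layerContraction Λ = 1 :=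
      (N.isLayer_shell Λ).contraction_isometry N hp hq
    rw [N.bulkMatrix_succ_eq_mul, Matrix.conjTranspose_mul, Matrix.mul_assoc,
      ← Matrix.mul_assoc _ _ (N.bulkTensorOne Λ), hC, Matrix.one_mul]
    ext β β'
    have key := congrFun (congrFun ih (resLabels (N.bulkSites_mono Λ Set.univ) β))
      (resLabels (N.bulkSites_mono Λ Set.univ) β')
    rw [Matrix.mul_apply] at key
    rw [Matrix.mul_apply, Fintype.sum_prod_type, Matrix.one_apply]
    simp only [resLabels_eq_iff (N.bulkSites_mono Λ Set.univ) (N.newBulk_univ Λ)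
      (N.shell_bulk_subset Λ) β β', Network.bulkTensorOne, Matrix.conjTranspose_apply, Matrix.of_apply] at key ⊢
    rw [Finset.sum_comm, Finset.sum_eq_single (resLabels (N.shell_bulk_subset Λ) β)]
    · by_cases h : resLabels (N.shell_bulk_subset Λ) β = resLabels (N.shell_bulk_subset Λ) β'
      · simp only [h, if_true, and_true]
        rw [key, Matrix.one_apply]
      · simp [h]
    · intro γ _ hγ
      simp [hγ]
    · simp

theorem Network.norm_bulkToBoundary [NeZero d] (hp : 5 ≤ p) (hq : 3 ≤ q) (Λ : ℕ) (ψ : N.HCode Λ) :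
    ‖N.bulkToBoundary Λ ψ‖ = ‖ψ‖ :=
  norm_toEuclideanLin (N.bulkMatrix_isometry hp hq Λ) ψ

theorem sum_productState {α : Type} [DecidableEq α] (v : EuclideanSpace ℂ (Fin d)) (hv : ‖v‖ = 1)
    (X : Finset α) : ∑ x, star (productState v X x) * productState v X x = 1 := by
  have h1 : ∑ i, star (v i) * v i = 1 := by
    have := congrArg (fun r : ℝ => (r : ℂ)) (EuclideanSpace.norm_sq_eq v)
    rw [hv] at this
    push_cast at this
    rw [one_pow] at this
    rw [this]
    exact Finset.sum_congr rfl fun i _ => Complex.conj_mul' _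
  have h2 := Finset.prod_univ_sum (fun _ : X => (Finset.univ : Finset (Fin d)))
    (fun _ i => star (v i) * v i)
  simp only [h1, Finset.prod_const_one, Fintype.piFinset_univ] at h2
  rw [h2]
  refine Finset.sum_congr rfl fun x _ => ?_
  simp only [productState, star_prod, Finset.prod_mul_distrib]

theorem Network.norm_physStep [NeZero d] (hp : 5 ≤ p) (hq : 3 ≤ q) (Λ : ℕ) (ψ : N.HPhys Λ) :
    ‖N.physStep Λ ψ‖ = ‖ψ‖ := by
  have h : N.physStep Λ = Matrix.toEuclideanLin (N.layerMatrix Λ (productState N.ref _)) :=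
    N.layerMap_eq Λ _
  rw [h]
  refine norm_toEuclideanLin ?_ ψ
  -- `V_χ = C K` with `K = 1 ⊗ χ`
  let K : Matrix ((N.boundaryLegs Λ Set.univ → Fin d) × (bulkOf (N.shell Λ) → Fin d))
    (N.boundaryLegs Λ Set.univ → Fin d) ℂ := Matrix.of fun y b =>
      if y.1 = b then productState N.ref (bulkOf (N.shell Λ)) y.2 else 0
  have hK : N.layerMatrix Λ (productState N.ref _) = N.layerContraction Λ * K := by
    ext b' b
    rw [Matrix.mul_apply, Fintype.sum_prod_type, Finset.sum_eq_single b]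
    · simp [K, Network.layerMatrix]
    · intro c _ hc
      simp [K, hc]
    · simp
  have hC : (N.layerContraction Λ).conjTranspose * N.layerContraction Λ = 1 :=
    (N.isLayer_shell Λ).contraction_isometry N hp hq
  rw [hK, Matrix.conjTranspose_mul, Matrix.mul_assoc, ← Matrix.mul_assoc _ _ K, hC, Matrix.one_mul]
  ext b b'
  rw [Matrix.mul_apply, Fintype.sum_prod_type, Finset.sum_eq_single b, Matrix.one_apply]
  · by_cases h : b = b'
    · simpa [K, h] using sum_productState N.ref N.norm_ref (bulkOf (N.shell Λ))
    · simp [K, h]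
  · intro c _ hc
    simp [K, hc]
  · simp

theorem productState_resLabels {α : Type} [DecidableEq α] {A B C : Finset α} (hA : A ⊆ B)
    (hC : B \ A = C) (hCB : C ⊆ B) (v : EuclideanSpace ℂ (Fin d)) (y : B → Fin d) :
    productState v (B \ A) (splitLabels hA y).2 = productState v C (resLabels hCB y) := by
  subst hC
  rfl

/-- The bulk-to-boundary maps are compatible with the embeddings into the next truncation. -/
theorem Network.bulkToBoundary_codeStep (Λ : ℕ) (ψ : N.HCode Λ) :
    N.bulkToBoundary (Λ + 1) (N.codeStep Λ ψ) = N.physStep Λ (N.bulkToBoundary Λ ψ) := by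
  have h : N.physStep Λ = Matrix.toEuclideanLin (N.layerMatrix Λ (productState N.ref _)) :=
    N.layerMap_eq Λ _
  rw [h, N.bulkToBoundary_eq, N.bulkToBoundary_eq]
  ext b'
  change ∑ β, N.bulkMatrix (Λ + 1) b' β * (ψ (resLabels (N.bulkSites_mono Λ Set.univ) β) *
    productState N.ref _ (splitLabels (N.bulkSites_mono Λ Set.univ) β).2) =
    ∑ b, N.layerMatrix Λ (productState N.ref _) b' b * ∑ β, N.bulkMatrix Λ b β * ψ β
  simp only [productState_resLabels _ (N.newBulk_univ Λ) (N.shell_bulk_subset Λ),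
    N.bulkMatrix_succ]
  rw [sum_resLabels (N.bulkSites_mono Λ Set.univ) (N.newBulk_univ Λ) (N.shell_bulk_subset Λ)
    (fun x z => (∑ b, N.layerContraction Λ b' (b, z) * N.bulkMatrix Λ b x) *
      (ψ x * productState N.ref (bulkOf (N.shell Λ)) z))]
  simp only [Network.layerMatrix, Matrix.of_apply, Finset.sum_mul, Finset.mul_sum]
  rw [Finset.sum_congr rfl fun _ _ => Finset.sum_comm, Finset.sum_comm]
  refine Finset.sum_congr rfl fun b _ => ?_
  rw [Finset.sum_comm]
  nth_rewrite 2 [Finset.sum_comm]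
  refine Finset.sum_congr rfl fun z _ => Finset.sum_congr rfl fun x _ => ?_
  ring

end Isometries

/-! ### Inductive limits of Hilbert spaces and of C⋆-algebras -/

section HilbertLimit

variable {E : ℕ → Type} [∀ n, NormedAddCommGroup (E n)] [∀ n, InnerProductSpace ℂ (E n)]

theorem range_subset_range_of_le {K : Type} [NormedAddCommGroup K] [InnerProductSpace ℂ K]
    {t : ∀ n, E n →ₗ[ℂ] E (n + 1)} {j : ∀ n, E n →ₗᵢ[ℂ] K}
    (hj : ∀ n ψ, j (n + 1) (t n ψ) = j n ψ) {m n : ℕ} (h : m ≤ n) :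
    Set.range (j m) ⊆ Set.range (j n) :=
  monotone_nat_of_le_succ (f := fun n => Set.range (j n)) (fun n => by
    rintro _ ⟨ψ, rfl⟩
    exact ⟨t n ψ, hj n ψ⟩) h

/-- A compatible sequence of isometries into a Hilbert space exhibits the closure of the union of their
ranges as the inductive limit. -/
theorem exists_isHilbertLimit_submodule {K : Type} [NormedAddCommGroup K] [InnerProductSpace ℂ K]
    [CompleteSpace K] {t : ∀ n, E n →ₗ[ℂ] E (n + 1)} (j : ∀ n, E n →ₗᵢ[ℂ] K)
    (hj : ∀ n ψ, j (n + 1) (t n ψ) = j n ψ) :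
    ∃ (S : Submodule ℂ K) (j' : ∀ n, E n →ₗᵢ[ℂ] S),
      IsHilbertLimit t j' ∧ ∀ n ψ, (j' n ψ : K) = j n ψ := by
  have hmono : Monotone fun n => LinearMap.range (j n).toLinearMap := fun m n h =>
    range_subset_range_of_le hj h
  let U : Submodule ℂ K := ⨆ n, LinearMap.range (j n).toLinearMap
  have hU : (U : Set K) = ⋃ n, Set.range (j n) :=
    Submodule.coe_iSup_of_directed _ hmono.directed_le
  have hmem : ∀ n ψ, j n ψ ∈ U.topologicalClosure := fun n ψ =>
    U.le_topologicalClosure (Submodule.mem_iSup_of_mem n ⟨ψ, rfl⟩)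
  let j' : ∀ n, E n →ₗᵢ[ℂ] U.topologicalClosure := fun n =>
    { toLinearMap := (j n).toLinearMap.codRestrict _ (hmem n)
      norm_map' := fun ψ => (j n).norm_map ψ }
  refine ⟨U.topologicalClosure, j', ⟨?_, fun n ψ => Subtype.ext (hj n ψ), ?_⟩, fun _ _ => rfl⟩
  · exact U.isClosed_topologicalClosure.completeSpace_coe
  · intro x
    rw [closure_subtype, Set.image_iUnion]
    have h : (⋃ n, (Subtype.val '' Set.range (j' n) : Set K)) = (U : Set K) := by
      rw [hU]
      refine Set.iUnion_congr fun n => ?_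
      rw [← Set.range_comp]
      rfl
    rw [h]
    exact x.2

variable [∀ n, CompleteSpace (E n)]

/-- The maps to `⨁ E n` (completed) that send a vector of `E (n + 1)` to the image of its component in
the range of `t n`, plus its component orthogonal to this range, placed in degree `n + 1`. -/
def limitMap (t : ∀ n, E n →ₗᵢ[ℂ] E (n + 1)) : ∀ n, E n →ₗ[ℂ] lp E 2
  | 0 => lp.lsingle 2 0
  | n + 1 =>
    let a : E (n + 1) →ₗ[ℂ] E n :=
      (ContinuousLinearMap.adjoint (t n).toContinuousLinearMap).toLinearMap
    (limitMap t n).comp a + (lp.lsingle 2 (n + 1)).comp (LinearMap.id - (t n).toLinearMap.comp a)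

theorem adjoint_apply_self {F G : Type} [NormedAddCommGroup F] [InnerProductSpace ℂ F]
    [CompleteSpace F] [NormedAddCommGroup G] [InnerProductSpace ℂ G] [CompleteSpace G]
    (t : F →ₗᵢ[ℂ] G) (x : F) : ContinuousLinearMap.adjoint t.toContinuousLinearMap (t x) = x := by
  refine ext_inner_right ℂ fun y => ?_
  rw [ContinuousLinearMap.adjoint_inner_left]
  exact t.inner_map_map x y

theorem limitMap_apply_of_lt (t : ∀ n, E n →ₗᵢ[ℂ] E (n + 1)) (n : ℕ) (x : E n) (m : ℕ) (h : n < m) :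
    limitMap t n x m = 0 := by
  induction n with
  | zero => exact lp.single_apply_ne 2 0 x (by omega)
  | succ n ih =>
    have h1 := ih (ContinuousLinearMap.adjoint (t n).toContinuousLinearMap x) (by omega)
    have h2 := lp.single_apply_ne 2 (n + 1)
      (x - t n (ContinuousLinearMap.adjoint (t n).toContinuousLinearMap x)) (j := m) (by omega)
    change limitMap t n _ m + lp.single 2 (n + 1) _ m = 0
    exact (congrArg₂ (· + ·) h1 h2).trans (add_zero 0)

theorem norm_limitMap (t : ∀ n, E n →ₗᵢ[ℂ] E (n + 1)) (n : ℕ) (x : E n) :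
    ‖limitMap t n x‖ = ‖x‖ := by
  induction n with
  | zero => exact lp.norm_single (by norm_num) 0 x
  | succ n ih =>
    set y := ContinuousLinearMap.adjoint (t n).toContinuousLinearMap x with hy
    have h0 : limitMap t (n + 1) x = limitMap t n y + lp.single 2 (n + 1) (x - t n y) := rfl
    have h1 : inner ℂ (limitMap t n y) (lp.single 2 (n + 1) (x - t n y)) = 0 := by
      rw [lp.inner_single_right, limitMap_apply_of_lt t n y (n + 1) (by omega), inner_zero_left]
    have h2 : inner ℂ (t n y) (x - t n y) = 0 := by
      rw [inner_sub_right, (t n).inner_map_map]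
      have := ContinuousLinearMap.adjoint_inner_right (t n).toContinuousLinearMap y x
      rw [← hy] at this
      rw [this]
      exact sub_self _
    have h3 := norm_add_sq_eq_norm_sq_add_norm_sq_of_inner_eq_zero (𝕜 := ℂ) _ _ h1
    have h4 := norm_add_sq_eq_norm_sq_add_norm_sq_of_inner_eq_zero (𝕜 := ℂ) _ _ h2
    rw [add_sub_cancel, (t n).norm_map] at h4
    rw [← h0, ih, lp.norm_single (by norm_num), ← h4] at h3
    exact (mul_self_inj (norm_nonneg _) (norm_nonneg _)).1 h3

theorem exists_isHilbertLimit {t : ∀ n, E n →ₗ[ℂ] E (n + 1)} (ht : ∀ n ψ, ‖t n ψ‖ = ‖ψ‖) :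
    ∃ (H : Type) (_ : NormedAddCommGroup H) (_ : InnerProductSpace ℂ H) (_ : CompleteSpace H)
      (j : ∀ n, E n →ₗᵢ[ℂ] H), IsHilbertLimit t j := by
  let t' : ∀ n, E n →ₗᵢ[ℂ] E (n + 1) := fun n => ⟨t n, ht n⟩
  obtain ⟨S, j, hj, -⟩ := exists_isHilbertLimit_submodule (t := t)
    (fun n => (⟨limitMap t' n, norm_limitMap t' n⟩ : E n →ₗᵢ[ℂ] lp E 2)) fun n ψ => by
      have h := adjoint_apply_self (t' n) ψ
      change limitMap t' n (ContinuousLinearMap.adjoint (t' n).toContinuousLinearMap (t' n ψ)) +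
        lp.single 2 (n + 1) (t' n ψ - t' n (ContinuousLinearMap.adjoint
          (t' n).toContinuousLinearMap (t' n ψ))) = limitMap t' n ψ
      rw [h, sub_self, lp.single_zero, add_zero]
  exact ⟨S, inferInstance, inferInstance, hj.complete, j, hj⟩

end HilbertLimit

section Operators

variable {E : ℕ → Type} [∀ n, NormedAddCommGroup (E n)] [∀ n, InnerProductSpace ℂ (E n)]
  [∀ n, CompleteSpace (E n)] {H : Type} [NormedAddCommGroup H] [InnerProductSpace ℂ H]
  {t : ∀ n, E n →ₗ[ℂ] E (n + 1)} {j : ∀ n, E n →ₗᵢ[ℂ] H}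

/-- Equality of continuous maps on an inductive limit can be tested at late stages. -/
theorem IsHilbertLimit.ext_of_le (hj : IsHilbertLimit t j) {F : Type} [TopologicalSpace F] [T2Space F]
    {f g : H → F} (hf : Continuous f) (hg : Continuous g) (n : ℕ)
    (h : ∀ m, n ≤ m → ∀ ξ, f (j m ξ) = g (j m ξ)) : f = g := by
  refine Continuous.ext_on hj.dense hf hg fun x hx => ?_
  obtain ⟨m, hm⟩ := Set.mem_iUnion.1 hx
  obtain ⟨ξ, rfl⟩ := range_subset_range_of_le hj.compat (le_max_right n m) hm
  exact h _ (le_max_left n m) ξ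

/-- A uniformly bounded sequence of operators, compatible from stage `n` on, extends to the limit. -/
theorem IsHilbertLimit.exists_extension (hj : IsHilbertLimit t j) (B : ∀ m, E m →L[ℂ] E m) (n : ℕ)
    (hB : ∀ m, n ≤ m → ∀ ξ, B (m + 1) (t m ξ) = t m (B m ξ)) (C : ℝ) (hC : ∀ m, ‖B m‖ ≤ C) :
    ∃ T : H →L[ℂ] H, ∀ m, n ≤ m → ∀ ξ, T (j m ξ) = j m (B m ξ) := by
  have := hj.complete
  let J : ∀ m, E m →L[ℂ] H := fun m => (j m).toContinuousLinearMap
  -- the extension is the strong limit of the operators `B m`, compressed to stage `m`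
  let g : ℕ → H →L[ℂ] H := fun m => (J m).comp ((B m).comp (ContinuousLinearMap.adjoint (J m)))
  -- the sequence `g` is eventually constant on the vectors of the stages
  have hg : ∀ k, n ≤ k → ∀ ξ m, k ≤ m → g m (j k ξ) = j k (B k ξ) := by
    intro k hk ξ m hm
    have h1 : ∃ ξ' : E m, j m ξ' = j k ξ ∧ j m (B m ξ') = j k (B k ξ) := by
      induction m, hm using Nat.le_induction with
      | base => exact ⟨ξ, rfl, rfl⟩
      | succ m hm ih =>
        obtain ⟨ξ', h1, h2⟩ := ih
        exact ⟨t m ξ', by rw [hj.compat, h1], by rw [hB m (hk.trans hm), hj.compat, h2]⟩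
    obtain ⟨ξ', h1, h2⟩ := h1
    rw [← h1, ← h2]
    change j m (B m (ContinuousLinearMap.adjoint (j m).toContinuousLinearMap (j m ξ'))) = _
    rw [adjoint_apply_self]
  have hC0 : 0 ≤ C := (norm_nonneg _).trans (hC 0)
  have hgC : ∀ m ψ, ‖g m ψ‖ ≤ C * ‖ψ‖ := by
    intro m ψ
    change ‖j m (B m (ContinuousLinearMap.adjoint (J m) ψ))‖ ≤ _
    rw [(j m).norm_map]
    refine ((B m).le_of_opNorm_le (hC m) _).trans (mul_le_mul_of_nonneg_left ?_ hC0)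
    refine ((ContinuousLinearMap.adjoint (J m)).le_opNorm ψ).trans ?_
    rw [LinearIsometryEquiv.norm_map]
    exact mul_le_of_le_one_left (norm_nonneg _) (j m).norm_toContinuousLinearMap_le
  have hlim : ∀ ψ, ∃ φ, Filter.Tendsto (fun m => g m ψ) Filter.atTop (nhds φ) := by
    intro ψ
    refine cauchySeq_tendsto_of_complete (Metric.cauchySeq_iff'.2 fun ε hε => ?_)
    obtain ⟨x, hx, hxψ⟩ := Metric.dense_iff.1 hj.dense ψ (ε / (2 * (C + 1))) (by positivity)
    obtain ⟨k, hk⟩ := Set.mem_iUnion.1 hxψ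
    obtain ⟨ξ, rfl⟩ := range_subset_range_of_le hj.compat (le_max_right n k) hk
    refine ⟨max n k, fun m hm => ?_⟩
    have hx' : ‖ψ - j (max n k) ξ‖ < ε / (2 * (C + 1)) := by
      rw [← dist_eq_norm, dist_comm]; exact hx
    have hd : ∀ i, ‖g i (ψ - j (max n k) ξ)‖ < ε / 2 := fun i => by
      refine (hgC i _).trans_lt ?_
      rw [lt_div_iff₀ (by positivity)] at hx'
      nlinarith [norm_nonneg (ψ - j (max n k) ξ)]
    have h1 := hg _ (le_max_left n k) ξ m hm
    have h2 := hg _ (le_max_left n k) ξ _ le_rfl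
    have h3 := hd m
    have h4 := hd (max n k)
    rw [map_sub] at h3 h4
    rw [h1, ← dist_eq_norm] at h3
    rw [h2, ← dist_eq_norm] at h4
    linarith [dist_triangle_right (g m ψ) (g (max n k) ψ) (j (max n k) (B (max n k) ξ))]
  choose f hf using hlim
  refine ⟨continuousLinearMapOfTendsto g (f := f) (tendsto_pi_nhds.2 hf), fun m hm ξ => ?_⟩
  refine tendsto_nhds_unique (hf (j m ξ)) ?_
  refine tendsto_const_nhds.congr' ?_
  filter_upwards [Filter.eventually_ge_atTop m] with i hi
  exact (hg m hm ξ i hi).symm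

end Operators

/-! ### Limits of algebras and their representations -/

section CStarLimit

/-- An injective star homomorphism on a finite-dimensional C⋆-algebra has closed range, hence is a star
isomorphism between C⋆-algebras. -/
theorem isometry_of_injective {A B : Type} [CStarAlgebra A] [FiniteDimensional ℂ A]
    [CStarAlgebra B] (f : A →⋆ₐ[ℂ] B) (hf : Function.Injective f) : Isometry f := by
  have : IsClosed (f.range : Set B) :=
    (LinearMap.range f.toAlgHom.toLinearMap).closed_of_finiteDimensional
  exact (StarAlgEquiv.isometry (StarAlgEquiv.ofInjective f hf) :)

variable {A : ℕ → Type} [∀ n, CStarAlgebra (A n)]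

/-- The composite of the connecting homomorphisms from stage `n` to stage `m`. -/
def stepHom (κ : ∀ n, A n →⋆ₐ[ℂ] A (n + 1)) {n m : ℕ} (h : n ≤ m) : A n →⋆ₐ[ℂ] A m :=
  Nat.leRecOn (C := fun k => A n →⋆ₐ[ℂ] A k) h (fun {k} f => (κ k).comp f) (StarAlgHom.id ℂ (A n))

theorem stepHom_self (κ : ∀ n, A n →⋆ₐ[ℂ] A (n + 1)) (n : ℕ) (a : A n) :
    stepHom κ (le_refl n) a = a := by
  rw [stepHom, Nat.leRecOn_self]
  rfl

theorem stepHom_succ (κ : ∀ n, A n →⋆ₐ[ℂ] A (n + 1)) {n m : ℕ} (h : n ≤ m) (a : A n) :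
    stepHom κ (Nat.le_succ_of_le h) a = κ m (stepHom κ h a) := by
  rw [stepHom, Nat.leRecOn_succ h]
  rfl

theorem stepHom_left (κ : ∀ n, A n →⋆ₐ[ℂ] A (n + 1)) {n m : ℕ} (h : n + 1 ≤ m) (a : A n) :
    stepHom κ h (κ n a) = stepHom κ (Nat.le_of_succ_le h) a := by
  induction m, h using Nat.le_induction with
  | base => rw [stepHom_self, stepHom_succ κ le_rfl, stepHom_self]
  | succ m hm ih => rw [stepHom_succ κ hm, ih, ← stepHom_succ]

/-- Compatible isometric star homomorphisms into a C⋆-algebra exhibit the closure of the union of their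
ranges as the inductive limit. -/
theorem exists_isCStarLimit {B : Type} [CStarAlgebra B] {κ : ∀ n, A n →⋆ₐ[ℂ] A (n + 1)}
    (ρ : ∀ n, A n →⋆ₐ[ℂ] B) (hρ : ∀ n, Isometry (ρ n)) (hκ : ∀ n a, ρ (n + 1) (κ n a) = ρ n a) :
    ∃ (L : Type) (_ : CStarAlgebra L) (φ : ∀ n, A n →⋆ₐ[ℂ] L) (σ : L →⋆ₐ[ℂ] B),
      IsCStarLimit κ φ ∧ Isometry σ ∧ ∀ n a, σ (φ n a) = ρ n a := by
  have hmono : Monotone fun n => (ρ n).range := monotone_nat_of_le_succ fun n => by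
    rintro _ ⟨a, rfl⟩
    exact ⟨κ n a, hκ n a⟩
  let U : StarSubalgebra ℂ B := ⨆ n, (ρ n).range
  have hU : (U : Set B) = ⋃ n, Set.range (ρ n) :=
    StarSubalgebra.coe_iSup_of_directed hmono.directed_le
  have hmem : ∀ n a, ρ n a ∈ U.topologicalClosure := fun n a =>
    U.le_topologicalClosure (le_iSup (fun n => (ρ n).range) n ⟨a, rfl⟩)
  have hclosed : IsClosed (U.topologicalClosure : Set B) := U.isClosed_topologicalClosure
  let φ : ∀ n, A n →⋆ₐ[ℂ] U.topologicalClosure := fun n => (ρ n).codRestrict _ (hmem n)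
  refine ⟨U.topologicalClosure, inferInstance, φ, U.topologicalClosure.subtype,
    ⟨fun n => ?_, fun n a => Subtype.ext (hκ n a), ?_⟩, isometry_subtype_coe, fun _ _ => rfl⟩
  · exact Isometry.of_dist_eq fun a b => (hρ n).dist_eq a b
  · intro x
    rw [closure_subtype, Set.image_iUnion]
    have h : (⋃ n, (Subtype.val '' Set.range (φ n) : Set B)) = (U : Set B) := by
      rw [hU]
      refine Set.iUnion_congr fun n => ?_
      rw [← Set.range_comp]
      rfl
    rw [h]
    exact x.2

variable {E : ℕ → Type} [∀ n, NormedAddCommGroup (E n)] [∀ n, InnerProductSpace ℂ (E n)]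
  [∀ n, CompleteSpace (E n)] {H : Type} [NormedAddCommGroup H] [InnerProductSpace ℂ H]
  [CompleteSpace H] {t : ∀ n, E n →ₗ[ℂ] E (n + 1)} {j : ∀ n, E n →ₗᵢ[ℂ] H}

/-- Compatible actions on the stages give compatible representations on the limit. -/
theorem IsHilbertLimit.exists_representation (hj : IsHilbertLimit t j)
    (κ : ∀ n, A n →⋆ₐ[ℂ] A (n + 1)) (act : ∀ n, A n →⋆ₐ[ℂ] (E n →L[ℂ] E n))
    (h : ∀ n a ξ, act (n + 1) (κ n a) (t n ξ) = t n (act n a ξ)) :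
    ∃ ρ : ∀ n, A n →⋆ₐ[ℂ] (H →L[ℂ] H), (∀ n a, ρ (n + 1) (κ n a) = ρ n a) ∧
      ∀ n a ξ, ρ n a (j n ξ) = j n (act n a ξ) := by
  have hext : ∀ n (a : A n), ∃ T : H →L[ℂ] H, ∀ m (hm : n ≤ m) ξ,
      T (j m ξ) = j m (act m (stepHom κ hm a) ξ) := by
    intro n a
    obtain ⟨T, hT⟩ := hj.exists_extension
      (fun m => if hm : n ≤ m then act m (stepHom κ hm a) else 0) n (fun m hm ξ => by
        rw [dif_pos hm, dif_pos (Nat.le_succ_of_le hm), stepHom_succ κ hm, h]) ‖a‖ (fun m => by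
        split_ifs with hm
        · exact (NonUnitalStarAlgHom.norm_apply_le ((act m).comp (stepHom κ hm)) a)
        · rw [norm_zero]; exact norm_nonneg a)
    exact ⟨T, fun m hm ξ => by rw [hT m hm, dif_pos hm]⟩
  choose T hT using hext
  -- an operator is determined by its action on the late stages
  have huniq : ∀ n (S S' : H →L[ℂ] H), (∀ m, n ≤ m → ∀ ξ, S (j m ξ) = S' (j m ξ)) → S = S' :=
    fun n S S' hS => ContinuousLinearMap.coeFn_injective
      (hj.ext_of_le S.continuous S'.continuous n hS)
  let ρ : ∀ n, A n →⋆ₐ[ℂ] (H →L[ℂ] H) := fun n =>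
    { toFun := T n
      map_one' := huniq n _ _ fun m hm ξ => by
        rw [hT n 1 m hm, map_one, map_one]
        rfl
      map_mul' := fun a b => huniq n _ _ fun m hm ξ => by
        change _ = T n a (T n b _)
        rw [hT n _ m hm, hT n b m hm, hT n a m hm, map_mul, map_mul]
        rfl
      map_zero' := huniq n _ _ fun m hm ξ => by
        rw [hT n 0 m hm, map_zero, map_zero]
        exact (j m).map_zero
      map_add' := fun a b => huniq n _ _ fun m hm ξ => by
        change _ = T n a _ + T n b _
        rw [hT n _ m hm, hT n b m hm, hT n a m hm, map_add, map_add]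
        exact (j m).map_add _ _
      commutes' := fun c => huniq n _ _ fun m hm ξ => by
        rw [hT n _ m hm, AlgHomClass.commutes, AlgHomClass.commutes, Algebra.algebraMap_eq_smul_one,
          Algebra.algebraMap_eq_smul_one]
        exact (j m).map_smul c ξ
      map_star' := fun a => huniq n _ _ fun m hm ξ => by
        refine ext_inner_right ℂ fun y => ?_
        change _ = inner ℂ (ContinuousLinearMap.adjoint (T n a) (j m ξ)) y
        rw [ContinuousLinearMap.adjoint_inner_left]
        refine congrFun (hj.ext_of_le (f := fun y => inner ℂ (T n (star a) (j m ξ)) y)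
          (g := fun y => inner ℂ (j m ξ) (T n a y)) (by fun_prop) (by fun_prop) m
          fun k hk η => ?_) y
        obtain ⟨ξ', hξ'⟩ := range_subset_range_of_le hj.compat hk ⟨ξ, rfl⟩
        rw [← hξ', hT n _ k (hm.trans hk), hT n _ k (hm.trans hk), map_star, map_star,
          (j k).inner_map_map, (j k).inner_map_map, ContinuousLinearMap.star_eq_adjoint,
          ContinuousLinearMap.adjoint_inner_left] }
  refine ⟨ρ, fun n a => huniq (n + 1) _ _ fun m hm ξ => ?_, fun n a ξ => ?_⟩
  · change T (n + 1) (κ n a) _ = T n a _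
    rw [hT _ _ m hm, hT n a m (Nat.le_of_succ_le hm), stepHom_left]
  · change T n a _ = _
    rw [hT n a n le_rfl, stepHom_self]

/-- A representation that extends a faithful action is faithful. -/
theorem injective_of_apply_eq {n : ℕ} {ρ : A n →⋆ₐ[ℂ] (H →L[ℂ] H)}
    {act : A n →⋆ₐ[ℂ] (E n →L[ℂ] E n)} (hact : Function.Injective act)
    (h : ∀ a ξ, ρ a (j n ξ) = j n (act a ξ)) : Function.Injective ρ := by
  intro a b hab
  refine hact (ContinuousLinearMap.ext fun ξ => (j n).injective ?_)
  rw [← h, ← h, hab]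

end CStarLimit

section Compression

variable {A Hc Hp : Type} [CStarAlgebra A] [NormedAddCommGroup Hc] [InnerProductSpace ℂ Hc]
  [CompleteSpace Hc] [NormedAddCommGroup Hp] [InnerProductSpace ℂ Hp] [CompleteSpace Hp]

/-- A representation that leaves the range of an isometry invariant restricts to this range. -/
theorem exists_restriction (u : Hc →ₗᵢ[ℂ] Hp) (π : A →⋆ₐ[ℂ] (Hp →L[ℂ] Hp))
    (h : ∀ a ψ, π a (u ψ) ∈ Set.range u) :
    ∃ π' : A →⋆ₐ[ℂ] (Hc →L[ℂ] Hc), ∀ a ψ, π a (u ψ) = u (π' a ψ) := by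
  let U : Hc →L[ℂ] Hp := u.toContinuousLinearMap
  let V : Hp →L[ℂ] Hc := ContinuousLinearMap.adjoint U
  have hV : ∀ a ψ, u (V (π a (u ψ))) = π a (u ψ) := by
    intro a ψ
    obtain ⟨φ, hφ⟩ := h a ψ
    rw [← hφ]
    exact congrArg u (adjoint_apply_self u φ)
  let T : A → (Hc →L[ℂ] Hc) := fun a => V.comp ((π a).comp U)
  have hT : ∀ a ψ, u (T a ψ) = π a (u ψ) := hV
  refine ⟨{ toFun := T
            map_one' := ContinuousLinearMap.ext fun ψ => u.injective ?_
            map_mul' := fun a b => ContinuousLinearMap.ext fun ψ => u.injective ?_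
            map_zero' := ContinuousLinearMap.ext fun ψ => u.injective ?_
            map_add' := fun a b => ContinuousLinearMap.ext fun ψ => u.injective ?_
            commutes' := fun c => ContinuousLinearMap.ext fun ψ => u.injective ?_
            map_star' := fun a => ?_ }, fun a ψ => (hT a ψ).symm⟩
  · rw [hT, map_one]
    rfl
  · change _ = u (T a (T b ψ))
    rw [hT, hT, hT, map_mul]
    rfl
  · rw [hT, map_zero]
    exact u.map_zero.symm
  · change _ = u (T a ψ + T b ψ)
    rw [u.map_add, hT, hT, hT, map_add]
    rfl
  · rw [hT, AlgHomClass.commutes, Algebra.algebraMap_eq_smul_one, Algebra.algebraMap_eq_smul_one]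
    exact (u.map_smul c ψ).symm
  · change V.comp ((π (star a)).comp U) = ContinuousLinearMap.adjoint (V.comp ((π a).comp U))
    rw [map_star, ContinuousLinearMap.star_eq_adjoint, ContinuousLinearMap.adjoint_comp,
      ContinuousLinearMap.adjoint_comp, ContinuousLinearMap.adjoint_adjoint]
    rfl

end Compression

section LimitAlgebras

variable {Ec Ep : ℕ → Type} [∀ n, NormedAddCommGroup (Ec n)] [∀ n, InnerProductSpace ℂ (Ec n)]
  [∀ n, CompleteSpace (Ec n)] [∀ n, NormedAddCommGroup (Ep n)] [∀ n, InnerProductSpace ℂ (Ep n)]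
  [∀ n, CompleteSpace (Ep n)] {A B : ℕ → Type} [∀ n, CStarAlgebra (A n)]
  [∀ n, FiniteDimensional ℂ (A n)] [∀ n, CStarAlgebra (B n)] [∀ n, FiniteDimensional ℂ (B n)]
  {Hc Hp : Type} [NormedAddCommGroup Hc] [InnerProductSpace ℂ Hc] [CompleteSpace Hc]
  [NormedAddCommGroup Hp] [InnerProductSpace ℂ Hp] [CompleteSpace Hp]

/-- Two sequences of finite-dimensional C⋆-algebras, acting faithfully on two sequences of Hilbert spaces
and intertwined by isometries `v n`, have limits acting faithfully on the limit Hilbert spaces and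
intertwined by the limit of the `v n`. Both limit algebras are closures of unions inside the operators
on `Hp`; the action of the first one on `Hc` is the restriction to the range of `u`. -/
theorem exists_limitAlgebras {tc : ∀ n, Ec n →ₗ[ℂ] Ec (n + 1)} {tp : ∀ n, Ep n →ₗ[ℂ] Ep (n + 1)}
    {jc : ∀ n, Ec n →ₗᵢ[ℂ] Hc} {jp : ∀ n, Ep n →ₗᵢ[ℂ] Hp} {u : Hc →ₗᵢ[ℂ] Hp}
    (hjc : IsHilbertLimit tc jc) (hjp : IsHilbertLimit tp jp) {v : ∀ n, Ec n →ₗ[ℂ] Ep n}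
    (hu : ∀ n ψ, u (jc n ψ) = jp n (v n ψ))
    {κc : ∀ n, A n →⋆ₐ[ℂ] A (n + 1)} {κp : ∀ n, B n →⋆ₐ[ℂ] B (n + 1)}
    {actc : ∀ n, A n →⋆ₐ[ℂ] (Ec n →L[ℂ] Ec n)} {actp : ∀ n, B n →⋆ₐ[ℂ] (Ep n →L[ℂ] Ep n)}
    (hcinj : ∀ n, Function.Injective (actc n)) (hpinj : ∀ n, Function.Injective (actp n))
    (hc2 : ∀ n a ψ, actc (n + 1) (κc n a) (tc n ψ) = tc n (actc n a ψ))
    (hp2 : ∀ n b ψ, actp (n + 1) (κp n b) (tp n ψ) = tp n (actp n b ψ))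
    {ι : ∀ n, A n →⋆ₐ[ℂ] B n} (hιinj : ∀ n, Function.Injective (ι n))
    (h1 : ∀ n a ψ, actp n (ι n a) (v n ψ) = v n (actc n a ψ))
    (h3 : ∀ n a, κp n (ι n a) = ι (n + 1) (κc n a)) :
    ∃ (Ac : Type) (_ : CStarAlgebra Ac) (Ap : Type) (_ : CStarAlgebra Ap)
      (φc : ∀ n, A n →⋆ₐ[ℂ] Ac) (φp : ∀ n, B n →⋆ₐ[ℂ] Ap) (ιlim : Ac →⋆ₐ[ℂ] Ap)
      (πc : Ac →⋆ₐ[ℂ] (Hc →L[ℂ] Hc)) (πp : Ap →⋆ₐ[ℂ] (Hp →L[ℂ] Hp)),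
      IsCStarLimit κc φc ∧ IsCStarLimit κp φp ∧ Isometry ιlim ∧
      (∀ n a, ιlim (φc n a) = φp n (ι n a)) ∧ Isometry πc ∧ Isometry πp ∧
      (∀ n a ψ, πc (φc n a) (jc n ψ) = jc n (actc n a ψ)) ∧
      (∀ n b ψ, πp (φp n b) (jp n ψ) = jp n (actp n b ψ)) ∧
      ∀ a ψ, πp (ιlim a) (u ψ) = u (πc a ψ) := by
  -- the representations of the stages on the limit Hilbert spaces
  obtain ⟨ρc, hρc, hρc'⟩ := hjc.exists_representation _ _ hc2
  obtain ⟨ρp, hρp, hρp'⟩ := hjp.exists_representation _ _ hp2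
  have hρc_iso : ∀ Λ, Isometry (ρc Λ) := fun Λ =>
    isometry_of_injective _ (injective_of_apply_eq (hcinj Λ) (hρc' Λ))
  have hρp_iso : ∀ Λ, Isometry (ρp Λ) := fun Λ =>
    isometry_of_injective _ (injective_of_apply_eq (hpinj Λ) (hρp' Λ))
  have hint : ∀ Λ A ψ, ρp Λ (ι Λ A) (u ψ) = u (ρc Λ A ψ) := by
    intro Λ A
    refine congrFun (hjc.ext_of_le (by fun_prop) (by fun_prop) Λ fun m hm => ?_)
    suffices hA : ∃ A', ρc m A' = ρc Λ A ∧ ρp m (ι m A') = ρp Λ (ι Λ A) by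
      obtain ⟨A', hc, hp⟩ := hA
      intro ξ
      rw [← hc, ← hp, hu, hρp', hρc', hu, h1]
    induction m, hm using Nat.le_induction with
    | base => exact ⟨A, rfl, rfl⟩
    | succ m hm ih =>
      obtain ⟨A', hc, hp⟩ := ih
      exact ⟨κc m A', by rw [hρc, hc], by rw [← h3, hρp, hp]⟩
  obtain ⟨Ap, iAp, φp, πp, hφp, hπp, hφp'⟩ := exists_isCStarLimit ρp hρp_iso hρp
  obtain ⟨Ac, iAc, φc, ιlim, hφc, hιlim, hφc'⟩ := exists_isCStarLimit (κ := κc)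
    (fun Λ => (φp Λ).comp (ι Λ))
    (fun Λ => (hφp.isometry Λ).comp (isometry_of_injective _ (hιinj Λ)))
    (fun Λ A => by
      change φp (Λ + 1) (ι (Λ + 1) (κc Λ A)) = φp Λ (ι Λ A)
      rw [← h3, hφp.compat])
  have hgen : ∀ Λ A, πp (ιlim (φc Λ A)) = ρp Λ (ι Λ A) := fun Λ A => by
    rw [← hφp' Λ (ι Λ A)]
    exact congrArg πp (hφc' Λ A)
  have hcont : Continuous fun A : Ac => πp (ιlim A) :=
    hπp.continuous.comp hιlim.continuous
  -- the range of `u` is invariant, since it is so under the dense union of the stages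
  obtain ⟨πc, hπc⟩ := exists_restriction u (πp.comp ιlim) fun A ψ => by
    have hcl : IsClosed {A : Ac | πp (ιlim A) (u ψ) ∈ Set.range u} :=
      u.isometry.isClosedEmbedding.isClosed_range.preimage (hcont.clm_apply continuous_const)
    refine hcl.closure_subset_iff.2 ?_ (hφc.dense A)
    rintro _ hx
    obtain ⟨Λ, a, rfl⟩ := Set.mem_iUnion.1 hx
    refine ⟨ρc Λ a ψ, ?_⟩
    rw [hgen, hint]
  have hπρ : ∀ Λ A, πc (φc Λ A) = ρc Λ A := by
    intro Λ A
    refine ContinuousLinearMap.ext fun ψ => u.injective ?_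
    rw [← hint, ← hgen]
    exact (hπc _ ψ).symm
  have hπc_cont : Continuous πc :=
    AddMonoidHomClass.continuous_of_bound πc 1 fun A => by
      rw [one_mul]; exact NonUnitalStarAlgHom.norm_apply_le πc A
  have hπc_iso : Isometry πc := by
    refine AddMonoidHomClass.isometry_of_norm πc fun A => ?_
    refine congrFun (Continuous.ext_on hφc.dense hπc_cont.norm continuous_norm fun x hx => ?_) A
    obtain ⟨Λ, a, rfl⟩ := Set.mem_iUnion.1 hx
    rw [hπρ, (hρc_iso Λ).norm_map_of_map_zero (map_zero _),
      (hφc.isometry Λ).norm_map_of_map_zero (map_zero _)]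
  refine ⟨Ac, iAc, Ap, iAp, φc, φp, ιlim, πc, πp, hφc, hφp,
    hιlim, hφc', hπc_iso, hπp, fun Λ A ψ => ?_, fun Λ B ψ => ?_, hπc⟩
  · rw [hπρ, hρc']
  · rw [← hρp', ← hφp']

end LimitAlgebras

/-! ### The limit algebras of a region -/

section Limits

variable {p q d : ℕ} [NeZero p] [NeZero q] (N : Network p q d) {R : Set (Chamber p q)}

theorem amplify_injective [NeZero d] {α : Type} [DecidableEq α] {X Y : Finset α} (h : X ⊆ Y) :
    Function.Injective (amplify d h) := by
  have hM : Function.Injective (amplifyMatrix d h) := by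
    intro M M' hMM
    ext x x'
    have := congrFun (congrFun hMM ((splitLabels h).symm (x, fun _ => 0)))
      ((splitLabels h).symm (x', fun _ => 0))
    simpa only [amplifyMatrix_eq_ampl, ampl_apply, Equiv.apply_symm_apply, if_true] using this
  exact (opEquiv d Y).injective.comp (hM.comp (opEquiv d X).symm.injective)

instance {α : Type} [DecidableEq α] (X : Finset α) : FiniteDimensional ℂ (Op d X) :=
  FiniteDimensional.of_injective (ContinuousLinearMap.coeLM ℂ) ContinuousLinearMap.coe_injective

/-- The limit algebras of a region. The maps `A ↦ A ⊗ 1` are compatible with the actions on the code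
spaces because this holds after applying the injective bulk-to-boundary maps. -/
theorem Network.hasLimitAlgebras [NeZero d] (hp : 5 ≤ p) (hq : 3 ≤ q) (hR : IsRegion N.center R)
    {Hc Hp : Type} [NormedAddCommGroup Hc] [InnerProductSpace ℂ Hc] [CompleteSpace Hc]
    [NormedAddCommGroup Hp] [InnerProductSpace ℂ Hp] [CompleteSpace Hp]
    {jc : ∀ Λ, N.HCode Λ →ₗᵢ[ℂ] Hc} {jp : ∀ Λ, N.HPhys Λ →ₗᵢ[ℂ] Hp} {u : Hc →ₗᵢ[ℂ] Hp}
    (hjc : IsHilbertLimit N.codeStep jc) (hjp : IsHilbertLimit N.physStep jp)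
    (hu : ∀ Λ ψ, u (jc Λ ψ) = jp Λ (N.bulkToBoundary Λ ψ)) : HasLimitAlgebras N R jc jp u := by
  obtain ⟨ι, κ, h1, h2, h3⟩ := N.exists_homs hp hq hR
  have huinj : ∀ Λ, Function.Injective (N.bulkToBoundary Λ) := fun Λ =>
    (⟨N.bulkToBoundary Λ, N.norm_bulkToBoundary hp hq Λ⟩ : N.HCode Λ →ₗᵢ[ℂ] N.HPhys Λ).injective
  have hp2 : ∀ Λ B ψ, N.physAct R (Λ + 1) (κ Λ B) (N.physStep Λ ψ) =
      N.physStep Λ (N.physAct R Λ B ψ) := fun Λ => h2 Λ _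
  have hc2 : ∀ Λ A ψ, N.codeAct R (Λ + 1) (N.codeAlgStep R Λ A) (N.codeStep Λ ψ) =
      N.codeStep Λ (N.codeAct R Λ A ψ) := fun Λ A ψ => huinj (Λ + 1) (by
    rw [← h1, ← h3, N.bulkToBoundary_codeStep, N.bulkToBoundary_codeStep, hp2, h1])
  have hcinj : ∀ Λ, Function.Injective (N.codeAct R Λ) := fun Λ => amplify_injective _
  have hpinj : ∀ Λ, Function.Injective (N.physAct R Λ) := fun Λ => amplify_injective _
  have hιinj : ∀ Λ, Function.Injective (ι Λ) := by
    intro Λ A A' hA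
    refine hcinj Λ (ContinuousLinearMap.ext fun ψ => huinj Λ ?_)
    rw [← h1, ← h1, hA]
  obtain ⟨Ac, iAc, Ap, iAp, φc, φp, ιlim, πc, πp, h⟩ :=
    exists_limitAlgebras hjc hjp hu hcinj hpinj hc2 hp2 hιinj h1 h3
  exact ⟨ι, κ, Ac, iAc, Ap, iAp, φc, φp, ιlim, πc, πp, h1, h2, h3, h⟩

/-- The limit Hilbert spaces: the physical one is the inductive limit of the layer maps, the code
one is the closure in it of the images of the truncated code spaces. -/
theorem Network.exists_hilbertLimits [NeZero d] (hp : 5 ≤ p) (hq : 3 ≤ q) :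
    ∃ (Hc : Type) (_ : NormedAddCommGroup Hc) (_ : InnerProductSpace ℂ Hc) (_ : CompleteSpace Hc)
      (Hp : Type) (_ : NormedAddCommGroup Hp) (_ : InnerProductSpace ℂ Hp) (_ : CompleteSpace Hp)
      (jc : ∀ Λ, N.HCode Λ →ₗᵢ[ℂ] Hc) (jp : ∀ Λ, N.HPhys Λ →ₗᵢ[ℂ] Hp) (u : Hc →ₗᵢ[ℂ] Hp),
      IsHilbertLimit N.codeStep jc ∧ IsHilbertLimit N.physStep jp ∧
      ∀ Λ ψ, u (jc Λ ψ) = jp Λ (N.bulkToBoundary Λ ψ) := by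
  obtain ⟨Hp, i1, i2, i3, jp, hjp⟩ := exists_isHilbertLimit (N.norm_physStep hp hq)
  obtain ⟨S, jc, hjc, hjc'⟩ := exists_isHilbertLimit_submodule (t := N.codeStep)
    (fun Λ => (jp Λ).comp ⟨N.bulkToBoundary Λ, N.norm_bulkToBoundary hp hq Λ⟩) fun Λ ψ => by
      change jp (Λ + 1) (N.bulkToBoundary (Λ + 1) (N.codeStep Λ ψ)) = jp Λ (N.bulkToBoundary Λ ψ)
      rw [N.bulkToBoundary_codeStep, hjp.compat]
  exact ⟨S, inferInstance, inferInstance, hjc.complete, Hp, i1, i2, i3, jc, jp, S.subtypeₗᵢ, hjc,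
    hjp, hjc'⟩

end Limits

end Bourdon

end

theorem mainTheorem8 (p q d : ℕ) [NeZero p] [NeZero q] (hp : 5 ≤ p) (hpodd : Odd p) (hq : 3 ≤ q)
    (N : Bourdon.Network p q d) :
    ∃ (Hc : Type) (_ : NormedAddCommGroup Hc) (_ : InnerProductSpace ℂ Hc) (_ : CompleteSpace Hc)
      (Hp : Type) (_ : NormedAddCommGroup Hp) (_ : InnerProductSpace ℂ Hp) (_ : CompleteSpace Hp)
      (jc : ∀ Λ, N.HCode Λ →ₗᵢ[ℂ] Hc) (jp : ∀ Λ, N.HPhys Λ →ₗᵢ[ℂ] Hp) (u : Hc →ₗᵢ[ℂ] Hp),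
      Bourdon.IsHilbertLimit N.codeStep jc ∧
      Bourdon.IsHilbertLimit N.physStep jp ∧
      (∀ Λ ψ, u (jc Λ ψ) = jp Λ (N.bulkToBoundary Λ ψ)) ∧
      ∀ (T : Bourdon.Chamber p q) (J : Set (ZMod p)),
        ((∃ i, J = {i}) ∨ ∃ i, J = {i, i + 1}) →
        (∀ i ∈ J, N.center ∉ Bourdon.wedge T {i}) →
        Bourdon.HasLimitAlgebras N (Bourdon.wedge T J) jc jp u ∧
        Bourdon.HasLimitAlgebras N (Bourdon.wedge T J)ᶜ jc jp u := by
  -- the reference vector has norm one, so that `ℂ^d` is nonzero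
  have : NeZero d := ⟨by
    rintro rfl
    have h := N.norm_ref
    rw [Subsingleton.elim N.ref 0, norm_zero] at h
    exact zero_ne_one h⟩
  obtain ⟨Hc, _, _, _, Hp, _, _, _, jc, jp, u, hjc, hjp, hu⟩ := N.exists_hilbertLimits hp hq
  refine ⟨Hc, _, _, ‹_›, Hp, _, _, ‹_›, jc, jp, u, hjc, hjp, hu, fun T J hJ h => ⟨?_, ?_⟩⟩
  · exact N.hasLimitAlgebras hp hq (Bourdon.isRegion_wedge h) hjc hjp hu
  · exact N.hasLimitAlgebras hp hq (Bourdon.isRegion_compl_wedge hp hq) hjc hjp hu
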